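/- For $\tau=id$, $d>0$, let $\vartheta(z)=\sum_{n\in\mathbb Z}e^{\pi i(n+\frac12)^2\tau+2\pi i(n+\frac12)(z-\frac12)}$ be the odd Jacobi theta function. For real $a,b$ and points $p\in(0,\frac12)$, $q\in(0,\frac12)+\frac\tau2$, write $q'=-\bar q$ and let $$G(z)=\Bigl(\frac{\vartheta(z-p)}{\vartheta(z+p)}\Bigr)^{a}\Bigl(\frac{\vartheta(z-q)}{\vartheta(z-q')}\Bigr)^{b},$$ a continuous branch on the closed strip $\{0\le\operatorname{Im}z\le d/2\}$ minus the corners $\pm p+\mathbb Z$, $q+\mathbb Z$, $q'+\mathbb Z$, continued along the imaginary axis. Consider the minimal surface on the strip with Gauss map $G$ and height differential $dh=dz$, i.e. $z\mapsto\operatorname{Re}\int^z\bigl(\frac12(\frac1G-G),\frac i2(\frac1G+G),1\bigr)\,dz$, and let $F$ be its orthogonal projection to the $x_1x_2$-plane. Call $H_p=F([-p,p])\cup F([p,1-p])$ and $H_q=F([q',q])\cup F([q,1+q'])$ the two hinges, with vertices $F(p)$ and $F(q)$. **Theorem.** Let $\tau\in i\mathbb R^+$ and let $-1<a\le-\frac12$,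 $-1<b\le-\frac12$ with $a+b<-1$ (in particular $a=-\frac{r-1}{r}$, $b=-\frac{s-1}{s}$ with integers $r,s\ge2$ not both equal to $2$). Then there are $p\in(0,\frac12)$ and $q\in(0,\frac12)+\frac\tau2$ with $$a(2p-1)+b(2\operatorname{Re}(q)-1)=1$$ such that $\int_0^\tau G\,dh=0$ (integral along the imaginary axis) and the two hinges $H_p$ and $H_q$ line up as a triangle: the four boundary intervals are mapped by $F$ onto the line segments $F([-p,p])=[F(p),F(0)]$, $F([p,1-p])=[F(p),F(\frac12)]$, $F([q',q])=[F(q),F(\frac\tau2)]$, $F([q,1+q'])=[F(q),F(\frac{1+\tau}2)]$, and there is a point $C$ such that $F(p),F(q),C$ are the vertices of a nondegenerate triangle with interior angles $\pi(1+a)$ at $F(p)$ and $\pi(1+b)$ at $F(q)$, the points $F(0)$ and $F(\frac\tau2)$ lie strictly inside the side from $F(p)$ to $F(q)$, and $F(\frac12)$, $F(\frac{1+\tau}{2})$ lie on the open rays from $F(p)$ and from $F(q)$ through $C$, respectively. -/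

import Mathlib

noncomputable section

/-- The odd Jacobi theta function
`ϑ(z, τ) = ∑ₙ exp (π i (n + 1/2)² τ + 2 π i (n + 1/2) (z - 1/2))`. -/
def oddTheta (τ z : ℂ) : ℂ :=
  ∑' n : ℤ, Complex.exp (Real.pi * Complex.I * ((n : ℂ) + 1 / 2) ^ 2 * τ
    + 2 * Real.pi * Complex.I * ((n : ℂ) + 1 / 2) * (z - 1 / 2))

/-- The reflection of `w` at the imaginary axis. -/
def mirror (w : ℂ) : ℂ := -(starRingEnd ℂ w)

/-- The domain of the Gauss map: the closed strip `0 ≤ Im z ≤ Im τ / 2` without the corners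
`± p + n` and `q + n`, `-conj q + n` (`n` an integer), together with the imaginary axis, along
which the Gauss map is continued beyond the strip. -/
def gaussDomain (τ : ℂ) (p : ℝ) (q : ℂ) : Set ℂ :=
  {z | ((0 ≤ z.im ∧ z.im ≤ τ.im / 2) ∨ z.re = 0) ∧
    ∀ n : ℤ, z ≠ (p : ℂ) + n ∧ z ≠ -(p : ℂ) + n ∧ z ≠ q + n ∧ z ≠ mirror q + n}

/-- `L` is a continuous branch of `log ϑ(z - w)` on `S`. -/
def IsLogTheta (τ : ℂ) (S : Set ℂ) (w : ℂ) (L : ℂ → ℂ) : Prop :=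
  ContinuousOn L S ∧ ∀ z ∈ S, Complex.exp (L z) = oddTheta τ (z - w)

/-- `G` is (a branch of) the Gauss map
`ϑ(z - p)^a ϑ(z + p)^(-a) ϑ(z - q)^b ϑ(z - q')^(-b)`, where `q' = -conj q` is the mirror
image of `q` on the line `Im z = Im τ / 2`. Two branches differ by a constant factor of
modulus one, that is, by a rotation of the surface about the vertical axis. -/
def IsGaussMap (τ : ℂ) (a b p : ℝ) (q : ℂ) (G : ℂ → ℂ) : Prop :=
  ∃ L₁ L₂ L₃ L₄ : ℂ → ℂ,
    IsLogTheta τ (gaussDomain τ p q) p L₁ ∧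
    IsLogTheta τ (gaussDomain τ p q) (-(p : ℂ)) L₂ ∧
    IsLogTheta τ (gaussDomain τ p q) q L₃ ∧
    IsLogTheta τ (gaussDomain τ p q) (mirror q) L₄ ∧
    ∀ z ∈ gaussDomain τ p q,
      G z = Complex.exp (a * L₁ z - a * L₂ z + b * L₃ z - b * L₄ z)

/-- The integral of `f dz` along the straight segment from `u` to `v`. -/
def segmentIntegral (f : ℂ → ℂ) (u v : ℂ) : ℂ :=
  (v - u) * ∫ s in (0 : ℝ)..1, f (u + s * (v - u))

/-- The minimal surface with Gauss map `G` and height differential `dz`, parametrized on the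
closed strip by the Weierstrass representation. The base point `τ / 4` lies on the central line
of the strip, so that the path of integration meets the boundary at most at its end point `z`. -/
def weierstrassMap (τ : ℂ) (G : ℂ → ℂ) (z : ℂ) : Fin 3 → ℝ :=
  ![(segmentIntegral (fun w => 1 / 2 * (1 / G w - G w)) (τ / 4) z).re,
    (segmentIntegral (fun w => Complex.I / 2 * (1 / G w + G w)) (τ / 4) z).re,
    (segmentIntegral (fun _ => 1) (τ / 4) z).re]

/-- The orthogonal projection of the surface to the horizontal `x₁x₂`-plane, identified
with `ℂ`. -/
def planeProj (τ : ℂ) (G : ℂ → ℂ) (z : ℂ) : ℂ :=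
  ⟨weierstrassMap τ G z 0, weierstrassMap τ G z 1⟩

open EuclideanGeometry in
/-- The two hinges line up as a triangle. The hinge `H_p` is the projection of one period
`[-p, p] ∪ [p, 1 - p]` of the lower boundary line, with vertex `F p`; the hinge `H_q` is the
projection of one period `[q', q] ∪ [q, 1 + q']` of the upper boundary line, with vertex `F q`.
Each boundary interval projects onto a line segment (an arm of the hinge), which is the trace of
the vertical symmetry plane over that interval. The hinges line up if there is a
nondegenerate triangle `F p, F q, C` with angle `π (1 + a)` at `F p` and `π (1 + b)` at `F q`
such that the arms over `[-p, p]` and `[q', q]` lie on the common side from `F p` to `F q`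
(so these two symmetry planes are equal), and the other two arms issue from `F p` and `F q`
in the directions of the sides to `C`. -/
def HingesLineUp (τ : ℂ) (a b p : ℝ) (q : ℂ) (G : ℂ → ℂ) : Prop :=
  let F := planeProj τ G
  ∃ C : ℂ, AffineIndependent ℝ ![F p, F q, C] ∧
    ∠ (F q) (F p) C = Real.pi * (1 + a) ∧
    ∠ (F p) (F q) C = Real.pi * (1 + b) ∧
    F '' segment ℝ (-(p : ℂ)) p = segment ℝ (F p) (F 0) ∧
    F '' segment ℝ (p : ℂ) (1 - p) = segment ℝ (F p) (F (1 / 2)) ∧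
    F '' segment ℝ (mirror q) q = segment ℝ (F q) (F (τ / 2)) ∧
    F '' segment ℝ q (1 + mirror q) = segment ℝ (F q) (F (1 / 2 + τ / 2)) ∧
    Sbtw ℝ (F p) (F 0) (F q) ∧
    Sbtw ℝ (F p) (F (τ / 2)) (F q) ∧
    (∃ s : ℝ, 0 < s ∧ F (1 / 2) = F p + s * (C - F p)) ∧
    (∃ s : ℝ, 0 < s ∧ F (1 / 2 + τ / 2) = F q + s * (C - F q))

end

/-!
Write `τ = i d` and `q = y + i d / 2`. The proof reduces the theorem to one real equation in `p`
and `y` and solves that equation by the intermediate value theorem.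

**A logarithm of the Gauss map.** By the Jacobi triple product (`jacobiTheta₂_eq_tprod`), proved
here from the finite `q`-binomial theorem, `ϑ` has an explicit logarithm in the strip, a sum of
logarithms of factors `1 - w` with `‖w‖ ≤ 1`. This gives a logarithm `logRatio` of
`ϑ(z - p) / ϑ(z + p)`, which is antisymmetric under `z ↦ -conj z`, and the monotonicity facts
that are needed hold factor by factor: `|ϑ(z - p)| < |ϑ(z + p)|` for `0 < Re z < 1 / 2`
(`logRatio_re_neg`), and the argument of the quotient decreases strictly along the imaginary axis
from `π` at `0` to `2 π p` at `τ / 2` (`axisArg_strictAnti`). The reflection `stripFlip` of the strip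
at its central line exchanges the roles of `(a, p)` and `(b, y)`. So `gaussModel` is an explicit
Gauss map on the strip, and since the strip without corners is star-shaped about `τ / 4`, every
branch is a rotation of it (`IsGaussMap.eq_gaussModel`).

**The hinges.** On the open intervals between corners of the real line `G / |G|` is constant and
the projection moves with velocity `-sinh (log |G|) G / |G|` (`planeProj_gaussModel`). The function
`log |G|` is odd about the midpoint of each interval and has a sign on each half, so that the
interval is folded onto a segment (`image_eq_segment_of_odd_speed`). As `|G|` and `1 / |G|` grow at
most like `(Im z) ^ a` with `a > -1`, the projection is continuous at the corners too, and the jump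
`π a` of `arg G` at the corner gives the angle `π (1 + a)` of the hinge (`lowerHinge`). Reflection
gives the upper hinge (`upperHinge`).

**The period condition.** On the imaginary axis `|G| = 1`. Let `φ` be the argument of `G` there,
relative to its value at `0` (`relPhase`). The equation `a (2p - 1) + b (2y - 1) = 1` says that `φ`
reaches the value `π` at `τ / 2`. Because `G (τ - z) G (z)` is constant on the axis, both
`∫₀^τ G dz = 0` (`IsGaussMap.period_eq_zero`) and the statement that `F (τ / 2) - F 0` is a positive
multiple of the direction `F 0 - F p` (`planeProj_axis`) follow from `∫ cos φ = 0` over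
`[0, d / 2]`; the positive factor is `∫ sin φ`, as `0 < φ < π`. On the line
`a (2p - 1) + b (2y - 1) = 1`, the integral of `cos φ` is positive at the end `y = 0` and negative at
the end `p = 0`; this is where `a, b ≤ -1 / 2` is used (`exists_period_solution`).

**The triangle.** With the period condition, `F p`, `F 0`, `F (τ / 2)` and `F q` lie in this order on
a line. The other two arms leave the end points on the same side, at the angles `π (1 + a)` and
`π (1 + b)`, whose sum is less than `π`, so they point to the third vertex of a triangle
(`exists_triangle`, `hingesLineUp_gaussModel`).
-/

/-! ### The Jacobi triple product -/

/-- The finite `q`-Pochhammer product `(1 - Q) (1 - Q²) ⋯ (1 - Q ^ m)`. -/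
def qFactorial (Q : ℂ) (m : ℕ) : ℂ := ∏ k ∈ Finset.range m, (1 - Q ^ (k + 1))

/-- The Gaussian binomial coefficient, defined by its Pascal recursion. -/
def gaussBinom (Q : ℂ) : ℕ → ℕ → ℂ
  | _, 0 => 1
  | 0, _ + 1 => 0
  | M + 1, m + 1 => gaussBinom Q M (m + 1) + gaussBinom Q M m * Q ^ (M - m)

lemma gaussBinom_zero_right (Q : ℂ) (M : ℕ) : gaussBinom Q M 0 = 1 := by
  cases M <;> simp [gaussBinom]

lemma gaussBinom_eq_zero (Q : ℂ) : ∀ {M m : ℕ}, M < m → gaussBinom Q M m = 0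
  | 0, m + 1, _ => by simp [gaussBinom]
  | M + 1, m + 1, h => by
    simp [gaussBinom, gaussBinom_eq_zero Q (show M < m + 1 by omega),
      gaussBinom_eq_zero Q (show M < m by omega)]

lemma gaussBinom_self (Q : ℂ) (M : ℕ) : gaussBinom Q M M = 1 := by
  induction M with
  | zero => simp [gaussBinom]
  | succ M ih => simp [gaussBinom, gaussBinom_eq_zero, ih]

lemma gaussBinom_mul_qFactorial (Q : ℂ) (m k : ℕ) :
    gaussBinom Q (m + k) m * (qFactorial Q m * qFactorial Q k) = qFactorial Q (m + k) := by
  induction h : m + k generalizing m k with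
  | zero =>
    obtain ⟨rfl, rfl⟩ : m = 0 ∧ k = 0 := by omega
    simp [gaussBinom, qFactorial]
  | succ M ih =>
    rcases m with _ | m
    · obtain rfl : k = M + 1 := by omega
      simp [gaussBinom, qFactorial]
    rcases k with _ | k
    · obtain rfl : m = M := by omega
      rw [gaussBinom_self]
      simp [qFactorial]
    have h1 := ih (m + 1) k (by omega)
    have h2 := ih m (k + 1) (by omega)
    have hM : M - m = k + 1 := by omega
    have e1 : ∀ j, qFactorial Q (j + 1) = qFactorial Q j * (1 - Q ^ (j + 1)) := fun j => by
      simp [qFactorial, Finset.prod_range_succ]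
    simp only [gaussBinom, hM]
    rw [e1 M, show M + 1 = (m + 1) + (k + 1) by omega, pow_add Q (m + 1)]
    rw [e1 k, e1 m] at *
    linear_combination (1 - Q ^ (k + 1)) * h1 + Q ^ (k + 1) * (1 - Q ^ (m + 1)) * h2

/-- The finite `q`-binomial theorem. -/
lemma prod_one_add_mul_pow (Q x : ℂ) (M : ℕ) :
    ∏ k ∈ Finset.range M, (1 + x * Q ^ k)
      = ∑ m ∈ Finset.range (M + 1), gaussBinom Q M m * Q ^ (m.choose 2) * x ^ m := by
  induction M with
  | zero => simp [gaussBinom]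
  | succ M ih =>
    rw [Finset.prod_range_succ, ih, Finset.sum_range_succ' _ (M + 1)]
    have h1 : ∀ m ∈ Finset.range (M + 1), gaussBinom Q (M + 1) (m + 1) * Q ^ ((m + 1).choose 2)
          * x ^ (m + 1) = gaussBinom Q M (m + 1) * Q ^ ((m + 1).choose 2) * x ^ (m + 1)
          + gaussBinom Q M m * Q ^ (m.choose 2) * x ^ m * (x * Q ^ M) := by
      intro m hm
      have hm' : m ≤ M := by simpa [Nat.lt_succ_iff] using hm
      have e : (m + 1).choose 2 = m + m.choose 2 := by
        rw [Nat.choose_succ_succ' m 1]; simp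
      have e2 : Q ^ M = Q ^ (M - m) * Q ^ m := by rw [← pow_add]; congr 1; omega
      simp only [gaussBinom, e, e2, pow_add]
      ring
    rw [Finset.sum_congr rfl h1, Finset.sum_add_distrib, ← Finset.sum_mul]
    have h2 := Finset.sum_range_succ' (fun m => gaussBinom Q M m * Q ^ (m.choose 2) * x ^ m) (M + 1)
    rw [Finset.sum_range_succ, gaussBinom_eq_zero Q (Nat.lt_succ_self M)] at h2
    simp only [gaussBinom_zero_right] at h2 ⊢
    linear_combination h2

/-- The finite form of the triple product, obtained from the `q`-binomial theorem of order `2 N`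
by centring the exponents. -/
lemma prod_triple_finite {q w : ℂ} (hq : q ≠ 0) (hw : w ≠ 0) (N : ℕ) :
    (∏ n ∈ Finset.range N, (1 + q ^ (2 * n + 1) * w)) *
      (∏ n ∈ Finset.range N, (1 + q ^ (2 * n + 1) * w⁻¹))
    = ∑ m ∈ Finset.range (2 * N + 1), gaussBinom (q ^ 2) (2 * N) m *
        (q ^ (((m : ℤ) - N) ^ 2) * w ^ ((m : ℤ) - N)) := by
  have key := prod_one_add_mul_pow (q ^ 2) (w * q ^ (1 - 2 * (N : ℤ))) (2 * N)
  rw [two_mul N, Finset.prod_range_add] at key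
  have hB : ∏ k ∈ Finset.range N, (1 + w * q ^ (1 - 2 * (N : ℤ)) * (q ^ 2) ^ (N + k))
      = ∏ n ∈ Finset.range N, (1 + q ^ (2 * n + 1) * w) := by
    refine Finset.prod_congr rfl fun k _ => ?_
    have : q ^ (1 - 2 * (N : ℤ)) * (q ^ 2) ^ (N + k) = q ^ (2 * k + 1) := by
      rw [← zpow_natCast (q ^ 2), ← zpow_natCast q 2, ← zpow_mul, ← zpow_add₀ hq, ← zpow_natCast q]
      congr 1; push_cast; ring
    rw [mul_assoc, this, mul_comm]
  have hA : ∏ k ∈ Finset.range N, (1 + w * q ^ (1 - 2 * (N : ℤ)) * (q ^ 2) ^ k)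
      = w ^ N * q ^ (-(N : ℤ) ^ 2) * ∏ n ∈ Finset.range N, (1 + q ^ (2 * n + 1) * w⁻¹) := by
    rw [← Finset.prod_range_reflect]
    have : ∀ k ∈ Finset.range N, (1 + w * q ^ (1 - 2 * (N : ℤ)) * (q ^ 2) ^ (N - 1 - k))
        = (w * q ^ (-(2 * (k : ℤ) + 1))) * (1 + q ^ (2 * k + 1) * w⁻¹) := by
      intro k hk
      have hk' : k < N := Finset.mem_range.1 hk
      have e1 : q ^ (1 - 2 * (N : ℤ)) * (q ^ 2) ^ (N - 1 - k) = q ^ (-(2 * (k : ℤ) + 1)) := by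
        rw [← zpow_natCast (q ^ 2), ← zpow_natCast q 2, ← zpow_mul, ← zpow_add₀ hq,
          Nat.sub_sub, Nat.cast_sub (by omega)]
        congr 1; push_cast; ring
      have e2 : q ^ (-(2 * (k : ℤ) + 1)) * q ^ (2 * k + 1) = 1 := by
        rw [← zpow_natCast q, ← zpow_add₀ hq]; push_cast; simp
      rw [mul_assoc, e1, mul_add, mul_one]
      have e3 : w * q ^ (-(2 * (k : ℤ) + 1)) * (q ^ (2 * k + 1) * w⁻¹) = 1 := by
        rw [show w * q ^ (-(2 * (k : ℤ) + 1)) * (q ^ (2 * k + 1) * w⁻¹)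
          = (q ^ (-(2 * (k : ℤ) + 1)) * q ^ (2 * k + 1)) * (w * w⁻¹) by ring, e2,
          mul_inv_cancel₀ hw, one_mul]
      rw [e3]; ring
    rw [Finset.prod_congr rfl this, Finset.prod_mul_distrib, Finset.prod_mul_distrib]
    congr 1
    rw [Finset.prod_const, Finset.card_range]
    congr 1
    clear key hB this
    induction N with
    | zero => simp
    | succ N ih =>
      rw [Finset.prod_range_succ, ih, ← zpow_add₀ hq]; congr 1; push_cast; ring
  rw [hA, hB] at key
  have hne : w ^ N * q ^ (-(N : ℤ) ^ 2) ≠ 0 := by positivity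
  apply mul_left_cancel₀ hne
  rw [← two_mul] at key
  rw [Finset.mul_sum]
  rw [show ∀ a b c : ℂ, a * (b * c) = a * c * b by intros; ring, key]
  refine Finset.sum_congr rfl fun m _ => ?_
  rw [mul_pow, mul_assoc, mul_left_comm, ← mul_assoc (w ^ N * _)]
  rw [show ∀ a b c d e : ℂ, (a * b) * c * (d * e) = c * ((b * d) * (a * e)) by intros; ring,
    ← zpow_add₀ hq, ← zpow_natCast w N, ← zpow_add₀ hw]
  rw [mul_left_comm]
  congr 1
  rw [mul_left_comm, mul_comm (w ^ m)]
  congr 1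
  · rw [← pow_mul, ← zpow_natCast q, ← zpow_natCast (q ^ _), ← zpow_mul, ← zpow_add₀ hq]
    congr 1
    have : ((2 * m.choose 2 : ℕ) : ℤ) = m * (m - 1) := by
      rw [Nat.choose_two_right, Nat.mul_div_cancel' (Nat.even_mul_pred_self m).two_dvd]
      rcases m with _ | m <;> simp
    rw [this]; ring
  · rw [← zpow_natCast w]; congr 1; ring

lemma qFactorial_ne_zero {Q : ℂ} (hQ : ‖Q‖ < 1) (m : ℕ) : qFactorial Q m ≠ 0 := by
  refine Finset.prod_ne_zero_iff.2 fun k _ h => ?_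
  have : ‖Q ^ (k + 1)‖ < 1 := by
    rw [norm_pow]; exact pow_lt_one₀ (norm_nonneg _) hQ (by omega)
  rw [← sub_eq_zero.1 h] at this
  simp at this

lemma summable_geom_mul {Q : ℂ} (hQ : ‖Q‖ < 1) (w : ℂ) : Summable fun n : ℕ => ‖Q ^ n * w‖ := by
  simp only [norm_mul, norm_pow]
  exact (summable_geometric_of_lt_one (norm_nonneg _) hQ).mul_right _

lemma multipliable_one_sub_geom {Q : ℂ} (hQ : ‖Q‖ < 1) (w : ℂ) :
    Multipliable fun n : ℕ => 1 - Q ^ n * w := by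
  have : Summable fun n : ℕ => ‖-(Q ^ n * w)‖ := by simpa using summable_geom_mul hQ w
  simpa [sub_eq_add_neg] using multipliable_one_add_of_summable this

lemma tprod_one_sub_geom {Q : ℂ} (hQ : ‖Q‖ < 1) (w : ℂ) :
    ∏' n : ℕ, (1 - Q ^ n * w) = (1 - w) * ∏' n : ℕ, (1 - Q ^ n * (Q * w)) := by
  have e : ∀ n : ℕ, 1 - Q ^ n * (Q * w) = 1 - Q ^ (n + 1) * w := fun n => by ring
  have hmul := multipliable_one_sub_geom hQ (Q * w)
  simp only [e] at hmul ⊢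
  rw [tprod_eq_zero_mul' (f := fun n => 1 - Q ^ n * w) hmul, pow_zero, one_mul]

/-- The Euler product `∏ (1 - Q ^ (n + 1))`. -/
noncomputable def eulerProd (Q : ℂ) : ℂ := ∏' n : ℕ, (1 - Q ^ n * Q)

lemma eulerProd_ne_zero {Q : ℂ} (hQ : ‖Q‖ < 1) : eulerProd Q ≠ 0 := by
  have h : Summable fun n : ℕ => ‖-(Q ^ n * Q)‖ := by simpa using summable_geom_mul hQ Q
  have := tprod_one_add_ne_zero_of_summable (f := fun n : ℕ => -(Q ^ n * Q)) (fun n hn => ?_) h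
  · simpa [eulerProd, sub_eq_add_neg] using this
  · have := qFactorial_ne_zero hQ (n + 1)
    rw [qFactorial, Finset.prod_range_succ] at this
    apply this
    rw [pow_succ, sub_eq_add_neg, hn, mul_zero]

lemma tendsto_qFactorial {Q : ℂ} (hQ : ‖Q‖ < 1) :
    Filter.Tendsto (qFactorial Q) Filter.atTop (nhds (eulerProd Q)) := by
  have := (multipliable_one_sub_geom hQ Q).hasProd.tendsto_prod_nat
  simp only [← pow_succ] at this
  rw [eulerProd]
  simp only [← pow_succ]
  exact this

open Filter Topology in
/-- **Jacobi triple product**, in the notation of `jacobiTheta₂`. -/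
theorem jacobiTheta₂_eq_tprod (z : ℂ) {τ : ℂ} (hτ : 0 < τ.im) {q w : ℂ}
    (hq : q = Complex.exp (Real.pi * Complex.I * τ))
    (hw : w = Complex.exp (2 * Real.pi * Complex.I * z)) :
    jacobiTheta₂ z τ = eulerProd (q ^ 2) * ((∏' n : ℕ, (1 - (q ^ 2) ^ n * (-q * w))) *
      ∏' n : ℕ, (1 - (q ^ 2) ^ n * (-q * w⁻¹))) := by
  have hq0 : q ≠ 0 := hq ▸ Complex.exp_ne_zero _
  have hw0 : w ≠ 0 := hw ▸ Complex.exp_ne_zero _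
  have hq1 : ‖q‖ < 1 := by
    rw [hq, Complex.norm_exp]
    simp
    positivity
  have hQ : ‖q ^ 2‖ < 1 := by
    rw [norm_pow]; exact pow_lt_one₀ (norm_nonneg _) hq1 (by norm_num)
  have hterm : ∀ j : ℤ, jacobiTheta₂_term j z τ = q ^ (j ^ 2) * w ^ j := by
    intro j
    rw [jacobiTheta₂_term, hq, hw, ← Complex.exp_int_mul, ← Complex.exp_int_mul, ← Complex.exp_add]
    congr 1; push_cast; ring
  -- the coefficient of `q ^ j² w ^ j` in the finite product of order `N`
  set c : ℕ → ℤ → ℂ := fun N j =>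
    if j ∈ Set.Icc (-(N : ℤ)) N then gaussBinom (q ^ 2) (2 * N) (N + j).toNat else 0 with hc
  have hcoef : ∀ (N : ℕ) (j : ℤ), j ∈ Set.Icc (-(N : ℤ)) N → c N j =
      qFactorial (q ^ 2) (2 * N) *
        ((qFactorial (q ^ 2) (N + j).toNat)⁻¹ * (qFactorial (q ^ 2) (N - j).toNat)⁻¹) := by
    intro N j hj
    have hj' := hj
    obtain ⟨h1, h2⟩ := hj'
    have := gaussBinom_mul_qFactorial (q ^ 2) (N + j).toNat (N - j).toNat
    rw [show (N + j).toNat + (N - j).toNat = 2 * N by omega] at this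
    simp only [hc, if_pos hj]
    rw [← this]
    field_simp [qFactorial_ne_zero hQ]
  have hsum : ∀ N : ℕ, ∑' j : ℤ, c N j * jacobiTheta₂_term j z τ =
      (∏ n ∈ Finset.range N, (1 - (q ^ 2) ^ n * (-q * w))) *
        ∏ n ∈ Finset.range N, (1 - (q ^ 2) ^ n * (-q * w⁻¹)) := by
    intro N
    have e : ∀ x : ℂ, ∏ n ∈ Finset.range N, (1 - (q ^ 2) ^ n * (-q * x))
        = ∏ n ∈ Finset.range N, (1 + q ^ (2 * n + 1) * x) := fun x =>
      Finset.prod_congr rfl fun n _ => by rw [← pow_mul, pow_succ]; ring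
    rw [e, e, prod_triple_finite hq0 hw0]
    have hinj : Function.Injective fun m : ℕ => (m : ℤ) - N := fun a b h => by
      simpa using h
    rw [tsum_eq_sum (s := (Finset.range (2 * N + 1)).map ⟨_, hinj⟩), Finset.sum_map]
    · refine Finset.sum_congr rfl fun m hm => ?_
      have hm' : m < 2 * N + 1 := Finset.mem_range.1 hm
      have hmem : (m : ℤ) - N ∈ Set.Icc (-(N : ℤ)) N := by constructor <;> omega
      simp only [Function.Embedding.coeFn_mk, hterm, hc, if_pos hmem]
      congr 3; omega
    · intro j hj
      have : j ∉ Set.Icc (-(N : ℤ)) N := by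
        rintro ⟨h1, h2⟩
        apply hj
        simp only [Finset.mem_map, Finset.mem_range, Function.Embedding.coeFn_mk]
        exact ⟨(j + N).toNat, by omega, by omega⟩
      simp only [hc, if_neg this, zero_mul]
  obtain ⟨B, hB⟩ : ∃ B, ∀ m, ‖qFactorial (q ^ 2) m‖ ≤ B := by
    obtain ⟨B, hB⟩ := (Metric.isBounded_range_of_tendsto _ (tendsto_qFactorial hQ)).exists_norm_le
    exact ⟨B, fun m => hB _ ⟨m, rfl⟩⟩
  have hinv := (tendsto_qFactorial hQ).inv₀ (eulerProd_ne_zero hQ)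
  obtain ⟨B', hB'⟩ : ∃ B, ∀ m, ‖(qFactorial (q ^ 2) m)⁻¹‖ ≤ B := by
    obtain ⟨B, hB⟩ := (Metric.isBounded_range_of_tendsto _ hinv).exists_norm_le
    exact ⟨B, fun m => hB _ ⟨m, rfl⟩⟩
  have hB0 : 0 ≤ B := (norm_nonneg _).trans (hB 0)
  have hB0' : 0 ≤ B' := (norm_nonneg _).trans (hB' 0)
  have hlim : Tendsto (fun N : ℕ => ∑' j : ℤ, c N j * jacobiTheta₂_term j z τ) atTop
      (𝓝 (∑' j : ℤ, (eulerProd (q ^ 2))⁻¹ * jacobiTheta₂_term j z τ)) := by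
    refine tendsto_tsum_of_dominated_convergence
      (bound := fun j => B * (B' * B') * ‖jacobiTheta₂_term j z τ‖)
      (((summable_jacobiTheta₂_term_iff z τ).2 hτ).norm.mul_left _) (fun j => ?_)
      (Eventually.of_forall fun N j => ?_)
    · refine Tendsto.mul_const _ ?_
      have hT : ∀ i : ℤ, Tendsto (fun N : ℕ => ((N : ℤ) + i).toNat) atTop atTop := fun i => by
        refine tendsto_atTop.2 fun b => ?_
        filter_upwards [eventually_ge_atTop (b + i.natAbs)] with N hN
        omega
      have h2 : Tendsto (fun N : ℕ => 2 * N) atTop atTop :=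
        tendsto_atTop.2 fun b => by
          filter_upwards [eventually_ge_atTop b] with N hN
          omega
      have := ((tendsto_qFactorial hQ).comp h2).mul
        ((hinv.comp (hT j)).mul (hinv.comp (hT (-j))))
      rw [← mul_assoc, mul_inv_cancel₀ (eulerProd_ne_zero hQ), one_mul] at this
      refine this.congr' ?_
      filter_upwards [eventually_ge_atTop j.natAbs] with N hN
      rw [hcoef N j ⟨by omega, by omega⟩]
      rfl
    · rw [norm_mul]
      refine mul_le_mul_of_nonneg_right ?_ (norm_nonneg _)
      by_cases hj : j ∈ Set.Icc (-(N : ℤ)) N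
      · rw [hcoef N j hj, norm_mul, norm_mul]
        gcongr
        exacts [hB _, hB' _, hB' _]
      · simp only [hc, if_neg hj, norm_zero]
        positivity
  have hprod := ((multipliable_one_sub_geom hQ (-q * w)).hasProd.tendsto_prod_nat).mul
    ((multipliable_one_sub_geom hQ (-q * w⁻¹)).hasProd.tendsto_prod_nat)
  simp only [← hsum] at hprod
  have := tendsto_nhds_unique hprod hlim
  rw [this, tsum_mul_left, mul_inv_cancel_left₀ (eulerProd_ne_zero hQ), jacobiTheta₂]

/-- The product formula for the odd theta function: with `h = exp (-π d)`, the function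
`ϑ(u)` is a nonzero multiple of `exp (-π i u) (e^{2πiu}; h²)_∞ (h² e^{-2πiu}; h²)_∞`. -/
theorem oddTheta_eq_tprod {d : ℝ} (hd : 0 < d) : ∃ c : ℂ, c ≠ 0 ∧ ∀ u : ℂ,
    oddTheta (d * Complex.I) u = c * (Complex.exp (-(Real.pi * Complex.I * u)) *
      ((∏' n : ℕ, (1 - (Real.exp (-2 * Real.pi * d) : ℂ) ^ n *
          Complex.exp (2 * Real.pi * Complex.I * u))) *
        ∏' n : ℕ, (1 - (Real.exp (-2 * Real.pi * d) : ℂ) ^ n *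
          (Real.exp (-2 * Real.pi * d) * Complex.exp (-(2 * Real.pi * Complex.I * u)))))) := by
  set Q : ℂ := (Real.exp (-2 * Real.pi * d) : ℂ) with hQdef
  have hτ : 0 < ((d : ℂ) * Complex.I).im := by simpa using hd
  set q : ℂ := Complex.exp (Real.pi * Complex.I * (d * Complex.I)) with hq
  have hqQ : q ^ 2 = Q := by
    rw [hQdef, hq, ← Complex.exp_nat_mul, Complex.ofReal_exp]; congr 1
    push_cast
    linear_combination (2 * Real.pi * d : ℂ) * Complex.I_sq
  have hQ : ‖Q‖ < 1 := by
    rw [hQdef, Complex.norm_real, Real.norm_eq_abs, Real.abs_exp, Real.exp_lt_one_iff]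
    have := mul_pos Real.pi_pos hd
    linarith
  have hodd : ∀ u : ℂ, oddTheta (d * Complex.I) u =
      Complex.exp (Real.pi * Complex.I * (d * Complex.I) / 4 + Real.pi * Complex.I / 2) *
        Complex.exp (-(Real.pi * Complex.I * u)) *
        jacobiTheta₂ (u - 1 / 2 - d * Complex.I / 2) (d * Complex.I) := by
    intro u
    rw [oddTheta, jacobiTheta₂, ← (Equiv.addRight (1 : ℤ)).tsum_eq
      (jacobiTheta₂_term · _ _), ← tsum_mul_left]
    refine tsum_congr fun n => ?_
    rw [jacobiTheta₂_term, ← Complex.exp_add, ← Complex.exp_add]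
    congr 1
    simp only [Equiv.coe_addRight]
    push_cast
    ring
  refine ⟨Complex.exp (Real.pi * Complex.I * (d * Complex.I) / 4 + Real.pi * Complex.I / 2) *
    eulerProd Q, mul_ne_zero (Complex.exp_ne_zero _) (eulerProd_ne_zero hQ), fun u => ?_⟩
  have hhalf : Complex.exp (Real.pi * Complex.I) = -1 := Complex.exp_pi_mul_I
  have e1 : -q * Complex.exp (2 * Real.pi * Complex.I * (u - 1 / 2 - d * Complex.I / 2))
      = Complex.exp (2 * Real.pi * Complex.I * u) := by
    rw [neg_eq_neg_one_mul, ← hhalf, hq, ← Complex.exp_add, ← Complex.exp_add]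
    congr 1; ring
  have e2 : -q * (Complex.exp (2 * Real.pi * Complex.I * (u - 1 / 2 - d * Complex.I / 2)))⁻¹
      = Q * Complex.exp (-(2 * Real.pi * Complex.I * u)) := by
    have hhalf' : Complex.exp (-(Real.pi * Complex.I)) = -1 := by
      rw [Complex.exp_neg, hhalf]; norm_num
    rw [neg_eq_neg_one_mul, ← hhalf', ← hqQ, hq, ← Complex.exp_neg, ← Complex.exp_nat_mul,
      ← Complex.exp_add, ← Complex.exp_add, ← Complex.exp_add]
    congr 1; push_cast; ring
  rw [hodd, jacobiTheta₂_eq_tprod _ hτ hq rfl, hqQ, e1, e2]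
  ring

/-! ### The logarithm of the `q`-Pochhammer symbol -/

/-- The square `exp (-2πd)` of the nome of the lattice `ℤ + i d ℤ`. -/
noncomputable def nomeSq (d : ℝ) : ℝ := Real.exp (-2 * Real.pi * d)

lemma nomeSq_pos (d : ℝ) : 0 < nomeSq d := Real.exp_pos _

lemma nomeSq_lt_one {d : ℝ} (hd : 0 < d) : nomeSq d < 1 := by
  rw [nomeSq, Real.exp_lt_one_iff]
  have := mul_pos Real.pi_pos hd
  linarith

lemma norm_nomeSq_lt_one {d : ℝ} (hd : 0 < d) : ‖(nomeSq d : ℂ)‖ < 1 := by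
  rw [Complex.norm_real, Real.norm_of_nonneg (nomeSq_pos d).le]
  exact nomeSq_lt_one hd

/-- The logarithm `∑ log (1 - Q ^ n w)` of the `q`-Pochhammer symbol `(w; Q)_∞`, where
`Q = exp (-2πd)`, with principal branches in each term. -/
noncomputable def logPoch (d : ℝ) (w : ℂ) : ℂ :=
  ∑' n : ℕ, Complex.log (1 - (nomeSq d : ℂ) ^ n * w)

lemma summable_logPoch {d : ℝ} (hd : 0 < d) (w : ℂ) :
    Summable fun n : ℕ => Complex.log (1 - (nomeSq d : ℂ) ^ n * w) := by
  have := (summable_geom_mul (norm_nomeSq_lt_one hd) w).of_norm.neg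
  simpa [sub_eq_add_neg] using Complex.summable_log_one_add_of_summable this

lemma norm_nomeSq_pow_mul_le {d : ℝ} (hd : 0 < d) (n : ℕ) (w : ℂ) :
    ‖(nomeSq d : ℂ) ^ n * w‖ ≤ ‖w‖ := by
  rw [norm_mul, norm_pow]
  exact mul_le_of_le_one_left (norm_nonneg _)
    (pow_le_one₀ (norm_nonneg _) (norm_nomeSq_lt_one hd).le)

lemma one_sub_re_pos {w : ℂ} (hw : ‖w‖ ≤ 1) (hw1 : w ≠ 1) : 0 < (1 - w).re := by
  have h1 := (Complex.re_le_norm w).trans hw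
  rcases h1.lt_or_eq with h | h
  · simpa using h
  · exfalso
    apply hw1
    have h2 := Complex.sq_norm w
    rw [Complex.normSq_apply, h] at h2
    have : w.im = 0 := by
      have : ‖w‖ ^ 2 ≤ 1 := pow_le_one₀ (norm_nonneg _) hw
      nlinarith [sq_nonneg w.im]
    exact Complex.ext (by simpa using h) (by simpa using this)

lemma one_sub_mem_slitPlane {w : ℂ} (hw : ‖w‖ ≤ 1) (hw1 : w ≠ 1) : 1 - w ∈ Complex.slitPlane :=
  Or.inl (one_sub_re_pos hw hw1)

lemma ne_one_of_norm_lt {w : ℂ} (hw : ‖w‖ < 1) : w ≠ 1 := by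
  rintro rfl
  simp at hw

lemma exp_logPoch {d : ℝ} (hd : 0 < d) {w : ℂ} (hw : ‖w‖ < 1) :
    Complex.exp (logPoch d w) = ∏' n : ℕ, (1 - (nomeSq d : ℂ) ^ n * w) := by
  refine Complex.cexp_tsum_eq_tprod (fun n => ?_) (summable_logPoch hd w)
  exact sub_ne_zero.2 (ne_one_of_norm_lt ((norm_nomeSq_pow_mul_le hd n w).trans_lt hw)).symm

lemma log_one_sub_conj {w : ℂ} (hw : ‖w‖ ≤ 1) :
    Complex.log (1 - (starRingEnd ℂ) w) = (starRingEnd ℂ) (Complex.log (1 - w)) := by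
  rcases eq_or_ne w 1 with rfl | hw1
  · simp
  rw [← Complex.log_conj _ (Complex.slitPlane_arg_ne_pi (one_sub_mem_slitPlane hw hw1))]
  simp

lemma logPoch_conj {d : ℝ} (hd : 0 < d) {w : ℂ} (hw : ‖w‖ ≤ 1) :
    logPoch d ((starRingEnd ℂ) w) = (starRingEnd ℂ) (logPoch d w) := by
  rw [logPoch, logPoch, Complex.conj_tsum]
  refine tsum_congr fun n => ?_
  rw [← log_one_sub_conj ((norm_nomeSq_pow_mul_le hd n w).trans hw)]
  simp

/-- The recursion `(w; Q)_∞ = (1 - w) (Q w; Q)_∞`. -/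
lemma logPoch_eq_log_add {d : ℝ} (hd : 0 < d) (w : ℂ) :
    logPoch d w = Complex.log (1 - w) + logPoch d (nomeSq d * w) := by
  rw [logPoch, (summable_logPoch hd w).tsum_eq_zero_add, logPoch]
  simp [pow_succ, mul_assoc]

lemma differentiableOn_logPoch {d : ℝ} (hd : 0 < d) :
    DifferentiableOn ℂ (logPoch d) (Metric.ball 0 1) := by
  intro w hw
  have hw' : ‖w‖ < 1 := by simpa using hw
  obtain ⟨r, hr, hr1⟩ := exists_between hw'
  have hr0 : 0 ≤ r := (norm_nonneg _).trans hr.le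
  refine (DifferentiableOn.differentiableAt ?_
    (Metric.isOpen_ball.mem_nhds (show w ∈ Metric.ball 0 r by simpa using hr))
    ).differentiableWithinAt
  have hnorm : ∀ x ∈ Metric.ball (0 : ℂ) r, ‖x‖ ≤ 1 := fun x hx => by
    have : ‖x‖ < r := by simpa using hx
    linarith
  refine Complex.differentiableOn_tsum_of_summable_norm
    (u := fun n => nomeSq d ^ n * (r ^ 2 * (1 - r)⁻¹ / 2 + r)) ?_ (fun n => ?_)
    Metric.isOpen_ball fun n x hx => ?_
  · exact (summable_geometric_of_lt_one (nomeSq_pos d).le (nomeSq_lt_one hd)).mul_right _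
  · intro x hx
    have hx' : ‖x‖ < 1 := by
      have : ‖x‖ < r := by simpa using hx
      linarith
    have hlt := (norm_nomeSq_pow_mul_le hd n x).trans_lt hx'
    exact (((differentiableAt_id.const_mul _).const_sub 1).clog
      (one_sub_mem_slitPlane hlt.le (ne_one_of_norm_lt hlt))).differentiableWithinAt
  · have hx' : ‖x‖ < r := by simpa using hx
    set z : ℂ := -((nomeSq d : ℂ) ^ n * x) with hz
    have hzr : ‖z‖ ≤ r := by
      rw [hz, norm_neg]; exact (norm_nomeSq_pow_mul_le hd n x).trans hx'.le
    have hzn : ‖z‖ ≤ nomeSq d ^ n * r := by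
      rw [hz, norm_neg, norm_mul, norm_pow, Complex.norm_real,
        Real.norm_of_nonneg (nomeSq_pos d).le]
      exact mul_le_mul_of_nonneg_left hx'.le (pow_nonneg (nomeSq_pos d).le _)
    rw [sub_eq_add_neg]
    refine (Complex.norm_log_one_add_le (hzr.trans_lt hr1)).trans ?_
    have h1 : (1 - ‖z‖)⁻¹ ≤ (1 - r)⁻¹ := inv_anti₀ (by linarith) (by linarith)
    have h2 : ‖z‖ ^ 2 ≤ nomeSq d ^ n * r * r := by
      rw [sq]; exact mul_le_mul hzn hzr (norm_nonneg _) ((norm_nonneg _).trans hzn)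
    have h3 : ‖z‖ ^ 2 * (1 - ‖z‖)⁻¹ ≤ nomeSq d ^ n * r * r * (1 - r)⁻¹ :=
      mul_le_mul h2 h1 (inv_nonneg.2 (by linarith)) ((sq_nonneg _).trans h2)
    calc _ ≤ nomeSq d ^ n * r * r * (1 - r)⁻¹ / 2 + nomeSq d ^ n * r := by linarith
      _ = _ := by ring

lemma exists_norm_logPoch_le {d : ℝ} (hd : 0 < d) {r : ℝ} (hr : r < 1) :
    ∃ C, ∀ w : ℂ, ‖w‖ ≤ r → ‖logPoch d w‖ ≤ C := by
  have hsub : Metric.closedBall (0 : ℂ) r ⊆ Metric.ball 0 1 :=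
    Metric.closedBall_subset_ball hr
  obtain ⟨C, hC⟩ := (isCompact_closedBall (0 : ℂ) r).exists_bound_of_continuousOn
    ((differentiableOn_logPoch hd).continuousOn.mono hsub)
  exact ⟨C, fun w hw => hC w (by simpa using hw)⟩

lemma norm_one_sub_le_of_re_le {v w : ℂ} (h : ‖v‖ = ‖w‖) (hre : w.re ≤ v.re) :
    ‖1 - v‖ ≤ ‖1 - w‖ := by
  have e : ∀ u : ℂ, ‖1 - u‖ ^ 2 = 1 - 2 * u.re + ‖u‖ ^ 2 := fun u => by
    rw [Complex.sq_norm, Complex.sq_norm, Complex.normSq_apply, Complex.normSq_apply]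
    simp; ring
  rw [← abs_of_nonneg (norm_nonneg (1 - v)), ← abs_of_nonneg (norm_nonneg (1 - w)),
    ← sq_le_sq, e, e, h]
  linarith

lemma norm_one_sub_lt_of_re_lt {v w : ℂ} (h : ‖v‖ = ‖w‖) (hre : w.re < v.re) :
    ‖1 - v‖ < ‖1 - w‖ := by
  have e : ∀ u : ℂ, ‖1 - u‖ ^ 2 = 1 - 2 * u.re + ‖u‖ ^ 2 := fun u => by
    rw [Complex.sq_norm, Complex.sq_norm, Complex.normSq_apply, Complex.normSq_apply]
    simp; ring
  rw [← abs_of_nonneg (norm_nonneg (1 - v)), ← abs_of_nonneg (norm_nonneg (1 - w)),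
    ← sq_lt_sq, e, e, h]
  linarith

/-- On a circle `‖w‖ = const < 1`, `|(w; Q)_∞|` decreases as `Re w` increases, since every factor
does. -/
lemma logPoch_re_le {d : ℝ} (hd : 0 < d) {v w : ℂ} (h : ‖v‖ = ‖w‖) (hw : ‖w‖ < 1)
    (hre : w.re ≤ v.re) : (logPoch d v).re ≤ (logPoch d w).re := by
  rw [logPoch, logPoch, Complex.re_tsum (summable_logPoch hd v),
    Complex.re_tsum (summable_logPoch hd w)]
  refine Summable.tsum_le_tsum (fun n => ?_) (Complex.hasSum_re (summable_logPoch hd v).hasSum).summable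
    (Complex.hasSum_re (summable_logPoch hd w).hasSum).summable
  rw [Complex.log_re, Complex.log_re]
  have hv1 := (norm_nomeSq_pow_mul_le hd n v).trans_lt (h.trans_lt hw)
  refine Real.log_le_log (norm_pos_iff.2 (sub_ne_zero.2 (ne_one_of_norm_lt hv1).symm)) ?_
  refine norm_one_sub_le_of_re_le (by rw [norm_mul, norm_mul, h]) ?_
  rw [← Complex.ofReal_pow, Complex.re_ofReal_mul, Complex.re_ofReal_mul]
  exact mul_le_mul_of_nonneg_left hre (pow_nonneg (nomeSq_pos d).le _)

/-- Along a ray in the upper half plane, `arg (1 - s v)` is strictly decreasing. -/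
lemma arg_one_sub_lt {v : ℂ} (hv : 0 < v.im) {s t : ℝ} (hs : 0 ≤ s) (hst : s < t)
    (ht : ‖t * v‖ ≤ 1) : (1 - (t : ℂ) * v).arg < (1 - (s : ℂ) * v).arg := by
  have ht0 : 0 < t := hs.trans_lt hst
  have hne : ∀ x : ℝ, (x : ℂ) * v = 1 → False := fun x h => by
    have h1 := congrArg Complex.re h
    have h2 := congrArg Complex.im h
    simp at h1 h2
    rcases h2 with rfl | h2
    · simp at h1
    · exact hv.ne' h2
  have hle : ‖(s : ℂ) * v‖ ≤ 1 := by
    refine le_trans ?_ ht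
    rw [norm_mul, norm_mul, Complex.norm_real, Complex.norm_real, Real.norm_of_nonneg hs,
      Real.norm_of_nonneg ht0.le]
    exact mul_le_mul_of_nonneg_right hst.le (norm_nonneg _)
  have hpt := one_sub_re_pos ht (fun h => hne t h)
  have hps := one_sub_re_pos hle (fun h => hne s h)
  have at' := abs_lt.1 (Complex.abs_arg_lt_pi_div_two_iff.2 (Or.inl hpt))
  have as' := abs_lt.1 (Complex.abs_arg_lt_pi_div_two_iff.2 (Or.inl hps))
  rw [← Real.strictMonoOn_tan.lt_iff_lt ⟨at'.1, at'.2⟩ ⟨as'.1, as'.2⟩, Complex.tan_arg,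
    Complex.tan_arg, div_lt_div_iff₀ hpt hps]
  simp
  nlinarith [mul_lt_mul_of_pos_right hst hv]

lemma logPoch_im_le {d : ℝ} (hd : 0 < d) {v : ℂ} (hv : 0 < v.im) {s t : ℝ} (hs : 0 ≤ s)
    (hst : s ≤ t) (ht : ‖t * v‖ ≤ 1) : (logPoch d (t * v)).im ≤ (logPoch d (s * v)).im := by
  rcases hst.eq_or_lt with rfl | hst
  · exact le_rfl
  rw [logPoch, logPoch, Complex.im_tsum (summable_logPoch hd _),
    Complex.im_tsum (summable_logPoch hd _)]
  refine Summable.tsum_le_tsum (fun n => ?_) (Complex.hasSum_im (summable_logPoch hd _).hasSum).summable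
    (Complex.hasSum_im (summable_logPoch hd _).hasSum).summable
  rw [Complex.log_im, Complex.log_im]
  have hQ : 0 < nomeSq d ^ n := pow_pos (nomeSq_pos d) n
  have := arg_one_sub_lt (v := v) hv (s := nomeSq d ^ n * s) (t := nomeSq d ^ n * t)
    (mul_nonneg hQ.le hs) (mul_lt_mul_of_pos_left hst hQ) (by
      have := (norm_nomeSq_pow_mul_le hd n (t * v)).trans ht
      simpa [mul_assoc] using this)
  simpa [mul_assoc] using this.le

/-! ### An explicit logarithm of the theta function in a strip -/

/-- The exponential `e^{2πiu}`. -/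
noncomputable def expTwo (u : ℂ) : ℂ := Complex.exp (2 * Real.pi * Complex.I * u)

lemma norm_expTwo (u : ℂ) : ‖expTwo u‖ = Real.exp (-2 * Real.pi * u.im) := by
  rw [expTwo, Complex.norm_exp]
  simp

lemma expTwo_ne_one {u : ℂ} (hu : ∀ n : ℤ, u ≠ n) : expTwo u ≠ 1 := by
  intro h
  obtain ⟨n, hn⟩ := Complex.exp_eq_one_iff.1 h
  apply hu n
  have : (2 * Real.pi * Complex.I : ℂ) ≠ 0 := Complex.two_pi_I_ne_zero
  apply mul_left_cancel₀ this
  rw [hn]; ring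

lemma expTwo_add_one (u : ℂ) : expTwo (u + 1) = expTwo u := by
  rw [expTwo, mul_add, mul_one, Complex.exp_add, Complex.exp_two_pi_mul_I, mul_one, expTwo]

lemma expTwo_conj (u : ℂ) : (starRingEnd ℂ) (expTwo u) = expTwo (-(starRingEnd ℂ) u) := by
  rw [expTwo, expTwo, ← Complex.exp_conj]
  congr 1
  simp [Complex.conj_ofNat]

lemma differentiable_expTwo : Differentiable ℂ expTwo := by
  unfold expTwo; fun_prop

lemma expTwo_re (u : ℂ) :
    (expTwo u).re = Real.exp (-2 * Real.pi * u.im) * Real.cos (2 * Real.pi * u.re) := by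
  rw [expTwo, Complex.exp_re]; simp

lemma expTwo_ofReal_im (x : ℝ) : (expTwo x).im = Real.sin (2 * Real.pi * x) := by
  rw [expTwo, Complex.exp_im]; simp

lemma expTwo_add (u v : ℂ) : expTwo (u + v) = expTwo u * expTwo v := by
  rw [expTwo, expTwo, expTwo, ← Complex.exp_add]; ring_nf

lemma expTwo_mul_I (t : ℝ) : expTwo (t * Complex.I) = (Real.exp (-2 * Real.pi * t) : ℂ) := by
  rw [expTwo, Complex.ofReal_exp]; congr 1; push_cast
  linear_combination (2 * Real.pi * t : ℂ) * Complex.I_sq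

/-- An explicit logarithm of the theta function, up to the factor `exp (-πiu)` and a constant, on
the strip `0 ≤ Im u < d` without the integers; see `oddTheta_eq_exp_thetaLog`. -/
noncomputable def thetaLog (d : ℝ) (u : ℂ) : ℂ :=
  Complex.log (1 - expTwo u) + logPoch d (nomeSq d * expTwo u) + logPoch d (nomeSq d * expTwo (-u))

lemma norm_nomeSq_mul_expTwo (d : ℝ) (u : ℂ) :
    ‖nomeSq d * expTwo u‖ = Real.exp (-2 * Real.pi * (d + u.im)) := by
  rw [norm_mul, norm_expTwo, Complex.norm_real, Real.norm_of_nonneg (nomeSq_pos d).le, nomeSq,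
    ← Real.exp_add]
  ring_nf

lemma norm_nomeSq_mul_expTwo_lt_one {d : ℝ} {u : ℂ} (h : -d < u.im) :
    ‖nomeSq d * expTwo u‖ < 1 := by
  rw [norm_nomeSq_mul_expTwo, Real.exp_lt_one_iff]
  have := mul_pos Real.pi_pos (show 0 < d + u.im by linarith)
  linarith

lemma norm_expTwo_le_one {u : ℂ} (h : 0 ≤ u.im) : ‖expTwo u‖ ≤ 1 := by
  rw [norm_expTwo, Real.exp_le_one_iff]
  have := mul_nonneg Real.pi_pos.le h
  linarith

/-- The product formula for the theta function in terms of `thetaLog`. -/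
lemma oddTheta_eq_exp_thetaLog {d : ℝ} (hd : 0 < d) : ∃ c : ℂ, c ≠ 0 ∧ ∀ u : ℂ, -d < u.im →
    u.im < d → (∀ n : ℤ, u ≠ n) → oddTheta (d * Complex.I) u =
      c * (Complex.exp (-(Real.pi * Complex.I * u)) * Complex.exp (thetaLog d u)) := by
  obtain ⟨c, hc, h⟩ := oddTheta_eq_tprod hd
  have h' : ∀ u : ℂ, oddTheta (d * Complex.I) u = c * (Complex.exp (-(Real.pi * Complex.I * u)) *
      ((∏' n : ℕ, (1 - (nomeSq d : ℂ) ^ n * expTwo u)) *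
        ∏' n : ℕ, (1 - (nomeSq d : ℂ) ^ n * (nomeSq d * expTwo (-u))))) := fun u => by
    rw [h]
    simp only [expTwo, nomeSq, mul_neg]
  refine ⟨c, hc, fun u h1 h2 hu => ?_⟩
  have hne : 1 - expTwo u ≠ 0 := sub_ne_zero.2 (expTwo_ne_one hu).symm
  rw [h', tprod_one_sub_geom (norm_nomeSq_lt_one hd), thetaLog, Complex.exp_add, Complex.exp_add,
    Complex.exp_log hne, exp_logPoch hd (norm_nomeSq_mul_expTwo_lt_one h1),
    exp_logPoch hd (norm_nomeSq_mul_expTwo_lt_one (u := -u) (by simpa using h2))]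

lemma analyticAt_thetaLog {d : ℝ} (hd : 0 < d) {u : ℂ} (h0 : 0 ≤ u.im) (h1 : u.im < d)
    (hu : ∀ n : ℤ, u ≠ n) : AnalyticAt ℂ (thetaLog d) u := by
  have hU : IsOpen {v : ℂ | (-d < v.im ∧ v.im < d) ∧ 1 - expTwo v ∈ Complex.slitPlane} := by
    refine ((isOpen_lt continuous_const Complex.continuous_im).inter
      (isOpen_lt Complex.continuous_im continuous_const)).inter
      (Complex.isOpen_slitPlane.preimage (continuous_const.sub differentiable_expTwo.continuous))
  refine DifferentiableOn.analyticAt (fun v hv => ?_) (hU.mem_nhds ⟨⟨by linarith, h1⟩,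
    one_sub_mem_slitPlane (norm_expTwo_le_one h0) (expTwo_ne_one hu)⟩)
  have hP : ∀ v : ℂ, -d < v.im →
      DifferentiableAt ℂ (fun v => logPoch d (nomeSq d * expTwo v)) v := fun v hv =>
    ((differentiableOn_logPoch hd).differentiableAt (Metric.isOpen_ball.mem_nhds
      (by simpa using norm_nomeSq_mul_expTwo_lt_one hv))).comp v
      ((differentiable_expTwo v).const_mul _)
  have hN : DifferentiableAt ℂ (fun v => logPoch d (nomeSq d * expTwo (-v))) v :=
    (hP (-v) (by simpa using hv.1.2)).comp v differentiableAt_id.neg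
  exact (((((differentiable_expTwo v).const_sub 1).clog hv.2).add
    (hP v hv.1.1)).add hN).differentiableWithinAt

lemma thetaLog_add_one (d : ℝ) (u : ℂ) : thetaLog d (u + 1) = thetaLog d u := by
  have : expTwo (-(u + 1)) = expTwo (-u) := by
    rw [← expTwo_add_one (-(u + 1))]; ring_nf
  rw [thetaLog, expTwo_add_one, this, thetaLog]

lemma thetaLog_neg_conj {d : ℝ} (hd : 0 < d) {u : ℂ} (h0 : 0 ≤ u.im) (h1 : u.im < d) :
    thetaLog d (-(starRingEnd ℂ) u) = (starRingEnd ℂ) (thetaLog d u) := by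
  have hQ : ∀ v : ℂ, (starRingEnd ℂ) ((nomeSq d : ℂ) * expTwo v)
      = nomeSq d * expTwo (-(starRingEnd ℂ) v) := fun v => by
    rw [map_mul, expTwo_conj, Complex.conj_ofReal]
  rw [thetaLog, thetaLog, map_add, map_add, ← log_one_sub_conj (norm_expTwo_le_one h0),
    ← logPoch_conj hd (norm_nomeSq_mul_expTwo_lt_one (u := u) (by linarith)).le,
    ← logPoch_conj hd (norm_nomeSq_mul_expTwo_lt_one (u := -u) (by simpa using h1)).le,
    hQ, hQ, expTwo_conj, map_neg]

lemma arg_one_sub_expTwo {x : ℝ} (h0 : 0 < x) (h1 : x < 1) :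
    (1 - expTwo x).arg = Real.pi * (x - 1 / 2) := by
  have hs : 0 < Real.sin (Real.pi * x) :=
    Real.sin_pos_of_pos_of_lt_pi (by positivity) (by nlinarith [Real.pi_pos])
  have : 1 - expTwo x = ((2 * Real.sin (Real.pi * x) : ℝ) : ℂ) *
      (Complex.cos ((Real.pi * (x - 1 / 2) : ℝ) : ℂ)
        + Complex.sin ((Real.pi * (x - 1 / 2) : ℝ) : ℂ) * Complex.I) := by
    have e : Real.pi * (x - 1 / 2) = Real.pi * x - Real.pi / 2 := by ring
    have hre : (expTwo x).re = 1 - 2 * Real.sin (Real.pi * x) ^ 2 := by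
      rw [expTwo_re]
      simp only [Complex.ofReal_re, Complex.ofReal_im, mul_zero, Real.exp_zero, one_mul]
      rw [mul_assoc, Real.cos_two_mul, Real.cos_sq']
      ring
    have him : (expTwo x).im = 2 * Real.sin (Real.pi * x) * Real.cos (Real.pi * x) := by
      rw [expTwo_ofReal_im, mul_assoc, Real.sin_two_mul]
    rw [e, ← Complex.ofReal_cos, ← Complex.ofReal_sin, Real.cos_sub_pi_div_two,
      Real.sin_sub_pi_div_two]
    generalize Real.sin (Real.pi * x) = s at hre him
    generalize Real.cos (Real.pi * x) = c at hre him
    apply Complex.ext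
    · simp [hre]; ring
    · simp [him]
  rw [this, Complex.arg_mul_cos_add_sin_mul_I (by positivity)]
  constructor <;> nlinarith [Real.pi_pos]

lemma thetaLog_ofReal_im {d : ℝ} (hd : 0 < d) {x : ℝ} (h0 : 0 < x) (h1 : x < 1) :
    (thetaLog d x).im = Real.pi * (x - 1 / 2) := by
  have hc : (starRingEnd ℂ) ((nomeSq d : ℂ) * expTwo x) = nomeSq d * expTwo (-x) := by
    rw [map_mul, expTwo_conj, Complex.conj_ofReal, Complex.conj_ofReal]
  rw [thetaLog, ← hc, logPoch_conj hd (norm_nomeSq_mul_expTwo_lt_one (by simpa using hd)).le]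
  simp [Complex.log_im, arg_one_sub_expTwo h0 h1]

lemma thetaLog_halfPeriod_im {d : ℝ} (hd : 0 < d) (x : ℝ) :
    (thetaLog d (x + d * Complex.I / 2)).im = 0 := by
  have hi : ((x : ℂ) + d * Complex.I / 2).im = d / 2 := by simp
  rw [thetaLog, ← logPoch_eq_log_add hd]
  have hc : (nomeSq d : ℂ) * expTwo (-(x + d * Complex.I / 2))
      = (starRingEnd ℂ) (expTwo (x + d * Complex.I / 2)) := by
    rw [expTwo_conj, expTwo, expTwo, nomeSq, Complex.ofReal_exp, ← Complex.exp_add]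
    congr 1
    simp [Complex.conj_ofNat]
    linear_combination (-2 * Real.pi * d : ℂ) * Complex.I_sq
  rw [hc, logPoch_conj hd (norm_expTwo_le_one (by rw [hi]; positivity))]
  simp

/-! ### The logarithm of the quotient of two theta functions -/

/-- The point `z` is congruent to neither `p` nor `-p` modulo `ℤ`. -/
def CornerFree (p : ℝ) (z : ℂ) : Prop := ∀ n : ℤ, z ≠ p + n ∧ z ≠ -p + n

/-- A logarithm of `ϑ(z - p) / ϑ(z + p)` on the closed strip `0 ≤ Im z ≤ d / 2`. The constant
`2πip` comes from the factors `exp (-πiu)` of the two theta functions; with it, the logarithm is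
real on the interval `(p, 1 - p)` and purely imaginary on the imaginary axis. -/
noncomputable def logRatio (d p : ℝ) (z : ℂ) : ℂ :=
  2 * Real.pi * Complex.I * p + thetaLog d (z - p) - thetaLog d (z + p)

lemma CornerFree.sub_ne {p : ℝ} {z : ℂ} (h : CornerFree p z) (n : ℤ) : z - p ≠ n := fun e =>
  (h n).1 (by rw [← e]; ring)

lemma CornerFree.add_ne {p : ℝ} {z : ℂ} (h : CornerFree p z) (n : ℤ) : z + p ≠ n := fun e =>
  (h n).2 (by rw [← e]; ring)

lemma cornerFree_of_im_ne_zero {p : ℝ} {z : ℂ} (h : z.im ≠ 0) : CornerFree p z := fun n =>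
  ⟨fun e => h (by simp [e]), fun e => h (by simp [e])⟩

lemma exp_logRatio {d : ℝ} (hd : 0 < d) {p : ℝ} {z : ℂ} (h0 : 0 ≤ z.im) (h1 : z.im < d)
    (hz : CornerFree p z) : Complex.exp (logRatio d p z) =
      oddTheta (d * Complex.I) (z - p) / oddTheta (d * Complex.I) (z + p) := by
  obtain ⟨c, hc, h⟩ := oddTheta_eq_exp_thetaLog hd
  rw [h (z - p) (by simp; linarith) (by simpa using h1) hz.sub_ne,
    h (z + p) (by simp; linarith) (by simpa using h1) hz.add_ne, mul_div_mul_left _ _ hc,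
    ← Complex.exp_add, ← Complex.exp_add, ← Complex.exp_sub, logRatio]
  congr 1
  ring

lemma analyticAt_logRatio {d : ℝ} (hd : 0 < d) {p : ℝ} {z : ℂ} (h0 : 0 ≤ z.im)
    (h1 : z.im < d) (hz : CornerFree p z) : AnalyticAt ℂ (logRatio d p) z := by
  have e1 : AnalyticAt ℂ (fun z : ℂ => thetaLog d (z - p)) z :=
    (analyticAt_thetaLog hd (by simpa using h0) (by simpa using h1) hz.sub_ne).comp_of_eq
      (by fun_prop) rfl
  have e2 : AnalyticAt ℂ (fun z : ℂ => thetaLog d (z + p)) z :=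
    (analyticAt_thetaLog hd (by simpa using h0) (by simpa using h1) hz.add_ne).comp_of_eq
      (by fun_prop) rfl
  exact (analyticAt_const.add e1).sub e2

lemma logRatio_add_one (d p : ℝ) (z : ℂ) : logRatio d p (z + 1) = logRatio d p z := by
  rw [logRatio, show z + 1 - p = z - p + 1 by ring, show z + 1 + p = z + p + 1 by ring,
    thetaLog_add_one, thetaLog_add_one, logRatio]

/-- Reflection at the imaginary axis inverts the quotient of theta functions up to conjugation. -/
lemma logRatio_neg_conj {d : ℝ} (hd : 0 < d) (p : ℝ) {z : ℂ} (h0 : 0 ≤ z.im) (h1 : z.im < d) :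
    logRatio d p (-(starRingEnd ℂ) z) = -(starRingEnd ℂ) (logRatio d p z) := by
  have e1 : -(starRingEnd ℂ) z - p = -(starRingEnd ℂ) (z + p) := by simp; ring
  have e2 : -(starRingEnd ℂ) z + p = -(starRingEnd ℂ) (z - p) := by simp; ring
  rw [logRatio, logRatio, e1, e2, thetaLog_neg_conj hd (by simpa using h0) (by simpa using h1),
    thetaLog_neg_conj hd (by simpa using h0) (by simpa using h1)]
  simp [Complex.conj_ofNat]
  ring

lemma cos_sub_lt_cos_add {x p : ℝ} (hx0 : 0 < x) (hx1 : x < 1 / 2) (hp0 : 0 < p)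
    (hp1 : p < 1 / 2) :
    Real.cos (2 * Real.pi * (x + p)) < Real.cos (2 * Real.pi * (x - p)) := by
  have hs : ∀ y : ℝ, 0 < y → y < 1 / 2 → 0 < Real.sin (2 * Real.pi * y) := fun y h0 h1 =>
    Real.sin_pos_of_pos_of_lt_pi (by positivity) (by nlinarith [Real.pi_pos])
  have := mul_pos (hs x hx0 hx1) (hs p hp0 hp1)
  rw [mul_add, mul_sub, Real.cos_add, Real.cos_sub]
  linarith

/-- In the right half of a period, `|ϑ(z - p)| < |ϑ(z + p)|`: this holds factor by factor. -/
lemma logRatio_re_neg {d : ℝ} (hd : 0 < d) {p : ℝ} (hp0 : 0 < p) (hp1 : p < 1 / 2) {z : ℂ}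
    (h0 : 0 ≤ z.im) (h1 : z.im < d) (hx0 : 0 < z.re) (hx1 : z.re < 1 / 2) (hz : CornerFree p z) :
    (logRatio d p z).re < 0 := by
  have hcos := cos_sub_lt_cos_add hx0 hx1 hp0 hp1
  have hre : (expTwo (z + p)).re < (expTwo (z - p)).re := by
    rw [expTwo_re, expTwo_re]
    simpa using mul_lt_mul_of_pos_left hcos (Real.exp_pos (-(2 * Real.pi * z.im)))
  have hre' : (expTwo (-(z + p))).re < (expTwo (-(z - p))).re := by
    rw [expTwo_re, expTwo_re]
    simp only [Complex.neg_re, mul_neg, Real.cos_neg]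
    simpa using mul_lt_mul_of_pos_left hcos (Real.exp_pos (2 * Real.pi * z.im))
  have hn : ‖expTwo (z - p)‖ = ‖expTwo (z + p)‖ := by simp [norm_expTwo]
  have hn' : ‖expTwo (-(z - p))‖ = ‖expTwo (-(z + p))‖ := by simp [norm_expTwo]
  have l1 : (Complex.log (1 - expTwo (z - p))).re < (Complex.log (1 - expTwo (z + p))).re := by
    rw [Complex.log_re, Complex.log_re]
    exact Real.log_lt_log (norm_pos_iff.2 (sub_ne_zero.2 (expTwo_ne_one hz.sub_ne).symm))
      (norm_one_sub_lt_of_re_lt hn hre)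
  have l2 : (logPoch d (nomeSq d * expTwo (z - p))).re
      ≤ (logPoch d (nomeSq d * expTwo (z + p))).re := by
    refine logPoch_re_le hd (by rw [norm_mul, norm_mul, hn])
      (norm_nomeSq_mul_expTwo_lt_one (by simp; linarith)) ?_
    rw [Complex.re_ofReal_mul, Complex.re_ofReal_mul]
    exact mul_le_mul_of_nonneg_left hre.le (nomeSq_pos d).le
  have l3 : (logPoch d (nomeSq d * expTwo (-(z - p)))).re
      ≤ (logPoch d (nomeSq d * expTwo (-(z + p)))).re := by
    refine logPoch_re_le hd (by rw [norm_mul, norm_mul, hn'])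
      (norm_nomeSq_mul_expTwo_lt_one (by simpa using h1)) ?_
    rw [Complex.re_ofReal_mul, Complex.re_ofReal_mul]
    exact mul_le_mul_of_nonneg_left hre'.le (nomeSq_pos d).le
  have e : (2 * Real.pi * Complex.I * p : ℂ).re = 0 := by simp
  rw [logRatio, Complex.sub_re, Complex.add_re, e, thetaLog, thetaLog]
  simp only [Complex.add_re]
  linarith

lemma two_pi_I_mul_im (p : ℝ) : (2 * Real.pi * Complex.I * p : ℂ).im = 2 * Real.pi * p := by simp

/-- Between `-p` and `p`, the quotient of theta functions is negative. -/
lemma logRatio_im_inner {d : ℝ} (hd : 0 < d) {p x : ℝ} (hp1 : p < 1 / 2)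
    (h0 : -p < x) (h1 : x < p) : (logRatio d p x).im = Real.pi := by
  have e : ((x : ℂ) - p) = ((x - p : ℝ) : ℂ) := by push_cast; ring
  have e' : ((x : ℂ) - p + 1) = ((x - p + 1 : ℝ) : ℂ) := by push_cast; ring
  have e2 : ((x : ℂ) + p) = ((x + p : ℝ) : ℂ) := by push_cast; ring
  rw [logRatio, Complex.sub_im, Complex.add_im, two_pi_I_mul_im, ← thetaLog_add_one d (x - p), e',
    e2, thetaLog_ofReal_im hd (by linarith) (by linarith),
    thetaLog_ofReal_im hd (by linarith) (by linarith)]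
  ring

/-- Between `p` and `1 - p`, the quotient of theta functions is positive. -/
lemma logRatio_im_outer {d : ℝ} (hd : 0 < d) {p x : ℝ} (hp0 : 0 < p)
    (h0 : p < x) (h1 : x < 1 - p) : (logRatio d p x).im = 0 := by
  have e : ((x : ℂ) - p) = ((x - p : ℝ) : ℂ) := by push_cast; ring
  have e2 : ((x : ℂ) + p) = ((x + p : ℝ) : ℂ) := by push_cast; ring
  rw [logRatio, Complex.sub_im, Complex.add_im, two_pi_I_mul_im, e,
    e2, thetaLog_ofReal_im hd (by linarith) (by linarith),
    thetaLog_ofReal_im hd (by linarith) (by linarith)]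
  ring

/-- On the line `Im z = d / 2`, where the argument of `exp (πiu) ϑ(u)` is constant, so is the
argument of the quotient of theta functions. -/
lemma logRatio_im_top {d : ℝ} (hd : 0 < d) (p x : ℝ) :
    (logRatio d p (x + d * Complex.I / 2)).im = 2 * Real.pi * p := by
  have e : ((x : ℂ) + d * Complex.I / 2 - p) = ((x - p : ℝ) : ℂ) + d * Complex.I / 2 := by
    push_cast; ring
  have e2 : ((x : ℂ) + d * Complex.I / 2 + p) = ((x + p : ℝ) : ℂ) + d * Complex.I / 2 := by
    push_cast; ring
  rw [logRatio, Complex.sub_im, Complex.add_im, two_pi_I_mul_im, e, e2, thetaLog_halfPeriod_im hd,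
    thetaLog_halfPeriod_im hd]
  ring

/-- The argument of `ϑ(z - p) / ϑ(z + p)` at the point `z = i t` of the imaginary axis, where this
quotient has modulus one. -/
noncomputable def axisArg (d p t : ℝ) : ℝ := (logRatio d p (t * Complex.I)).im

lemma logRatio_axis {d : ℝ} (hd : 0 < d) (p : ℝ) {t : ℝ} (h0 : 0 ≤ t) (h1 : t < d) :
    logRatio d p (t * Complex.I) = axisArg d p t * Complex.I := by
  have h := logRatio_neg_conj hd p (z := t * Complex.I) (by simpa using h0) (by simpa using h1)
  have e : -(starRingEnd ℂ) (t * Complex.I) = t * Complex.I := by simp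
  rw [e] at h
  have hre := congrArg Complex.re h
  apply Complex.ext
  · simp at hre ⊢
    linarith
  · simp [axisArg]

lemma axisArg_eq {d : ℝ} (hd : 0 < d) (p : ℝ) {t : ℝ} (h0 : 0 ≤ t) (h1 : t < d) :
    axisArg d p t = 2 * Real.pi * p - 2 * (thetaLog d (t * Complex.I + p)).im := by
  have e : (t * Complex.I - p : ℂ) = -(starRingEnd ℂ) (t * Complex.I + p) := by simp; ring
  rw [axisArg, logRatio, Complex.sub_im, Complex.add_im, two_pi_I_mul_im, e,
    thetaLog_neg_conj hd (by simpa using h0) (by simpa using h1), Complex.conj_im]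
  ring

lemma axisArg_zero_right {d : ℝ} (hd : 0 < d) {p : ℝ} (hp0 : 0 < p) (hp1 : p < 1 / 2) :
    axisArg d p 0 = Real.pi := by
  have := logRatio_im_inner hd (x := 0) hp1 (by linarith) hp0
  simpa [axisArg] using this

lemma axisArg_half {d : ℝ} (hd : 0 < d) (p : ℝ) : axisArg d p (d / 2) = 2 * Real.pi * p := by
  have := logRatio_im_top hd p 0
  rw [← this, axisArg]
  congr 2
  push_cast; ring

lemma axisArg_zero_left (d t : ℝ) : axisArg d 0 t = 0 := by
  simp [axisArg, logRatio]

/-- The argument of `ϑ(it - p) / ϑ(it + p)` decreases along the imaginary axis: this holds factor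
by factor. -/
lemma axisArg_strictAnti {d : ℝ} (hd : 0 < d) {p : ℝ} (hp0 : 0 < p) (hp1 : p < 1 / 2) {s t : ℝ}
    (hs : 0 ≤ s) (hst : s < t) (ht : t ≤ d / 2) : axisArg d p t < axisArg d p s := by
  have htd : t < d := by linarith
  have hv : 0 < (expTwo p).im := by
    rw [expTwo_ofReal_im]
    exact Real.sin_pos_of_pos_of_lt_pi (by positivity) (by nlinarith [Real.pi_pos])
  have hvn : ‖expTwo p‖ = 1 := by simp [norm_expTwo]
  have hexp : Real.exp (-2 * Real.pi * t) < Real.exp (-2 * Real.pi * s) := by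
    apply Real.exp_lt_exp.2; nlinarith [Real.pi_pos]
  have hexp' : Real.exp (2 * Real.pi * s) < Real.exp (2 * Real.pi * t) := by
    apply Real.exp_lt_exp.2; nlinarith [Real.pi_pos]
  have e1 : ∀ r : ℝ, expTwo (r * Complex.I + p) = (Real.exp (-2 * Real.pi * r) : ℂ) * expTwo p :=
    fun r => by rw [expTwo_add, expTwo_mul_I]
  have e2 : ∀ r : ℝ, expTwo (-(r * Complex.I + p))
      = (starRingEnd ℂ) ((Real.exp (2 * Real.pi * r) : ℂ) * expTwo p) := fun r => by
    rw [map_mul, expTwo_conj, Complex.conj_ofReal, Complex.conj_ofReal]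
    have := expTwo_mul_I (-r)
    rw [show -2 * Real.pi * -r = 2 * Real.pi * r by ring] at this
    rw [← this, ← expTwo_add]
    congr 1; push_cast; ring
  have hn1 : ∀ r : ℝ, ‖((r : ℝ) : ℂ) * expTwo p‖ = |r| := fun r => by
    rw [norm_mul, hvn, mul_one, Complex.norm_real, Real.norm_eq_abs]
  have hQ := nomeSq_pos d
  have l1 : (Complex.log (1 - expTwo (s * Complex.I + p))).im
      < (Complex.log (1 - expTwo (t * Complex.I + p))).im := by
    rw [Complex.log_im, Complex.log_im, e1, e1]
    refine arg_one_sub_lt hv (Real.exp_pos _).le hexp ?_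
    rw [hn1, Real.abs_exp, Real.exp_le_one_iff]
    nlinarith [Real.pi_pos]
  have l2 : (logPoch d (nomeSq d * expTwo (s * Complex.I + p))).im
      ≤ (logPoch d (nomeSq d * expTwo (t * Complex.I + p))).im := by
    rw [e1, e1, ← mul_assoc, ← mul_assoc, ← Complex.ofReal_mul, ← Complex.ofReal_mul]
    refine logPoch_im_le hd hv (by positivity) (mul_le_mul_of_nonneg_left hexp.le hQ.le) ?_
    rw [hn1, abs_mul, Real.abs_exp, abs_of_pos hQ]
    refine mul_le_one₀ (nomeSq_lt_one hd).le (Real.exp_pos _).le (Real.exp_le_one_iff.2 ?_)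
    nlinarith [Real.pi_pos]
  have l3 : (logPoch d (nomeSq d * expTwo (-(s * Complex.I + p)))).im
      ≤ (logPoch d (nomeSq d * expTwo (-(t * Complex.I + p)))).im := by
    have hle : ∀ r : ℝ, r < d → nomeSq d * Real.exp (2 * Real.pi * r) ≤ 1 := fun r hr => by
      rw [nomeSq, ← Real.exp_add, Real.exp_le_one_iff]
      nlinarith [Real.pi_pos]
    have hnorm : ∀ r : ℝ, r < d →
        ‖((nomeSq d * Real.exp (2 * Real.pi * r) : ℝ) : ℂ) * expTwo p‖ ≤ 1 := fun r hr => by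
      rw [hn1, abs_of_pos (by positivity)]; exact hle r hr
    have e3 : ∀ r : ℝ, r < d → (logPoch d (nomeSq d * expTwo (-(r * Complex.I + p)))).im
        = -(logPoch d (((nomeSq d * Real.exp (2 * Real.pi * r) : ℝ) : ℂ) * expTwo p)).im :=
      fun r hr => by
        rw [e2, ← Complex.conj_im, ← logPoch_conj hd (hnorm r hr)]
        congr 2
        rw [map_mul, map_mul, Complex.conj_ofReal, Complex.conj_ofReal]
        push_cast; ring
    rw [e3 s (by linarith), e3 t htd, neg_le_neg_iff]
    exact logPoch_im_le hd hv (by positivity) (mul_le_mul_of_nonneg_left hexp'.le hQ.le)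
      (hnorm t htd)
  rw [axisArg_eq hd p hs (by linarith), axisArg_eq hd p (hs.trans hst.le) htd, thetaLog, thetaLog]
  simp only [Complex.add_im]
  linarith

lemma continuous_axisArg_left {d : ℝ} (hd : 0 < d) {t : ℝ} (h0 : 0 < t) (h1 : t < d) :
    Continuous fun p => axisArg d p t := by
  simp only [fun p => axisArg_eq hd p h0.le h1]
  have : Continuous fun p : ℝ => thetaLog d (t * Complex.I + p) := by
    refine continuous_iff_continuousAt.2 fun p => ?_
    have hne : ∀ n : ℤ, (t * Complex.I + p : ℂ) ≠ n := fun n e => by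
      have := congrArg Complex.im e
      simp at this
      exact h0.ne' this
    have := (analyticAt_thetaLog hd (u := t * Complex.I + p) (by simpa using h0.le)
      (by simpa using h1) hne).continuousAt
    exact this.comp (f := fun p : ℝ => (t * Complex.I + p : ℂ)) (by fun_prop)
  exact continuous_const.mul continuous_id |>.sub
    (continuous_const.mul (Complex.continuous_im.comp this))

lemma axis_cornerFree {p : ℝ} (hp0 : 0 < p) (hp1 : p < 1 / 2) (t : ℝ) :
    CornerFree p (t * Complex.I) := by
  refine fun n => ⟨fun e => ?_, fun e => ?_⟩
  all_goals
    have h := congrArg Complex.re e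
    simp at h
  · have h1 : -1 < (n : ℝ) := by linarith
    have h2 : (n : ℝ) < 0 := by linarith
    norm_cast at h1 h2
    omega
  · have h1 : 0 < (n : ℝ) := by linarith
    have h2 : (n : ℝ) < 1 := by linarith
    norm_cast at h1 h2
    omega

lemma continuousOn_axisArg {d : ℝ} (hd : 0 < d) {p : ℝ} (hp0 : 0 < p) (hp1 : p < 1 / 2) :
    ContinuousOn (axisArg d p) (Set.Ico 0 d) := by
  intro t ht
  have := (analyticAt_logRatio hd (by simpa using ht.1) (by simpa using ht.2)
    (axis_cornerFree hp0 hp1 t)).continuousAt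
  exact (Complex.continuous_im.continuousAt.comp (this.comp (f := fun t : ℝ => (t * Complex.I : ℂ))
    (by fun_prop))).continuousWithinAt

/-- Near the lower boundary of the strip, the quotient of theta functions and its inverse grow at
most like `1 / Im z`. -/
lemma exists_abs_logRatio_re_le {d : ℝ} (hd : 0 < d) (p : ℝ) :
    ∃ C, ∀ z : ℂ, 0 < z.im → z.im ≤ d / 2 → |(logRatio d p z).re| ≤ C - Real.log z.im := by
  obtain ⟨C₀, hC₀⟩ := exists_norm_logPoch_le hd (r := Real.exp (-Real.pi * d))
    (Real.exp_lt_one_iff.2 (by nlinarith [Real.pi_pos]))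
  have hlow : ∀ x : ℝ, 0 < x → x ≤ d → x * (2 * Real.pi / (1 + 2 * Real.pi * d))
      ≤ 1 - Real.exp (-2 * Real.pi * x) := by
    intro x hx hxd
    have h1 : 1 + 2 * Real.pi * x ≤ Real.exp (2 * Real.pi * x) := by
      have := Real.add_one_le_exp (2 * Real.pi * x); linarith
    have h2 : 0 < 2 * Real.pi * x := by positivity
    have h3 : Real.exp (-2 * Real.pi * x) ≤ (1 + 2 * Real.pi * x)⁻¹ := by
      rw [show -2 * Real.pi * x = -(2 * Real.pi * x) by ring, Real.exp_neg]
      exact inv_anti₀ (by positivity) h1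
    have h4 : x * (2 * Real.pi / (1 + 2 * Real.pi * d)) ≤ 1 - (1 + 2 * Real.pi * x)⁻¹ := by
      have : 1 - (1 + 2 * Real.pi * x)⁻¹ = x * (2 * Real.pi / (1 + 2 * Real.pi * x)) := by
        field_simp; ring
      rw [this]
      gcongr
    linarith
  set k : ℝ := 2 * Real.pi / (1 + 2 * Real.pi * d) with hk
  have hk0 : 0 < k := by positivity
  have hlog : ∀ u : ℂ, 0 < u.im → u.im ≤ d / 2 → Real.log u.im + Real.log k ≤
      (Complex.log (1 - expTwo u)).re ∧ (Complex.log (1 - expTwo u)).re ≤ Real.log 2 := by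
    intro u h0 h1
    have hn : ‖expTwo u‖ = Real.exp (-2 * Real.pi * u.im) := norm_expTwo u
    have hlo : u.im * k ≤ ‖1 - expTwo u‖ := by
      have h2 := norm_sub_norm_le (1 : ℂ) (expTwo u)
      rw [norm_one, hn] at h2
      exact (hlow _ h0 (by linarith)).trans h2
    have hpos : 0 < u.im * k := mul_pos h0 hk0
    rw [Complex.log_re, ← Real.log_mul h0.ne' hk0.ne']
    refine ⟨Real.log_le_log hpos hlo, Real.log_le_log (hpos.trans_le hlo) ?_⟩
    have h2 := norm_sub_le (1 : ℂ) (expTwo u)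
    rw [norm_one] at h2
    linarith [norm_expTwo_le_one h0.le]
  have hP : ∀ u : ℂ, -(d / 2) ≤ u.im → |(logPoch d (nomeSq d * expTwo u)).re| ≤ C₀ := by
    intro u hu
    refine (Complex.abs_re_le_norm _).trans (hC₀ _ ?_)
    rw [norm_nomeSq_mul_expTwo, Real.exp_le_exp]
    nlinarith [Real.pi_pos]
  refine ⟨4 * C₀ + Real.log 2 - Real.log k, fun z h0 h1 => ?_⟩
  have i1 : (z - p).im = z.im := by simp
  have i2 : (z + p).im = z.im := by simp
  have a1 := hlog (z - p) (by rwa [i1]) (by rwa [i1])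
  have a2 := hlog (z + p) (by rwa [i2]) (by rwa [i2])
  rw [i1] at a1
  rw [i2] at a2
  have b1 := abs_le.1 (hP (z - p) (by rw [i1]; linarith))
  have b2 := abs_le.1 (hP (z + p) (by rw [i2]; linarith))
  have b3 := abs_le.1 (hP (-(z - p)) (by rw [Complex.neg_im, i1]; linarith))
  have b4 := abs_le.1 (hP (-(z + p)) (by rw [Complex.neg_im, i2]; linarith))
  have e : (2 * Real.pi * Complex.I * p : ℂ).re = 0 := by simp
  rw [logRatio, Complex.sub_re, Complex.add_re, e, thetaLog, thetaLog, abs_le]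
  simp only [Complex.add_re]
  constructor <;> linarith [a1.1, a1.2, a2.1, a2.2, b1.1, b1.2, b2.1, b2.2, b3.1, b3.2, b4.1, b4.2]

/-! ### Integrals along segments issuing from a point of the central line -/

lemma segmentIntegral_congr {f g : ℂ → ℂ} {u v : ℂ}
    (h : ∀ s : ℝ, 0 < s → s < 1 → f (u + s * (v - u)) = g (u + s * (v - u))) :
    segmentIntegral f u v = segmentIntegral g u v := by
  rw [segmentIntegral, segmentIntegral]
  congr 1
  refine intervalIntegral.integral_congr_ae ?_
  have : ∀ᵐ s : ℝ, s ≠ 1 := by simp [MeasureTheory.ae_iff]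
  filter_upwards [this] with s hs hs'
  rw [Set.uIoc_of_le zero_le_one] at hs'
  exact h s hs'.1 (lt_of_le_of_ne hs'.2 hs)

/-- Differentiation of the integral over the segment from `c` to `x` in the end point `x`, for a
function that is analytic along the segment: under the integral sign,
`∂ₓ ((x - c) g (c + s (x - c))) = ∂ₛ (s g (c + s (x - c)))`. -/
lemma hasDerivAt_segmentIntegral {g : ℂ → ℂ} {c : ℂ} {x₁ x₂ x₀ : ℝ} (hx₀ : x₀ ∈ Set.Ioo x₁ x₂)
    (hg : ∀ x ∈ Set.Ioo x₁ x₂, ∀ s ∈ Set.Icc (0 : ℝ) 1, AnalyticAt ℂ g (c + s * (x - c))) :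
    HasDerivAt (fun x : ℝ => segmentIntegral g c x) (g x₀) x₀ := by
  obtain ⟨ε, hε, hball⟩ := Metric.isOpen_iff.1 isOpen_Ioo x₀ hx₀
  set K : Set ℝ := Metric.closedBall x₀ (ε / 2) with hK
  have hKsub : K ⊆ Set.Ioo x₁ x₂ :=
    (Metric.closedBall_subset_ball (by linarith)).trans hball
  have hKnhds : K ∈ nhds x₀ := Metric.closedBall_mem_nhds _ (by linarith)
  set F' : ℝ → ℝ → ℂ := fun x s =>
    g (c + s * (x - c)) + (x - c) * (s * deriv g (c + s * (x - c))) with hF'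
  have hline : Continuous fun w : ℝ × ℝ => c + (w.2 : ℂ) * (w.1 - c) := by fun_prop
  have hcont : ContinuousOn (fun w : ℝ × ℝ => F' w.1 w.2) (K ×ˢ Set.Icc 0 1) := by
    intro w hw
    have ha := hg w.1 (hKsub hw.1) w.2 hw.2
    have c1 : ContinuousAt (fun w : ℝ × ℝ => g (c + (w.2 : ℂ) * (w.1 - c))) w :=
      ContinuousAt.comp (f := fun w : ℝ × ℝ => c + (w.2 : ℂ) * (w.1 - c)) ha.continuousAt
        hline.continuousAt
    have c2 : ContinuousAt (fun w : ℝ × ℝ => deriv g (c + (w.2 : ℂ) * (w.1 - c))) w :=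
      ContinuousAt.comp (f := fun w : ℝ × ℝ => c + (w.2 : ℂ) * (w.1 - c))
        ha.deriv.continuousAt hline.continuousAt
    have c3 : ContinuousAt (fun w : ℝ × ℝ => ((w.1 : ℂ) - c)) w := by fun_prop
    have c4 : ContinuousAt (fun w : ℝ × ℝ => ((w.2 : ℂ))) w := by fun_prop
    exact (c1.add (c3.mul (c4.mul c2))).continuousWithinAt
  obtain ⟨B, hB⟩ := ((isCompact_closedBall x₀ (ε / 2)).prod
    isCompact_Icc).exists_bound_of_continuousOn hcont
  have hgc : ∀ x ∈ K, ContinuousOn (fun s : ℝ => g (c + s * (x - c))) (Set.Icc 0 1) := by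
    intro x hx s hs
    exact ((hg x (hKsub hx) s hs).continuousAt.comp (f := fun s : ℝ => c + (s : ℂ) * (x - c))
      (by fun_prop)).continuousWithinAt
  have huIcc : Set.uIcc (0 : ℝ) 1 = Set.Icc 0 1 := Set.uIcc_of_le zero_le_one
  have huIoc : Set.uIoc (0 : ℝ) 1 = Set.Ioc 0 1 := Set.uIoc_of_le zero_le_one
  have hF'c : ContinuousOn (F' x₀) (Set.Icc 0 1) := by
    refine hcont.comp (f := fun s : ℝ => (x₀, s)) (by fun_prop) fun s hs => ⟨?_, hs⟩
    exact mem_of_mem_nhds hKnhds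
  have hFc : ∀ x ∈ K, ContinuousOn (fun s : ℝ => ((x : ℂ) - c) * g (c + s * (x - c)))
      (Set.Icc 0 1) := fun x hx => continuousOn_const.mul (hgc x hx)
  have key := intervalIntegral.hasDerivAt_integral_of_dominated_loc_of_deriv_le
    (μ := MeasureTheory.volume) (a := 0) (b := 1) (bound := fun _ => B)
    (F := fun (x : ℝ) (s : ℝ) => ((x : ℂ) - c) * g (c + s * (x - c))) (F' := F') (x₀ := x₀)
    (s := K) hKnhds ?_ ?_ ?_ ?_ ?_ ?_
  · have h2 := key.2
    have hint : ∫ s in (0 : ℝ)..1, F' x₀ s = g x₀ := by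
      have := intervalIntegral.integral_eq_sub_of_hasDerivAt (a := 0) (b := 1)
        (f := fun s : ℝ => (s : ℂ) * g (c + s * (x₀ - c))) (f' := F' x₀) (fun s hs => ?_) key.1
      · rw [this]; simp
      · rw [huIcc] at hs
        have hd := (hg x₀ hx₀ s hs).differentiableAt.hasDerivAt
        have hl : HasDerivAt (fun s : ℝ => c + (s : ℂ) * (x₀ - c)) (1 * ((x₀ : ℂ) - c)) s :=
          ((Complex.ofRealCLM.hasDerivAt (x := s)).mul_const _).const_add c
        have hm := (Complex.ofRealCLM.hasDerivAt (x := s)).mul (hd.scomp s hl)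
        refine hm.congr_deriv ?_
        simp only [hF', Complex.ofRealCLM_apply, Complex.ofReal_one, Function.comp_apply,
          smul_eq_mul]
        ring
    rw [hint] at h2
    simpa only [segmentIntegral, intervalIntegral.integral_const_mul] using h2
  · filter_upwards [hKnhds] with x hx
    rw [huIoc]
    exact ((hFc x hx).mono Set.Ioc_subset_Icc_self).aestronglyMeasurable measurableSet_Ioc
  · exact ContinuousOn.intervalIntegrable (by rw [huIcc]; exact hFc x₀ (mem_of_mem_nhds hKnhds))
  · rw [huIoc]
    exact (hF'c.mono Set.Ioc_subset_Icc_self).aestronglyMeasurable measurableSet_Ioc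
  · refine Filter.Eventually.of_forall fun s hs x hx => ?_
    rw [huIoc] at hs
    exact hB (x, s) ⟨hx, Set.Ioc_subset_Icc_self hs⟩
  · exact intervalIntegrable_const
  · refine Filter.Eventually.of_forall fun s hs x hx => ?_
    rw [huIoc] at hs
    have hd := (hg x (hKsub hx) s (Set.Ioc_subset_Icc_self hs)).differentiableAt.hasDerivAt
    have hx' : HasDerivAt (fun x : ℝ => ((x : ℂ) - c)) 1 x :=
      (Complex.ofRealCLM.hasDerivAt (x := x)).sub_const c
    have hl : HasDerivAt (fun x : ℝ => c + (s : ℂ) * (x - c)) ((s : ℂ) * 1) x :=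
      (hx'.const_mul (s : ℂ)).const_add c
    have hm := hx'.mul (hd.scomp x hl)
    refine hm.congr_deriv ?_
    simp only [hF', Function.comp_apply, smul_eq_mul]
    ring

/-- If `g` is dominated by `C (1 - s) ^ (-α)` with `α < 1` on the segments from `c` to the points
`x` of the real line, then it is integrable on them and the integral depends continuously on `x`,
also where `g` is singular at `x`. -/
lemma continuous_segmentIntegral {g : ℂ → ℂ} {c : ℂ} {C α : ℝ} (hα : α < 1)
    (hg : ∀ x s : ℝ, 0 ≤ s → s < 1 → ContinuousAt g (c + s * (x - c)))
    (hb : ∀ x s : ℝ, 0 ≤ s → s < 1 → ‖g (c + s * (x - c))‖ ≤ C * (1 - s) ^ (-α)) :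
    (∀ x : ℝ, IntervalIntegrable (fun s : ℝ => g (c + s * (x - c))) MeasureTheory.volume 0 1) ∧
    Continuous fun x : ℝ => segmentIntegral g c x := by
  have huIoc : Set.uIoc (0 : ℝ) 1 = Set.Ioc 0 1 := Set.uIoc_of_le zero_le_one
  have hne : ∀ᵐ s : ℝ, s ≠ 1 := by simp [MeasureTheory.ae_iff]
  have hmeas : ∀ x : ℝ, MeasureTheory.AEStronglyMeasurable (fun s : ℝ => g (c + s * (x - c)))
      (MeasureTheory.volume.restrict (Set.uIoc 0 1)) := by
    intro x
    rw [huIoc, ← MeasureTheory.Measure.restrict_congr_set MeasureTheory.Ioo_ae_eq_Ioc]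
    refine ContinuousOn.aestronglyMeasurable (fun s hs => ?_) measurableSet_Ioo
    exact ((hg x s hs.1.le hs.2).comp (f := fun s : ℝ => c + (s : ℂ) * (x - c))
      (by fun_prop)).continuousWithinAt
  have hbint : IntervalIntegrable (fun s : ℝ => C * (1 - s) ^ (-α)) MeasureTheory.volume 0 1 := by
    have h := (intervalIntegral.intervalIntegrable_rpow' (a := 1) (b := 0) (r := -α)
      (by linarith)).comp_sub_left 1
    simpa using h.const_mul C
  have hbound : ∀ x : ℝ, ∀ᵐ s : ℝ, s ∈ Set.uIoc (0 : ℝ) 1 →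
      ‖g (c + s * (x - c))‖ ≤ C * (1 - s) ^ (-α) := fun x => by
    filter_upwards [hne] with s hs hs'
    rw [huIoc] at hs'
    exact hb x s hs'.1.le (lt_of_le_of_ne hs'.2 hs)
  refine ⟨fun x => ?_, continuous_iff_continuousAt.2 fun x₀ => ?_⟩
  · refine hbint.mono_fun' (hmeas x) ?_
    rw [Filter.EventuallyLE, MeasureTheory.ae_restrict_iff' measurableSet_uIoc]
    exact hbound x
  · have hi : ContinuousAt (fun x : ℝ => ∫ s in (0 : ℝ)..1, g (c + s * (x - c))) x₀ := by
      refine intervalIntegral.continuousAt_of_dominated_interval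
        (bound := fun s => C * (1 - s) ^ (-α))
        (Filter.Eventually.of_forall hmeas) (Filter.Eventually.of_forall hbound) hbint ?_
      filter_upwards [hne] with s hs hs'
      rw [huIoc] at hs'
      exact (hg x₀ s hs'.1.le (lt_of_le_of_ne hs'.2 hs)).comp
        (f := fun x : ℝ => c + (s : ℂ) * (x - c)) (by fun_prop)
    exact ContinuousAt.mul (by fun_prop) hi

lemma segmentIntegral_axis (g : ℂ → ℂ) (u v : ℝ) :
    segmentIntegral g (u * Complex.I) (v * Complex.I)
      = Complex.I * ∫ r in u..v, g (r * Complex.I) := by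
  have h := intervalIntegral.smul_integral_comp_add_mul (a := 0) (b := 1)
    (fun r : ℝ => g (r * Complex.I)) (v - u) u
  rw [show u + (v - u) * 0 = u by ring, show u + (v - u) * 1 = v by ring] at h
  rw [← h, segmentIntegral, Complex.real_smul]
  have e : ∀ s : ℝ, (u * Complex.I + s * (v * Complex.I - u * Complex.I) : ℂ)
      = ((u + (v - u) * s : ℝ) : ℂ) * Complex.I := fun s => by push_cast; ring
  simp only [e]
  push_cast
  ring

/-- The horizontal projection in complex notation: `F = (conj ∫ dz / G - ∫ G dz) / 2`. -/
lemma planeProj_eq {τ z : ℂ} {G : ℂ → ℂ}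
    (h : IntervalIntegrable (fun s : ℝ => G (τ / 4 + s * (z - τ / 4))) MeasureTheory.volume 0 1)
    (h' : IntervalIntegrable (fun s : ℝ => 1 / G (τ / 4 + s * (z - τ / 4)))
      MeasureTheory.volume 0 1) :
    planeProj τ G z = ((starRingEnd ℂ) (segmentIntegral (fun w => 1 / G w) (τ / 4) z)
      - segmentIntegral G (τ / 4) z) / 2 := by
  have e1 : segmentIntegral (fun w => 1 / 2 * (1 / G w - G w)) (τ / 4) z
      = (segmentIntegral (fun w => 1 / G w) (τ / 4) z - segmentIntegral G (τ / 4) z) / 2 := by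
    simp only [segmentIntegral]
    rw [intervalIntegral.integral_const_mul, intervalIntegral.integral_sub h' h]
    ring
  have e2 : segmentIntegral (fun w => Complex.I / 2 * (1 / G w + G w)) (τ / 4) z
      = Complex.I * ((segmentIntegral (fun w => 1 / G w) (τ / 4) z
        + segmentIntegral G (τ / 4) z) / 2) := by
    simp only [segmentIntegral]
    rw [intervalIntegral.integral_const_mul, intervalIntegral.integral_add h' h]
    ring
  apply Complex.ext
  · simp only [planeProj, weierstrassMap, Matrix.cons_val_zero, e1]
    simp
  · simp only [planeProj, weierstrassMap, Matrix.cons_val_one, e2]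
    simp
    ring

/-! ### Curves folded onto a segment -/

/-- A plane curve with velocity in a fixed direction `e`, whose speed is odd about the midpoint of
the parameter interval and positive in the first half, traverses a segment forth and back. -/
lemma image_eq_segment_of_odd_speed {f : ℝ → ℂ} {ρ : ℝ → ℝ} {e : ℂ} {m r : ℝ} (hr : 0 < r)
    (he : e * (starRingEnd ℂ) e = 1) (hf : Continuous f)
    (hderiv : ∀ x ∈ Set.Ioo (m - r) (m + r), HasDerivAt f (ρ x * e) x)
    (hodd : ∀ h ∈ Set.Ioo (-r) r, ρ (m + h) = -ρ (m - h))
    (hpos : ∀ x ∈ Set.Ioo (m - r) m, 0 < ρ x) :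
    f '' Set.Icc (m - r) (m + r) = segment ℝ (f (m + r)) (f m) ∧ f (m - r) = f (m + r) ∧
      ∃ k : ℝ, 0 < k ∧ f m = f (m + r) + k * e := by
  set w : ℝ → ℂ := fun x => (starRingEnd ℂ) e * (f x - f m) with hw
  have hwc : Continuous w := continuous_const.mul (hf.sub continuous_const)
  have hwd : ∀ x ∈ Set.Ioo (m - r) (m + r), HasDerivAt w (ρ x : ℂ) x := fun x hx => by
    have := ((hderiv x hx).sub_const (f m)).const_mul ((starRingEnd ℂ) e)
    refine this.congr_deriv ?_
    linear_combination (ρ x : ℂ) * he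
  set v : ℝ → ℝ := fun x => (w x).re with hv
  have hvc : Continuous v := Complex.continuous_re.comp hwc
  have hvd : ∀ x ∈ Set.Ioo (m - r) (m + r), HasDerivAt v (ρ x) x := fun x hx => by
    exact ((Complex.reCLM.hasFDerivAt (x := w x)).comp_hasDerivAt x (hwd x hx)).congr_deriv
      (by simp)
  have hid : ∀ x ∈ Set.Ioo (m - r) (m + r), HasDerivAt (fun x => (w x).im) 0 x := fun x hx => by
    exact ((Complex.imCLM.hasFDerivAt (x := w x)).comp_hasDerivAt x (hwd x hx)).congr_deriv
      (by simp)
  have hm : m ∈ Set.Ioo (m - r) (m + r) := ⟨by linarith, by linarith⟩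
  have hvm : v m = 0 := by simp [hv, hw]
  -- continuous functions with vanishing derivative inside the interval are constant on it
  have hconst : ∀ {g : ℝ → ℝ}, Continuous g → ∀ {lo hi : ℝ}, lo ≤ hi →
      (∀ x ∈ Set.Ioo lo hi, HasDerivAt g 0 x) → ∀ x ∈ Set.Icc lo hi, g x = g lo := by
    intro g hg lo hi _ hd x hx
    rcases hx.1.eq_or_lt with rfl | hlt
    · rfl
    obtain ⟨c, hc, hc'⟩ := exists_hasDerivAt_eq_slope g (fun _ => 0) hlt hg.continuousOn
      fun y hy => hd y ⟨hy.1, hy.2.trans_le hx.2⟩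
    rw [eq_div_iff (by linarith)] at hc'
    linarith
  have him : ∀ x ∈ Set.Icc (m - r) (m + r), (w x).im = 0 := by
    intro x hx
    have hc := hconst (Complex.continuous_im.comp hwc) (by linarith) hid
    have h1 := hc x hx
    have h2 := hc m (Set.Ioo_subset_Icc_self hm)
    simp only [Function.comp_apply] at h1 h2
    rw [h1, ← h2]
    simp [hw]
  have hfw : ∀ x ∈ Set.Icc (m - r) (m + r), f x = f m + v x * e := by
    intro x hx
    have h1 : w x = (v x : ℂ) := Complex.ext (by simp [hv]) (by simp [him x hx])
    rw [← h1, hw]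
    linear_combination (-(f x - f m)) * he
  have hsymm : ∀ h ∈ Set.Icc 0 r, v (m + h) = v (m - h) := by
    intro h hh
    have hd : ∀ x ∈ Set.Ioo 0 r, HasDerivAt (fun x => v (m + x) - v (m - x)) 0 x := by
      intro x hx
      have h1 : HasDerivAt (fun x => v (m + x)) (ρ (m + x)) x :=
        HasDerivAt.comp_const_add m x (hvd (m + x) ⟨by linarith [hx.1], by linarith [hx.2]⟩)
      have h2 : HasDerivAt (fun x => v (m - x)) (-ρ (m - x)) x :=
        HasDerivAt.comp_const_sub m x (hvd (m - x) ⟨by linarith [hx.2], by linarith [hx.1]⟩)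
      refine (h1.sub h2).congr_deriv ?_
      rw [hodd x ⟨by linarith [hx.1], hx.2⟩]; ring
    have := hconst (g := fun x => v (m + x) - v (m - x)) (by fun_prop) hr.le hd h hh
    simp only [add_zero, sub_zero, sub_self] at this
    linarith
  have hmono : StrictMonoOn v (Set.Icc (m - r) m) := by
    refine strictMonoOn_of_deriv_pos (convex_Icc _ _) hvc.continuousOn fun x hx => ?_
    rw [interior_Icc] at hx
    rw [(hvd x ⟨hx.1, by linarith [hx.2]⟩).deriv]
    exact hpos x hx
  have hlo : m - r ∈ Set.Icc (m - r) m := ⟨le_rfl, by linarith⟩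
  have hmm : m ∈ Set.Icc (m - r) m := ⟨by linarith, le_rfl⟩
  have hneg : v (m - r) < 0 := by
    rw [← hvm]; exact hmono hlo hmm (by linarith)
  have hends : v (m + r) = v (m - r) := hsymm r ⟨hr.le, le_rfl⟩
  have himage : v '' Set.Icc (m - r) (m + r) = Set.Icc (v (m - r)) 0 := by
    apply Set.Subset.antisymm
    · rintro _ ⟨x, hx, rfl⟩
      obtain ⟨x', hx', hxx⟩ : ∃ x' ∈ Set.Icc (m - r) m, v x = v x' := by
        rcases le_total x m with h | h
        · exact ⟨x, ⟨hx.1, h⟩, rfl⟩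
        · refine ⟨m - (x - m), ⟨by linarith [hx.2], by linarith⟩, ?_⟩
          rw [← hsymm (x - m) ⟨by linarith, by linarith [hx.2]⟩]
          congr 1; ring
      rw [hxx, ← hvm]
      exact ⟨hmono.monotoneOn hlo hx' hx'.1, hmono.monotoneOn hx' hmm hx'.2⟩
    · have h := intermediate_value_Icc (show m - r ≤ m by linarith) hvc.continuousOn
      rw [hvm] at h
      exact h.trans (Set.image_mono (Set.Icc_subset_Icc_right (by linarith)))
  have hI : m + r ∈ Set.Icc (m - r) (m + r) := ⟨by linarith, le_rfl⟩
  have hI' : m - r ∈ Set.Icc (m - r) (m + r) := ⟨le_rfl, by linarith⟩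
  refine ⟨?_, ?_, -v (m - r), by linarith, ?_⟩
  · have h1 : f '' Set.Icc (m - r) (m + r)
        = (AffineMap.lineMap (f m) (f m + e) : ℝ →ᵃ[ℝ] ℂ) '' (v '' Set.Icc (m - r) (m + r)) := by
      rw [Set.image_image]
      refine Set.image_congr fun x hx => ?_
      rw [hfw x hx, AffineMap.lineMap_apply]
      simp; ring
    rw [h1, himage, ← segment_eq_Icc hneg.le, image_segment, hfw _ hI, hends]
    congr 1
    · rw [AffineMap.lineMap_apply]; simp; ring
    · rw [AffineMap.lineMap_apply]; simp
  · rw [hfw _ hI, hfw _ hI', hends]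
  · rw [hfw _ hI, hends]; push_cast; ring

lemma segment_ofReal {u v : ℝ} (h : u ≤ v) :
    segment ℝ (u : ℂ) v = (fun x : ℝ => (x : ℂ)) '' Set.Icc u v := by
  rw [← segment_eq_Icc h]
  exact (image_segment ℝ (Complex.ofRealCLM.toLinearMap.toAffineMap) u v).symm

/-! ### An explicit branch of the Gauss map -/

/-- The antiholomorphic involution of the strip `0 ≤ Im z ≤ d / 2` that reflects it at its central
line. -/
noncomputable def stripFlip (d : ℝ) (z : ℂ) : ℂ := (starRingEnd ℂ) z + d * Complex.I / 2

@[simp] lemma stripFlip_im (d : ℝ) (z : ℂ) : (stripFlip d z).im = d / 2 - z.im := by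
  simp [stripFlip]; ring

@[simp] lemma stripFlip_re (d : ℝ) (z : ℂ) : (stripFlip d z).re = z.re := by
  simp [stripFlip]

lemma stripFlip_stripFlip (d : ℝ) (z : ℂ) : stripFlip d (stripFlip d z) = z :=
  Complex.ext (by simp) (by simp)

lemma continuous_stripFlip (d : ℝ) : Continuous (stripFlip d) :=
  Complex.continuous_conj.add continuous_const

/-- A logarithm of the Gauss map on the closed strip, with an arbitrary additive constant `i κ`.
The upper corners are `± y + i d / 2`, and the quotient of theta functions that belongs to them is
the one for the lower corners `± y`, reflected at the central line. -/
noncomputable def gaussLog (d a b p y κ : ℝ) (z : ℂ) : ℂ :=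
  κ * Complex.I + a * logRatio d p z + b * (starRingEnd ℂ) (logRatio d y (stripFlip d z))

/-- The Gauss map on the closed strip, with an arbitrary rotation `exp (i κ)`. -/
noncomputable def gaussModel (d a b p y κ : ℝ) (z : ℂ) : ℂ := Complex.exp (gaussLog d a b p y κ z)

lemma analyticAt_gaussModel {d : ℝ} (hd : 0 < d) {a b p y κ : ℝ} {z : ℂ} (h0 : 0 ≤ z.im)
    (h1 : z.im ≤ d / 2) (hp : CornerFree p z) (hy : CornerFree y (stripFlip d z)) :
    AnalyticAt ℂ (gaussModel d a b p y κ) z := by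
  have e1 := analyticAt_logRatio hd h0 (by linarith) hp
  have e2 : AnalyticAt ℂ (fun z => (starRingEnd ℂ) (logRatio d y (stripFlip d z))) z := by
    have h := analyticAt_logRatio hd (z := stripFlip d z) (by simp; linarith) (by simp; linarith) hy
    rw [Complex.analyticAt_iff_eventually_differentiableAt] at h ⊢
    filter_upwards [(continuous_stripFlip d).continuousAt.eventually h] with v hv
    have hv' : DifferentiableAt ℂ (fun w => logRatio d y (w + d * Complex.I / 2))
        ((starRingEnd ℂ) v) :=
      DifferentiableAt.comp (f := fun w : ℂ => w + d * Complex.I / 2) _ hv (by fun_prop)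
    have := hv'.conj_conj
    rw [Complex.conj_conj] at this
    exact this
  exact ((analyticAt_const.add (analyticAt_const.mul e1)).add (analyticAt_const.mul e2)).cexp

lemma gaussLog_neg_conj {d : ℝ} (hd : 0 < d) (a b p y κ : ℝ) {z : ℂ} (h0 : 0 ≤ z.im)
    (h1 : z.im ≤ d / 2) : gaussLog d a b p y κ (-(starRingEnd ℂ) z)
      = -(starRingEnd ℂ) (gaussLog d a b p y κ z) := by
  have e : stripFlip d (-(starRingEnd ℂ) z) = -(starRingEnd ℂ) (stripFlip d z) :=
    Complex.ext (by simp) (by simp)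
  rw [gaussLog, gaussLog, e, logRatio_neg_conj hd p h0 (by linarith),
    logRatio_neg_conj hd y (by simp; linarith) (by simp; linarith)]
  simp
  ring

lemma gaussLog_add_one (d a b p y κ : ℝ) (z : ℂ) :
    gaussLog d a b p y κ (z + 1) = gaussLog d a b p y κ z := by
  have e : stripFlip d (z + 1) = stripFlip d z + 1 := by simp [stripFlip]; ring
  rw [gaussLog, gaussLog, e, logRatio_add_one, logRatio_add_one]

lemma gaussLog_stripFlip (d a b p y κ : ℝ) (z : ℂ) :
    gaussLog d a b p y κ (stripFlip d z)
      = (starRingEnd ℂ) (gaussLog d b a y p (-κ) z) := by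
  rw [gaussLog, gaussLog, stripFlip_stripFlip]
  simp
  ring

lemma gaussModel_stripFlip (d a b p y κ : ℝ) (z : ℂ) :
    gaussModel d a b p y κ (stripFlip d z)
      = (starRingEnd ℂ) (gaussModel d b a y p (-κ) z) := by
  rw [gaussModel, gaussModel, gaussLog_stripFlip, ← Complex.exp_conj]

/-- The growth of the Gauss map and its inverse at the lower boundary of the strip. -/
lemma exists_norm_gaussModel_le {d : ℝ} (hd : 0 < d) {a : ℝ} (ha : a ≤ 0) (b p y κ : ℝ) :
    ∃ C, ∀ z : ℂ, 0 < z.im → z.im ≤ d / 4 →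
      ‖gaussModel d a b p y κ z‖ ≤ C * z.im ^ a ∧
        ‖1 / gaussModel d a b p y κ z‖ ≤ C * z.im ^ a := by
  obtain ⟨C₁, h₁⟩ := exists_abs_logRatio_re_le hd p
  obtain ⟨C₂, h₂⟩ := exists_abs_logRatio_re_le hd y
  refine ⟨Real.exp (-a * C₁ + |b| * (C₂ - Real.log (d / 4))), fun z h0 h1 => ?_⟩
  have b1 := h₁ z h0 (by linarith)
  have b2 := h₂ (stripFlip d z) (by simp; linarith) (by simp; linarith)
  have hlog : Real.log (d / 4) ≤ Real.log (stripFlip d z).im :=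
    Real.log_le_log (by positivity) (by simp; linarith)
  have hre : |(gaussLog d a b p y κ z).re|
      ≤ -a * C₁ + |b| * (C₂ - Real.log (d / 4)) + a * Real.log z.im := by
    have e : (gaussLog d a b p y κ z).re
        = a * (logRatio d p z).re + b * (logRatio d y (stripFlip d z)).re := by
      simp [gaussLog]
    rw [e]
    refine (abs_add_le _ _).trans ?_
    rw [abs_mul, abs_mul, abs_of_nonpos ha]
    have m1 := mul_le_mul_of_nonneg_left b1 (neg_nonneg.2 ha)
    have m2 := mul_le_mul_of_nonneg_left (b2.trans (sub_le_sub_left hlog C₂)) (abs_nonneg b)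
    linarith
  have hC : Real.exp (-a * C₁ + |b| * (C₂ - Real.log (d / 4))) * z.im ^ a
      = Real.exp (-a * C₁ + |b| * (C₂ - Real.log (d / 4)) + a * Real.log z.im) := by
    rw [Real.rpow_def_of_pos h0, ← Real.exp_add]; ring_nf
  rw [hC, gaussModel, one_div, ← Complex.exp_neg, Complex.norm_exp, Complex.norm_exp,
    Real.exp_le_exp, Real.exp_le_exp, Complex.neg_re]
  exact ⟨(le_abs_self _).trans hre, (neg_le_abs _).trans hre⟩

/-- The logarithm of the modulus of the Gauss map on the real line. -/
noncomputable def boundaryLogNorm (d a b p y x : ℝ) : ℝ :=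
  a * (logRatio d p x).re + b * (logRatio d y (x + d * Complex.I / 2)).re

lemma gaussLog_ofReal {d : ℝ} (hd : 0 < d) (a b p y κ x : ℝ) :
    gaussLog d a b p y κ x = boundaryLogNorm d a b p y x
      + ((κ + a * (logRatio d p x).im - 2 * Real.pi * b * y : ℝ) : ℂ) * Complex.I := by
  have e : stripFlip d x = x + d * Complex.I / 2 := by simp [stripFlip]
  have him := logRatio_im_top hd y x
  rw [gaussLog, e]
  apply Complex.ext
  · simp [boundaryLogNorm]
  · simp [him]; ring

lemma boundaryLogNorm_eq {d : ℝ} (hd : 0 < d) (a b p y x : ℝ) :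
    boundaryLogNorm d a b p y x = (gaussLog d a b p y 0 x).re := by
  rw [gaussLog_ofReal hd]; simp

lemma boundaryLogNorm_neg {d : ℝ} (hd : 0 < d) (a b p y x : ℝ) :
    boundaryLogNorm d a b p y (-x) = -boundaryLogNorm d a b p y x := by
  have h := gaussLog_neg_conj hd a b p y 0 (z := x) (by simp) (by simp; positivity)
  rw [Complex.conj_ofReal, ← Complex.ofReal_neg] at h
  rw [boundaryLogNorm_eq hd, boundaryLogNorm_eq hd, h]
  simp

lemma boundaryLogNorm_add_one {d : ℝ} (hd : 0 < d) (a b p y x : ℝ) :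
    boundaryLogNorm d a b p y (x + 1) = boundaryLogNorm d a b p y x := by
  rw [boundaryLogNorm_eq hd, boundaryLogNorm_eq hd, Complex.ofReal_add, Complex.ofReal_one,
    gaussLog_add_one]

lemma cornerFree_inner {p x : ℝ} (hp1 : p < 1 / 2) (h0 : -p < x) (h1 : x < p) :
    CornerFree p (x : ℂ) := by
  refine fun n => ⟨fun e => ?_, fun e => ?_⟩
  · have h : x = p + n := by exact_mod_cast e
    have h2 : -1 < (n : ℝ) := by linarith
    have h3 : (n : ℝ) < 0 := by linarith
    norm_cast at h2 h3
    omega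
  · have h : x = -p + n := by exact_mod_cast e
    have h2 : 0 < (n : ℝ) := by linarith
    have h3 : (n : ℝ) < 1 := by linarith
    norm_cast at h2 h3
    omega

lemma cornerFree_outer {p x : ℝ} (hp0 : 0 < p) (h0 : p < x) (h1 : x < 1 - p) :
    CornerFree p (x : ℂ) := by
  refine fun n => ⟨fun e => ?_, fun e => ?_⟩
  · have h : x = p + n := by exact_mod_cast e
    have h2 : 0 < (n : ℝ) := by linarith
    have h3 : (n : ℝ) < 1 := by linarith
    norm_cast at h2 h3
    omega
  · have h : x = -p + n := by exact_mod_cast e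
    have h2 : 0 < (n : ℝ) := by linarith
    have h3 : (n : ℝ) < 1 := by linarith
    norm_cast at h2 h3
    omega

lemma boundaryLogNorm_pos {d : ℝ} (hd : 0 < d) {a b p y x : ℝ} (ha : a < 0) (hb : b < 0)
    (hp0 : 0 < p) (hp1 : p < 1 / 2) (hy0 : 0 < y) (hy1 : y < 1 / 2) (hx0 : 0 < x)
    (hx1 : x < 1 / 2) (hx : CornerFree p (x : ℂ)) : 0 < boundaryLogNorm d a b p y x := by
  have h1 := logRatio_re_neg hd hp0 hp1 (z := x) (by simp) (by simpa using hd) (by simpa using hx0)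
    (by simpa using hx1) hx
  have hi : ((x : ℂ) + d * Complex.I / 2).im = d / 2 := by simp
  have hr : ((x : ℂ) + d * Complex.I / 2).re = x := by simp
  have h2 := logRatio_re_neg hd hy0 hy1 (z := x + d * Complex.I / 2) (by rw [hi]; positivity)
    (by rw [hi]; linarith) (by rwa [hr]) (by rwa [hr])
    (cornerFree_of_im_ne_zero (by rw [hi]; positivity))
  rw [boundaryLogNorm]
  linarith [mul_pos_of_neg_of_neg ha h1, mul_pos_of_neg_of_neg hb h2]

/-! ### The hinges -/

lemma ray_im (d x s : ℝ) :
    ((d * Complex.I / 4 + s * (x - d * Complex.I / 4) : ℂ)).im = (1 - s) * (d / 4) := by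
  simp; ring

lemma analyticAt_gaussModel_ray {d : ℝ} (hd : 0 < d) {a b p y κ x s : ℝ} (h0 : 0 ≤ s)
    (h1 : s ≤ 1) (hx : s < 1 ∨ CornerFree p (x : ℂ)) :
    AnalyticAt ℂ (gaussModel d a b p y κ) (d * Complex.I / 4 + s * (x - d * Complex.I / 4)) := by
  have hle : 0 ≤ (1 - s) * (d / 4) := mul_nonneg (by linarith) (by linarith)
  have hle' : (1 - s) * (d / 4) ≤ d / 4 := mul_le_of_le_one_left (by linarith) (by linarith)
  refine analyticAt_gaussModel hd (by rw [ray_im]; exact hle) (by rw [ray_im]; linarith) ?_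
    (cornerFree_of_im_ne_zero (by rw [stripFlip_im, ray_im]; linarith))
  rcases h1.lt_or_eq with h | rfl
  · refine cornerFree_of_im_ne_zero ?_
    rw [ray_im]
    exact (mul_pos (by linarith) (by linarith)).ne'
  · rcases hx with h | h
    · exact absurd h (lt_irrefl _)
    · simpa using h

/-- The projection `F` of the surface is continuous along the real line, also at the corners, and
its velocity is `- sinh (log |G|)` times the unit vector `G / |G|`. -/
lemma planeProj_gaussModel {d : ℝ} (hd : 0 < d) {a : ℝ} (ha : -1 < a) (ha' : a ≤ 0)
    (b p y κ : ℝ) :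
    (Continuous fun x : ℝ => planeProj (d * Complex.I) (gaussModel d a b p y κ) x) ∧
    ∀ x₁ x₂ : ℝ, (∀ x ∈ Set.Ioo x₁ x₂, CornerFree p (x : ℂ)) → ∀ x ∈ Set.Ioo x₁ x₂,
      HasDerivAt (fun x : ℝ => planeProj (d * Complex.I) (gaussModel d a b p y κ) x)
        ((-Real.sinh (boundaryLogNorm d a b p y x) : ℝ) * Complex.exp
          ((κ + a * (logRatio d p x).im - 2 * Real.pi * b * y : ℝ) * Complex.I)) x := by
  set G := gaussModel d a b p y κ with hG
  have hne : ∀ z, G z ≠ 0 := fun z => Complex.exp_ne_zero _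
  obtain ⟨C, hC⟩ := exists_norm_gaussModel_le hd ha' b p y κ
  have hbound : ∀ g : ℂ → ℂ, (∀ z : ℂ, 0 < z.im → z.im ≤ d / 4 → ‖g z‖ ≤ C * z.im ^ a) →
      ∀ x s : ℝ, 0 ≤ s → s < 1 → ‖g (d * Complex.I / 4 + s * (x - d * Complex.I / 4))‖
        ≤ C * (d / 4) ^ a * (1 - s) ^ (-(-a)) := by
    intro g hg x s h0 h1
    have hpos : 0 < (1 - s) * (d / 4) := mul_pos (by linarith) (by linarith)
    have := hg (d * Complex.I / 4 + s * (x - d * Complex.I / 4)) (by rw [ray_im]; exact hpos)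
      (by rw [ray_im]; exact mul_le_of_le_one_left (by linarith) (by linarith))
    rw [ray_im, Real.mul_rpow (by linarith) (by linarith)] at this
    rw [neg_neg]
    linarith
  have hcG : ∀ x s : ℝ, 0 ≤ s → s < 1 →
      ContinuousAt G (d * Complex.I / 4 + s * (x - d * Complex.I / 4)) := fun x s h0 h1 =>
    (analyticAt_gaussModel_ray hd h0 h1.le (Or.inl h1)).continuousAt
  obtain ⟨i1, c1⟩ := continuous_segmentIntegral (g := G) (α := -a) (by linarith) hcG
    (hbound G fun z h0 h1 => (hC z h0 h1).1)
  obtain ⟨i2, c2⟩ := continuous_segmentIntegral (g := fun z => 1 / G z) (α := -a) (by linarith)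
    (fun x s h0 h1 => continuousAt_const.div (hcG x s h0 h1) (hne _))
    (hbound _ fun z h0 h1 => (hC z h0 h1).2)
  have hF : ∀ x : ℝ, planeProj (d * Complex.I) G x = ((starRingEnd ℂ)
      (segmentIntegral (fun w => 1 / G w) (d * Complex.I / 4) x)
      - segmentIntegral G (d * Complex.I / 4) x) / 2 := fun x => planeProj_eq (i1 x) (i2 x)
  simp only [hF]
  refine ⟨((Complex.continuous_conj.comp c2).sub c1).div_const _, fun x₁ x₂ hx x hxm => ?_⟩
  have hA : ∀ x ∈ Set.Ioo x₁ x₂, ∀ s ∈ Set.Icc (0 : ℝ) 1,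
      AnalyticAt ℂ G (d * Complex.I / 4 + s * (x - d * Complex.I / 4)) := fun x hx' s hs =>
    analyticAt_gaussModel_ray hd hs.1 hs.2 (Or.inr (hx x hx'))
  have d1 := hasDerivAt_segmentIntegral hxm hA
  have d2 := hasDerivAt_segmentIntegral (g := fun z => 1 / G z) hxm fun x hx' s hs => by
    simp only [one_div]
    exact (hA x hx' s hs).inv (hne _)
  have d3 := Complex.conjCLE.toContinuousLinearMap.hasFDerivAt.comp_hasDerivAt x d2
  refine ((d3.sub d1).div_const 2).congr_deriv ?_
  rw [hG, gaussModel, gaussLog_ofReal hd, one_div, ← Complex.exp_neg]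
  simp only [ContinuousLinearEquiv.coe_coe, Complex.conjCLE_apply, ← Complex.exp_conj]
  have e : (starRingEnd ℂ) (-((boundaryLogNorm d a b p y x : ℂ)
      + ((κ + a * (logRatio d p x).im - 2 * Real.pi * b * y : ℝ) : ℂ) * Complex.I))
      = -(boundaryLogNorm d a b p y x : ℂ)
        + ((κ + a * (logRatio d p x).im - 2 * Real.pi * b * y : ℝ) : ℂ) * Complex.I := by
    rw [map_neg, map_add, map_mul, Complex.conj_ofReal, Complex.conj_ofReal, Complex.conj_I]
    ring
  rw [e, Complex.exp_add, Complex.exp_add, Complex.ofReal_neg, Complex.ofReal_sinh, Complex.sinh]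
  ring

lemma exp_I_mul_conj (t : ℝ) : Complex.exp (t * Complex.I) *
    (starRingEnd ℂ) (Complex.exp (t * Complex.I)) = 1 := by
  rw [← Complex.exp_conj, ← Complex.exp_add]
  simp

/-- The hinge over the real line: the intervals `[-p, p]` and `[p, 1 - p]` are folded onto two
segments issuing from `F p`, in directions that enclose the angle `π (1 + a)`. -/
theorem lowerHinge {d : ℝ} (hd : 0 < d) {a b p y : ℝ} (ha : -1 < a) (ha' : a < 0) (hb : b < 0)
    (hp0 : 0 < p) (hp1 : p < 1 / 2) (hy0 : 0 < y) (hy1 : y < 1 / 2) (κ : ℝ) :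
    let F := planeProj (d * Complex.I) (gaussModel d a b p y κ)
    (F '' segment ℝ (-(p : ℂ)) p = segment ℝ (F p) (F 0) ∧
      ∃ k : ℝ, 0 < k ∧ F 0 = F p + k * Complex.exp
        ((κ + a * Real.pi - 2 * Real.pi * b * y : ℝ) * Complex.I)) ∧
    (F '' segment ℝ (p : ℂ) (1 - p) = segment ℝ (F p) (F (1 / 2)) ∧
      ∃ k : ℝ, 0 < k ∧ F (1 / 2) = F p - k * Complex.exp
        ((κ - 2 * Real.pi * b * y : ℝ) * Complex.I)) := by
  intro F
  obtain ⟨hc, hder⟩ := planeProj_gaussModel hd ha ha'.le b p y κ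
  set f : ℝ → ℂ := fun x : ℝ => F x with hf
  have hneg := boundaryLogNorm_neg hd a b p y
  constructor
  · have h := image_eq_segment_of_odd_speed (f := f) (m := 0) (r := p)
      (ρ := fun x => -Real.sinh (boundaryLogNorm d a b p y x)) hp0
      (exp_I_mul_conj (κ + a * Real.pi - 2 * Real.pi * b * y)) hc (fun x hx => ?_)
      (fun h _ => ?_) (fun x hx => ?_)
    · obtain ⟨h1, -, k, hk, h3⟩ := h
      simp only [zero_sub, zero_add, hf] at h1 h3
      refine ⟨?_, k, hk, by simpa using h3⟩
      rw [← Complex.ofReal_neg, segment_ofReal (by linarith), Set.image_image, h1,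
        Complex.ofReal_zero]
    · have hx' : x ∈ Set.Ioo (-p) p := by simpa using hx
      have := hder (-p) p (fun x hx => cornerFree_inner hp1 hx.1 hx.2) x hx'
      rwa [logRatio_im_inner hd hp1 hx'.1 hx'.2] at this
    · simp only [zero_add, zero_sub, hneg, Real.sinh_neg, neg_neg]
    · rw [zero_sub] at hx
      have := boundaryLogNorm_pos hd ha' hb hp0 hp1 hy0 hy1 (x := -x) (by linarith [hx.2])
        (by linarith [hx.1]) (cornerFree_inner hp1 (by linarith [hx.2]) (by linarith [hx.1]))
      rw [hneg] at this
      simpa using this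
  · have h := image_eq_segment_of_odd_speed (f := f) (m := 1 / 2) (r := 1 / 2 - p)
      (ρ := fun x => Real.sinh (boundaryLogNorm d a b p y x))
      (e := -Complex.exp ((κ - 2 * Real.pi * b * y : ℝ) * Complex.I)) (by linarith)
      (by rw [map_neg, neg_mul_neg, exp_I_mul_conj]) hc (fun x hx => ?_)
      (fun h _ => ?_) (fun x hx => ?_)
    · rw [show (1 / 2 : ℝ) - (1 / 2 - p) = p by ring,
        show (1 / 2 : ℝ) + (1 / 2 - p) = 1 - p by ring] at h
      obtain ⟨h1, h2, k, hk, h3⟩ := h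
      rw [← h2] at h1 h3
      have hhalf : f (1 / 2) = F (1 / 2) := by simp [hf]
      rw [hhalf] at h1 h3
      refine ⟨?_, k, hk, by rw [h3]; ring⟩
      rw [← h1, ← Complex.ofReal_one, ← Complex.ofReal_sub, segment_ofReal (by linarith),
        Set.image_image]
    · have hx' : x ∈ Set.Ioo p (1 - p) := ⟨by linarith [hx.1], by linarith [hx.2]⟩
      have := hder p (1 - p) (fun x hx => cornerFree_outer hp0 hx.1 hx.2) x hx'
      rw [logRatio_im_outer hd hp0 hx'.1 hx'.2] at this
      refine this.congr_deriv ?_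
      rw [mul_zero, add_zero]
      push_cast
      ring
    · rw [← Real.sinh_neg, ← hneg, ← boundaryLogNorm_add_one hd a b p y (-(1 / 2 - h))]
      ring_nf
    · have hx1 : p < x := by linarith [hx.1]
      exact Real.sinh_pos_iff.2 (boundaryLogNorm_pos hd ha' hb hp0 hp1 hy0 hy1
        (by linarith) hx.2 (cornerFree_outer hp0 hx1 (by linarith [hx.2])))

/-- Reflection at the central line of the strip corresponds to complex conjugation of the
projected surface. -/
lemma planeProj_stripFlip {d : ℝ} {G H : ℂ → ℂ} (h : ∀ w, G (stripFlip d w) = (starRingEnd ℂ) (H w))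
    (z : ℂ) : planeProj (d * Complex.I) G (stripFlip d z)
      = (starRingEnd ℂ) (planeProj (d * Complex.I) H z) := by
  have hs : ∀ f g : ℂ → ℂ, (∀ w, f (stripFlip d w) = (starRingEnd ℂ) (g w)) →
      segmentIntegral f (d * Complex.I / 4) (stripFlip d z)
        = (starRingEnd ℂ) (segmentIntegral g (d * Complex.I / 4) z) := by
    intro f g hfg
    have e : ∀ s : ℝ, (d * Complex.I / 4 + s * (stripFlip d z - d * Complex.I / 4) : ℂ)
        = stripFlip d (d * Complex.I / 4 + s * (z - d * Complex.I / 4)) := fun s => by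
      simp [stripFlip, Complex.conj_ofNat]; ring
    simp only [segmentIntegral, e, hfg]
    rw [map_mul, intervalIntegral.integral_of_le zero_le_one,
      intervalIntegral.integral_of_le zero_le_one, integral_conj]
    congr 1
    simp [stripFlip, Complex.conj_ofNat]; ring
  have e1 := hs (fun w => 1 / 2 * (1 / G w - G w)) (fun w => 1 / 2 * (1 / H w - H w)) fun w => by
    simp [h, Complex.conj_ofNat]
  have e2 := hs (fun w => Complex.I / 2 * (1 / G w + G w))
    (fun w => -(Complex.I / 2 * (1 / H w + H w))) fun w => by
    simp [h, Complex.conj_ofNat]; ring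
  have e3 : segmentIntegral (fun w => -(Complex.I / 2 * (1 / H w + H w))) (d * Complex.I / 4) z
      = -segmentIntegral (fun w => Complex.I / 2 * (1 / H w + H w)) (d * Complex.I / 4) z := by
    simp only [segmentIntegral]
    rw [intervalIntegral.integral_neg, mul_neg]
  apply Complex.ext
  · simp only [planeProj, weierstrassMap, Matrix.cons_val_zero, e1]
    simp
  · simp only [planeProj, weierstrassMap, Matrix.cons_val_one, e2, e3]
    simp

/-! ### The period condition -/

/-- The argument of the Gauss map at the point `i t` of the imaginary axis, relative to its value
at `t = 0`; see `gaussLog_axis`. -/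
noncomputable def relPhase (d a b p y t : ℝ) : ℝ :=
  a * axisArg d p t - b * axisArg d y (d / 2 - t) - (a * Real.pi - 2 * Real.pi * b * y)

lemma gaussLog_axis {d : ℝ} (hd : 0 < d) (a b p y κ : ℝ) {t : ℝ} (h0 : 0 ≤ t) (h1 : t ≤ d / 2) :
    gaussLog d a b p y κ (t * Complex.I) =
      ((κ + a * Real.pi - 2 * Real.pi * b * y + relPhase d a b p y t : ℝ) : ℂ) * Complex.I := by
  have e : stripFlip d (t * Complex.I) = ((d / 2 - t : ℝ) : ℂ) * Complex.I := by
    simp [stripFlip]; ring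
  rw [gaussLog, e, logRatio_axis hd p h0 (by linarith),
    logRatio_axis hd y (by linarith) (by linarith), relPhase]
  simp
  ring

lemma axisArg_mem {d : ℝ} (hd : 0 < d) {p : ℝ} (hp0 : 0 < p) (hp1 : p < 1 / 2) {t : ℝ}
    (h0 : 0 < t) (h1 : t < d / 2) :
    2 * Real.pi * p < axisArg d p t ∧ axisArg d p t < Real.pi := by
  constructor
  · rw [← axisArg_half hd p]
    exact axisArg_strictAnti hd hp0 hp1 h0.le h1 le_rfl
  · rw [← axisArg_zero_right hd hp0 hp1]
    exact axisArg_strictAnti hd hp0 hp1 le_rfl h0 h1.le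

lemma continuousOn_relPhase {d : ℝ} (hd : 0 < d) (a b p y : ℝ) :
    ContinuousOn (relPhase d a b p y) (Set.Ioo 0 (d / 2)) := by
  have h : ∀ (p : ℝ), ∀ t ∈ Set.Ioo 0 (d / 2), ContinuousAt (axisArg d p) t := by
    intro p t ht
    have := (analyticAt_logRatio hd (p := p) (z := t * Complex.I) (by simpa using ht.1.le)
      (by simpa using (by linarith [ht.2] : t < d))
      (cornerFree_of_im_ne_zero (by simpa using ht.1.ne'))).continuousAt
    exact Complex.continuous_im.continuousAt.comp
      (this.comp (f := fun t : ℝ => (t * Complex.I : ℂ)) (by fun_prop))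
  intro t ht
  have h1 := h p t ht
  have h2 : ContinuousAt (fun t => axisArg d y (d / 2 - t)) t :=
    ContinuousAt.comp (f := fun t => d / 2 - t)
      (h y (d / 2 - t) ⟨by linarith [ht.2], by linarith [ht.1]⟩) (by fun_prop)
  exact (((continuousAt_const.mul h1).sub (continuousAt_const.mul h2)).sub
    continuousAt_const).continuousWithinAt

lemma aestronglyMeasurable_comp_relPhase {d : ℝ} (hd : 0 < d) (a b p y : ℝ) {E : Type*}
    [TopologicalSpace E] [TopologicalSpace.PseudoMetrizableSpace E]
    [SecondCountableTopologyEither ℝ E] {g : ℝ → E} (hg : Continuous g) :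
    MeasureTheory.AEStronglyMeasurable (fun t => g (relPhase d a b p y t))
      (MeasureTheory.volume.restrict (Set.uIoc 0 (d / 2))) := by
  rw [Set.uIoc_of_le (by positivity),
    ← MeasureTheory.Measure.restrict_congr_set MeasureTheory.Ioo_ae_eq_Ioc]
  exact (hg.comp_continuousOn (continuousOn_relPhase hd a b p y)).aestronglyMeasurable
    measurableSet_Ioo

lemma intervalIntegrable_comp_relPhase {d : ℝ} (hd : 0 < d) (a b p y : ℝ) {E : Type*}
    [NormedAddCommGroup E] {g : ℝ → E} (hg : Continuous g) (hb : ∀ x, ‖g x‖ ≤ 1) :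
    IntervalIntegrable (fun t => g (relPhase d a b p y t)) MeasureTheory.volume 0 (d / 2) :=
  (intervalIntegrable_const (c := (1 : ℝ))).mono_fun'
    (aestronglyMeasurable_comp_relPhase hd a b p y hg)
    (Filter.Eventually.of_forall fun _ => hb _)

/-- Between `0` and `τ / 2`, the argument of the Gauss map stays strictly between its values at the
two ends, which differ by `π`. -/
lemma relPhase_mem {d : ℝ} (hd : 0 < d) {a b p y : ℝ} (ha : a < 0) (hb : b < 0)
    (hp0 : 0 < p) (hp1 : p < 1 / 2) (hy0 : 0 < y) (hy1 : y < 1 / 2)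
    (h : a * (2 * p - 1) + b * (2 * y - 1) = 1) {t : ℝ} (h0 : 0 < t) (h1 : t < d / 2) :
    0 < relPhase d a b p y t ∧ relPhase d a b p y t < Real.pi := by
  obtain ⟨l1, u1⟩ := axisArg_mem hd hp0 hp1 h0 h1
  obtain ⟨l2, u2⟩ := axisArg_mem hd hy0 hy1 (show 0 < d / 2 - t by linarith)
    (show d / 2 - t < d / 2 by linarith)
  have hπ : a * (2 * Real.pi * p - Real.pi) + b * (2 * Real.pi * y - Real.pi) = Real.pi := by
    linear_combination Real.pi * h
  have a1 := mul_lt_mul_of_neg_left l1 ha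
  have a2 := mul_lt_mul_of_neg_left u1 ha
  have b1 := mul_lt_mul_of_neg_left l2 hb
  have b2 := mul_lt_mul_of_neg_left u2 hb
  rw [relPhase]
  constructor <;> linarith

lemma integral_sin_relPhase_pos {d : ℝ} (hd : 0 < d) {a b p y : ℝ} (ha : a < 0) (hb : b < 0)
    (hp0 : 0 < p) (hp1 : p < 1 / 2) (hy0 : 0 < y) (hy1 : y < 1 / 2)
    (h : a * (2 * p - 1) + b * (2 * y - 1) = 1) :
    0 < ∫ t in (0 : ℝ)..d / 2, Real.sin (relPhase d a b p y t) := by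
  refine intervalIntegral.intervalIntegral_pos_of_pos_on
    (intervalIntegrable_comp_relPhase hd a b p y Real.continuous_sin Real.abs_sin_le_one)
    (fun t ht => ?_) (by positivity)
  obtain ⟨h1, h2⟩ := relPhase_mem hd ha hb hp0 hp1 hy0 hy1 h ht.1 ht.2
  exact Real.sin_pos_of_pos_of_lt_pi h1 h2

/-- The period condition can be solved. On the line `a (2p - 1) + b (2y - 1) = 1`, the integral of
the cosine of the relative phase is positive in the limit `y → 0`, where the phase stays in
`[0, π (1 + b)] ⊆ [0, π / 2]`, and negative in the limit `p → 0`, where it stays in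
`[-π a, π] ⊆ [π / 2, π]`. -/
theorem exists_period_solution {d : ℝ} (hd : 0 < d) {a b : ℝ} (ha : -1 < a) (ha' : a ≤ -(1 / 2))
    (hb : -1 < b) (hb' : b ≤ -(1 / 2)) (hab : a + b < -1) :
    ∃ p y : ℝ, 0 < p ∧ p < 1 / 2 ∧ 0 < y ∧ y < 1 / 2 ∧
      a * (2 * p - 1) + b * (2 * y - 1) = 1 ∧
      ∫ t in (0 : ℝ)..d / 2, Real.cos (relPhase d a b p y t) = 0 := by
  have ha0 : a < 0 := by linarith
  have hb0 : b < 0 := by linarith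
  have hπ := Real.pi_pos
  -- the solution `y` of `a (2p - 1) + b (2y - 1) = 1`, and the value of `p` for which it is `0`
  set Y : ℝ → ℝ := fun p => (1 + (1 - a * (2 * p - 1)) / b) / 2 with hY
  have hYeq : ∀ p, b * (2 * Y p - 1) = 1 - a * (2 * p - 1) := fun p => by
    have := hb0.ne
    simp only [hY]; field_simp; ring
  set P : ℝ := (1 + (1 + b) / a) / 2 with hP
  have hPeq : a * (2 * P - 1) = 1 + b := by
    have := ha0.ne
    simp only [hP]; field_simp; ring
  have hP0 : 0 < P := by
    by_contra! hle
    nlinarith [mul_nonneg_of_nonpos_of_nonpos ha0.le hle]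
  have hP1 : P < 1 / 2 := by
    by_contra! hle
    nlinarith [mul_nonpos_of_nonpos_of_nonneg ha0.le (sub_nonneg.2 hle)]
  have hYP : Y P = 0 := by
    have h := hYeq P
    rw [hPeq] at h
    have : b * Y P = 0 := by linarith
    exact (mul_eq_zero.1 this).resolve_left hb0.ne
  have hY0 : b * (2 * Y 0 - 1) = 1 + a := by rw [hYeq]; ring
  have hYlt : ∀ p, 0 ≤ p → Y p < 1 / 2 := fun p hp => by
    by_contra! hle
    have h1 := mul_nonpos_of_nonpos_of_nonneg hb0.le (sub_nonneg.2 hle)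
    have h2 := mul_nonpos_of_nonpos_of_nonneg ha0.le hp
    have h := hYeq p
    linarith
  have hYpos : ∀ p, p < P → 0 < Y p := fun p hp => by
    by_contra! hle
    have h1 := mul_nonneg_of_nonpos_of_nonpos hb0.le hle
    have h2 := mul_lt_mul_of_neg_left hp ha0
    have h := hYeq p
    linarith
  have hYc : Continuous Y := by simp only [hY]; fun_prop
  set J : ℝ → ℝ := fun p => ∫ t in (0 : ℝ)..d / 2, Real.cos (relPhase d a b p (Y p) t) with hJ
  have hint : ∀ p, IntervalIntegrable (fun t => Real.cos (relPhase d a b p (Y p) t))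
      MeasureTheory.volume 0 (d / 2) := fun p =>
    intervalIntegrable_comp_relPhase hd a b p (Y p) Real.continuous_cos Real.abs_cos_le_one
  have hJc : Continuous J := by
    refine continuous_iff_continuousAt.2 fun p₀ => ?_
    refine intervalIntegral.continuousAt_of_dominated_interval (bound := fun _ => (1 : ℝ))
      (Filter.Eventually.of_forall fun p =>
        aestronglyMeasurable_comp_relPhase hd a b p (Y p) Real.continuous_cos)
      (Filter.Eventually.of_forall fun p => Filter.Eventually.of_forall fun t _ =>
        Real.abs_cos_le_one _) intervalIntegrable_const ?_
    have hne : ∀ᵐ t : ℝ, t ≠ d / 2 := by simp [MeasureTheory.ae_iff]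
    filter_upwards [hne] with t ht ht'
    rw [Set.uIoc_of_le (by positivity)] at ht'
    have h1 : t < d / 2 := lt_of_le_of_ne ht'.2 ht
    have c1 := continuous_axisArg_left hd ht'.1 (by linarith)
    have c2 := (continuous_axisArg_left hd (t := d / 2 - t) (by linarith)
      (by linarith [ht'.1])).comp hYc
    refine Continuous.continuousAt ?_
    exact Real.continuous_cos.comp (((continuous_const.mul c1).sub (continuous_const.mul c2)).sub
      (continuous_const.sub (continuous_const.mul hYc)))
  have hJP : 0 < J P := by
    refine intervalIntegral.intervalIntegral_pos_of_pos_on (hint P) (fun t ht => ?_) (by positivity)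
    obtain ⟨l1, u1⟩ := axisArg_mem hd hP0 hP1 ht.1 ht.2
    have e : relPhase d a b P (Y P) t = a * axisArg d P t - a * Real.pi := by
      rw [hYP, relPhase, axisArg_zero_left]; ring
    have a1 := mul_lt_mul_of_neg_left l1 ha0
    have a2 := mul_lt_mul_of_neg_left u1 ha0
    have h3 : a * (2 * Real.pi * P) - a * Real.pi = Real.pi * (1 + b) := by
      linear_combination Real.pi * hPeq
    have h4 : Real.pi * (1 + b) ≤ Real.pi / 2 := by nlinarith
    rw [e]
    exact Real.cos_pos_of_mem_Ioo ⟨by linarith, by linarith⟩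
  have hJ0 : J 0 < 0 := by
    have : 0 < ∫ t in (0 : ℝ)..d / 2, -Real.cos (relPhase d a b 0 (Y 0) t) := by
      refine intervalIntegral.intervalIntegral_pos_of_pos_on (hint 0).neg (fun t ht => ?_)
        (by positivity)
      obtain ⟨l1, u1⟩ := axisArg_mem hd (hYpos 0 hP0) (hYlt 0 le_rfl)
        (show 0 < d / 2 - t by linarith [ht.2]) (show d / 2 - t < d / 2 by linarith [ht.1])
      have e : relPhase d a b 0 (Y 0) t = -b * axisArg d (Y 0) (d / 2 - t)
          - (a * Real.pi - 2 * Real.pi * b * Y 0) := by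
        rw [relPhase, axisArg_zero_left]; ring
      have a1 := mul_lt_mul_of_neg_left l1 hb0
      have a2 := mul_lt_mul_of_neg_left u1 hb0
      have h3 : b * (2 * Real.pi * Y 0) - b * Real.pi = Real.pi * (1 + a) := by
        linear_combination Real.pi * hY0
      have h4 : a * Real.pi ≤ -(Real.pi / 2) := by nlinarith
      rw [e, neg_pos]
      exact Real.cos_neg_of_pi_div_two_lt_of_lt (by linarith) (by linarith)
    rw [intervalIntegral.integral_neg] at this
    linarith
  obtain ⟨p, ⟨hp0, hp1⟩, hp⟩ := intermediate_value_Ioo hP0.le hJc.continuousOn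
    (show (0 : ℝ) ∈ Set.Ioo (J 0) (J P) from ⟨hJ0, hJP⟩)
  exact ⟨p, Y p, hp0, hp1.trans hP1, hYpos p hp1, hYlt p hp0.le, by linarith [hYeq p], hp⟩

/-! ### Symmetries and zeros of the theta function -/

lemma oddTheta_neg (τ u : ℂ) : oddTheta τ (-u) = -oddTheta τ u := by
  rw [oddTheta, ← (Equiv.subLeft (-1 : ℤ)).tsum_eq, oddTheta, ← tsum_neg]
  refine tsum_congr fun n => ?_
  have h : Complex.exp (n * (2 * Real.pi * Complex.I)) = 1 := Complex.exp_int_mul_two_pi_mul_I n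
  have h' : Complex.exp (Real.pi * Complex.I) = -1 := Complex.exp_pi_mul_I
  have h2 : Complex.exp (n * (2 * Real.pi * Complex.I) + Real.pi * Complex.I) = -1 := by
    rw [Complex.exp_add, h, h', one_mul]
  have e : ∀ x y z : ℂ, x = y + z → Complex.exp z = -1 → Complex.exp x = -Complex.exp y :=
    fun x y z hx hz => by rw [hx, Complex.exp_add, hz, mul_neg_one]
  refine e _ _ _ ?_ h2
  simp only [Equiv.subLeft_apply]
  push_cast
  ring

lemma oddTheta_period_sub (τ u : ℂ) : oddTheta τ (τ - u) =
    Complex.exp (2 * Real.pi * Complex.I * u - Real.pi * Complex.I * τ) * oddTheta τ u := by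
  rw [oddTheta, ← (Equiv.subLeft (-2 : ℤ)).tsum_eq, oddTheta, ← tsum_mul_left]
  refine tsum_congr fun n => ?_
  have h : Complex.exp ((n + 1 : ℤ) * (2 * Real.pi * Complex.I)) = 1 :=
    Complex.exp_int_mul_two_pi_mul_I _
  have e : ∀ x y v z : ℂ, x = y + v + z → Complex.exp z = 1 →
      Complex.exp x = Complex.exp y * Complex.exp v :=
    fun x y v z hx hz => by rw [hx, Complex.exp_add, hz, mul_one, Complex.exp_add]
  refine e _ _ _ _ ?_ h
  simp only [Equiv.subLeft_apply]
  push_cast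
  ring

lemma oddTheta_conj (d : ℝ) (u : ℂ) :
    (starRingEnd ℂ) (oddTheta (d * Complex.I) u) = oddTheta (d * Complex.I) ((starRingEnd ℂ) u) := by
  rw [oddTheta, Complex.conj_tsum, oddTheta, ← (Equiv.subLeft (-1 : ℤ)).tsum_eq]
  refine tsum_congr fun n => ?_
  rw [← Complex.exp_conj]
  congr 1
  simp only [Equiv.subLeft_apply]
  simp [Complex.conj_ofNat]
  ring

lemma tprod_one_sub_geom_ne_zero {Q w : ℂ} (hQ : ‖Q‖ < 1) (h : ∀ n : ℕ, Q ^ n * w ≠ 1) :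
    ∏' n : ℕ, (1 - Q ^ n * w) ≠ 0 := by
  have hs : Summable fun n : ℕ => ‖-(Q ^ n * w)‖ := by simpa using summable_geom_mul hQ w
  have := tprod_one_add_ne_zero_of_summable (f := fun n : ℕ => -(Q ^ n * w)) (fun n => ?_) hs
  · simpa [sub_eq_add_neg] using this
  · rw [← sub_eq_add_neg]
    exact sub_ne_zero.2 (h n).symm

lemma nomeSq_pow_mul_expTwo (d : ℝ) (n : ℕ) (u : ℂ) :
    (nomeSq d : ℂ) ^ n * expTwo u = expTwo (u + n * (d * Complex.I)) := by
  rw [nomeSq, Complex.ofReal_exp, ← Complex.exp_nat_mul, expTwo, expTwo, ← Complex.exp_add]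
  congr 1
  push_cast
  linear_combination (-2 * Real.pi * d * n : ℂ) * Complex.I_sq

/-- The theta function vanishes only at the points of the lattice `ℤ + i d ℤ`. -/
lemma oddTheta_ne_zero {d : ℝ} (hd : 0 < d) {u : ℂ}
    (hu : ∀ m n : ℤ, u ≠ m + n * (d * Complex.I)) : oddTheta (d * Complex.I) u ≠ 0 := by
  obtain ⟨c, hc, h⟩ := oddTheta_eq_tprod hd
  have hQ : ‖(Real.exp (-2 * Real.pi * d) : ℂ)‖ < 1 := norm_nomeSq_lt_one hd
  rw [h]
  refine mul_ne_zero hc (mul_ne_zero (Complex.exp_ne_zero _) (mul_ne_zero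
    (tprod_one_sub_geom_ne_zero hQ fun n => ?_) (tprod_one_sub_geom_ne_zero hQ fun n => ?_)))
  · have := nomeSq_pow_mul_expTwo d n u
    rw [nomeSq, expTwo] at this
    rw [this]
    refine expTwo_ne_one fun m e => hu m (-n) ?_
    push_cast
    linear_combination e
  · have := nomeSq_pow_mul_expTwo d (n + 1) (-u)
    rw [nomeSq, expTwo, mul_neg, pow_succ, mul_assoc] at this
    rw [this]
    refine expTwo_ne_one fun m e => hu (-m) (n + 1) ?_
    push_cast at e ⊢
    linear_combination -e

lemma differentiable_oddTheta {d : ℝ} (hd : 0 < d) : Differentiable ℂ (oddTheta (d * Complex.I)) := by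
  have hτ : 0 < ((d : ℂ) * Complex.I).im := by simpa using hd
  have e : oddTheta (d * Complex.I) = fun u => Complex.exp (Real.pi * Complex.I *
      (d * Complex.I) / 4 + Real.pi * Complex.I * (u - 1 / 2)) *
      jacobiTheta₂ (u - 1 / 2 + d * Complex.I / 2) (d * Complex.I) := by
    funext u
    rw [oddTheta, jacobiTheta₂, ← tsum_mul_left]
    refine tsum_congr fun n => ?_
    rw [jacobiTheta₂_term, ← Complex.exp_add]
    congr 1
    ring
  rw [e]
  intro u
  have h1 : DifferentiableAt ℂ
      (fun u => jacobiTheta₂ (u - 1 / 2 + d * Complex.I / 2) (d * Complex.I)) u :=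
    DifferentiableAt.comp (f := fun u : ℂ => u - 1 / 2 + d * Complex.I / 2) u
      (differentiableAt_jacobiTheta₂_fst _ hτ) (by fun_prop)
  exact DifferentiableAt.mul (by fun_prop) h1

/-! ### Existence and uniqueness of logarithms -/

/-- An entire function without zeros on a star-shaped set has a continuous logarithm there,
given by integrating the logarithmic derivative along the rays. -/
lemma exists_log_of_starConvex {S : Set ℂ} {c : ℂ} (hS : StarConvex ℝ c S) (hc : c ∈ S)
    {f : ℂ → ℂ} (hf : Differentiable ℂ f) (h0 : ∀ z ∈ S, f z ≠ 0) :
    ∃ L : ℂ → ℂ, ContinuousOn L S ∧ ∀ z ∈ S, Complex.exp (L z) = f z := by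
  have hray : ∀ z ∈ S, ∀ s ∈ Set.Icc (0 : ℝ) 1, c + s * (z - c) ∈ S := by
    intro z hz s hs
    have := hS hz (sub_nonneg.2 hs.2) hs.1 (by ring)
    convert this using 1
    simp; ring
  have hf' : Continuous (deriv f) := (hf.contDiff (n := 1)).continuous_deriv le_rfl
  set φ : ℂ → ℝ → ℂ := fun z s =>
    (z - c) * (deriv f (c + s * (z - c)) / f (c + s * (z - c))) with hφ
  refine ⟨fun z => Complex.log (f c) + ∫ s in (0 : ℝ)..1, φ z s, ?_, ?_⟩
  · refine continuousOn_const.add ?_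
    rw [continuousOn_iff_continuous_domRestrict]
    -- clamping the parameter makes the integrand continuous on all of `S × ℝ`
    set clamp : ℝ → ℝ := fun s => (Set.projIcc 0 1 zero_le_one s : ℝ) with hclamp
    have hcl : Continuous clamp := continuous_subtype_val.comp continuous_projIcc
    have e : ∀ z : S, (Set.domRestrict S fun z => ∫ s in (0 : ℝ)..1, φ z s) z
        = ∫ s in (0 : ℝ)..1, φ z (clamp s) := by
      intro z
      rw [Set.domRestrict_apply]
      refine intervalIntegral.integral_congr fun s hs => ?_
      rw [Set.uIcc_of_le zero_le_one] at hs
      simp only [hclamp, Set.projIcc_of_mem zero_le_one hs]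
    rw [funext e]
    refine intervalIntegral.continuous_parametric_intervalIntegral_of_continuous' ?_ 0 1
    have hline : Continuous fun w : S × ℝ => c + (clamp w.2 : ℂ) * ((w.1 : ℂ) - c) := by fun_prop
    refine Continuous.mul (by fun_prop) ((hf'.comp hline).div (hf.continuous.comp hline) ?_)
    intro w
    exact h0 _ (hray w.1 w.1.2 _ (Set.projIcc 0 1 zero_le_one w.2).2)
  · intro z hz
    set γ : ℝ → ℂ := fun s => c + s * (z - c) with hγ
    have hγc : Continuous γ := by fun_prop
    set U : Set ℝ := {s | f (γ s) ≠ 0} with hU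
    have hUo : IsOpen U := isOpen_ne_fun (hf.continuous.comp hγc) continuous_const
    have hIU : Set.Icc (0 : ℝ) 1 ⊆ U := fun s hs => h0 _ (hray z hz s hs)
    have hφc : ContinuousOn (φ z) U := fun s hs =>
      (continuousAt_const.mul (((hf'.comp hγc).continuousAt).div
        (hf.continuous.comp hγc).continuousAt hs)).continuousWithinAt
    set k : ℝ → ℂ := fun s => f (γ s) * Complex.exp (-∫ r in (0 : ℝ)..s, φ z r) with hk
    have hkd : ∀ s ∈ Set.Icc (0 : ℝ) 1, HasDerivAt k 0 s := by
      intro s hs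
      have hint : IntervalIntegrable (φ z) MeasureTheory.volume 0 s := by
        refine ContinuousOn.intervalIntegrable (hφc.mono ?_)
        rw [Set.uIcc_of_le hs.1]
        exact (Set.Icc_subset_Icc_right hs.2).trans hIU
      have d1 := intervalIntegral.integral_hasDerivAt_right hint
        (hφc.stronglyMeasurableAtFilter hUo s (hIU hs)) (hφc.continuousAt (hUo.mem_nhds (hIU hs)))
      have d2 : HasDerivAt γ (1 * (z - c)) s :=
        ((Complex.ofRealCLM.hasDerivAt (x := s)).mul_const _).const_add c
      have d3 := (hf (γ s)).hasDerivAt.scomp s d2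
      have d4 := d3.mul d1.neg.cexp
      refine d4.congr_deriv ?_
      have hne : f (γ s) ≠ 0 := hIU hs
      simp only [Function.comp_apply, hφ, smul_eq_mul]
      change _ + f (γ s) * (_ * -((z - c) * (deriv f (γ s) / f (γ s)))) = 0
      field_simp
      ring
    have hconst := constant_of_has_deriv_right_zero (a := 0) (b := 1)
      (fun s hs => (hkd s hs).continuousAt.continuousWithinAt)
      (fun s hs => (hkd s (Set.Ico_subset_Icc_self hs)).hasDerivWithinAt) 1 ⟨zero_le_one, le_rfl⟩
    have h1 : γ 1 = z := by simp [hγ]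
    have h2 : γ 0 = c := by simp [hγ]
    simp only [hk, h1, h2, intervalIntegral.integral_same, neg_zero, Complex.exp_zero,
      mul_one] at hconst
    rw [Complex.exp_add, Complex.exp_log (h0 c hc), ← hconst, mul_assoc, ← Complex.exp_add]
    simp

/-- Two continuous logarithms of the same function on a preconnected set differ by a constant
multiple of `2πi`. -/
lemma exists_int_of_exp_eq {S : Set ℂ} (hS : IsPreconnected S) {L L' : ℂ → ℂ}
    (hL : ContinuousOn L S) (hL' : ContinuousOn L' S)
    (h : ∀ z ∈ S, Complex.exp (L z) = Complex.exp (L' z)) :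
    ∃ k : ℤ, ∀ z ∈ S, L z = L' z + k * (2 * Real.pi * Complex.I) := by
  rcases S.eq_empty_or_nonempty with rfl | ⟨z₀, hz₀⟩
  · exact ⟨0, by simp⟩
  have h' : ∀ z ∈ S, ∃ k : ℤ, L z = L' z + k * (2 * Real.pi * Complex.I) := fun z hz =>
    Complex.exp_eq_exp_iff_exists_int.1 (h z hz)
  obtain ⟨k₀, hk₀⟩ := h' z₀ hz₀
  refine ⟨k₀, fun z hz => ?_⟩
  obtain ⟨k, hk⟩ := h' z hz
  suffices k = k₀ by rw [hk, this]
  set N : ℂ → ℝ := fun z => (L z - L' z).im / (2 * Real.pi) with hN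
  have hNc : ContinuousOn N S :=
    (Complex.continuous_im.comp_continuousOn (hL.sub hL')).div_const _
  have hNk : ∀ z (k : ℤ), L z = L' z + k * (2 * Real.pi * Complex.I) → N z = k := by
    intro z k e
    simp only [hN, e, add_sub_cancel_left]
    have := Real.pi_pos.ne'
    simp [this]
  have hpre := (hS.image N hNc).ordConnected
  have hmem : ∀ x ∈ Set.uIcc (k : ℝ) k₀, ∃ m : ℤ, x = m := by
    intro x hx
    have := hpre.uIcc_subset ⟨z, hz, hNk z k hk⟩ ⟨z₀, hz₀, hNk z₀ k₀ hk₀⟩ hx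
    obtain ⟨w, hw, rfl⟩ := this
    obtain ⟨m, hm⟩ := h' w hw
    exact ⟨m, hNk w m hm⟩
  by_contra hne
  rcases lt_or_gt_of_ne hne with hlt | hlt
  · obtain ⟨m, hm⟩ := hmem (k + 1 / 2) (by
      have : (k : ℝ) + 1 ≤ k₀ := by exact_mod_cast hlt
      rw [Set.uIcc_of_le (by linarith)]; constructor <;> linarith)
    have : (2 * k + 1 : ℤ) = 2 * m := by
      have : (2 * k + 1 : ℝ) = 2 * m := by linarith
      exact_mod_cast this
    omega
  · obtain ⟨m, hm⟩ := hmem (k₀ + 1 / 2) (by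
      have : (k₀ : ℝ) + 1 ≤ k := by exact_mod_cast hlt
      rw [Set.uIcc_of_ge (by linarith)]; constructor <;> linarith)
    have : (2 * k₀ + 1 : ℤ) = 2 * m := by
      have : (2 * k₀ + 1 : ℝ) = 2 * m := by linarith
      exact_mod_cast this
    omega

/-! ### Branches of the Gauss map -/

lemma mirror_upper (d y : ℝ) : mirror ((y : ℂ) + d * Complex.I / 2) = -y + d * Complex.I / 2 := by
  simp [mirror, Complex.conj_ofNat]; ring

/-- The part of the domain of the Gauss map in the closed strip. -/
def stripDomain (d p y : ℝ) : Set ℂ :=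
  {z | z ∈ gaussDomain (d * Complex.I) p (y + d * Complex.I / 2) ∧ 0 ≤ z.im ∧ z.im ≤ d / 2}

lemma mem_gaussDomain_of_inner {d p y : ℝ} {z : ℂ} (h0 : 0 < z.im) (h1 : z.im < d / 2) :
    z ∈ gaussDomain (d * Complex.I) p (y + d * Complex.I / 2) := by
  refine ⟨Or.inl ⟨h0.le, by simpa using h1.le⟩, fun n => ?_⟩
  rw [mirror_upper]
  refine ⟨?_, ?_, ?_, ?_⟩ <;> intro e <;> have h := congrArg Complex.im e <;> simp at h <;> linarith

lemma mem_gaussDomain_axis {d p y : ℝ} (hp0 : 0 < p) (hp1 : p < 1 / 2) (hy0 : 0 < y)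
    (hy1 : y < 1 / 2) {z : ℂ} (hz : z.re = 0) :
    z ∈ gaussDomain (d * Complex.I) p (y + d * Complex.I / 2) := by
  have key : ∀ x : ℝ, 0 < x → x < 1 / 2 → ∀ n : ℤ, ¬ (0 = x + n) ∧ ¬ (0 = -x + (n : ℝ)) := by
    intro x h0 h1 n
    constructor <;> intro e
    · have h2 : -1 < (n : ℝ) := by linarith
      have h3 : (n : ℝ) < 0 := by linarith
      norm_cast at h2 h3
      omega
    · have h2 : 0 < (n : ℝ) := by linarith
      have h3 : (n : ℝ) < 1 := by linarith
      norm_cast at h2 h3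
      omega
  refine ⟨Or.inr hz, fun n => ?_⟩
  rw [mirror_upper]
  refine ⟨fun e => (key p hp0 hp1 n).1 ?_, fun e => (key p hp0 hp1 n).2 ?_,
    fun e => (key y hy0 hy1 n).1 ?_, fun e => (key y hy0 hy1 n).2 ?_⟩ <;>
    simpa [hz] using congrArg Complex.re e

lemma starConvex_gaussDomain {d p y : ℝ} (hd : 0 < d) (hp0 : 0 < p) (hp1 : p < 1 / 2) (hy0 : 0 < y)
    (hy1 : y < 1 / 2) : StarConvex ℝ (d * Complex.I / 4 : ℂ)
      (gaussDomain (d * Complex.I) p (y + d * Complex.I / 2)) := by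
  intro z hz r s hr hs hrs
  rcases hr.eq_or_lt with rfl | hr
  · rw [zero_add] at hrs
    simpa [hrs] using hz
  rcases hz.1 with h | h
  · have h2 : z.im ≤ d / 2 := by simpa using h.2
    have e : (r • (d * Complex.I / 4 : ℂ) + s • z).im = r * (d / 4) + s * z.im := by
      simp
    have i1 := mul_pos hr (show 0 < d / 4 by positivity)
    have i2 := mul_nonneg hs h.1
    have i3 := mul_le_mul_of_nonneg_left h2 hs
    refine mem_gaussDomain_of_inner (by rw [e]; linarith) ?_
    rw [e]
    have : r * (d / 2) + s * (d / 2) = d / 2 := by rw [← add_mul, hrs, one_mul]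
    linarith
  · exact mem_gaussDomain_axis hp0 hp1 hy0 hy1 (by simp [h])

lemma center_mem_gaussDomain {d p y : ℝ} (hd : 0 < d) :
    (d * Complex.I / 4 : ℂ) ∈ gaussDomain (d * Complex.I) p (y + d * Complex.I / 2) :=
  mem_gaussDomain_of_inner (by simpa using hd) (by simp; linarith)

lemma isPreconnected_stripDomain {d p y : ℝ} (hd : 0 < d) (hp0 : 0 < p) (hp1 : p < 1 / 2)
    (hy0 : 0 < y) (hy1 : y < 1 / 2) : IsPreconnected (stripDomain d p y) := by
  have hconv : Convex ℝ {z : ℂ | 0 ≤ z.im ∧ z.im ≤ d / 2} := by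
    have h := (convex_Icc (0 : ℝ) (d / 2)).linear_preimage (Complex.imLm)
    exact h
  have hc : (d * Complex.I / 4 : ℂ) ∈ {z : ℂ | 0 ≤ z.im ∧ z.im ≤ d / 2} := by
    constructor
    · simp; positivity
    · simp; linarith
  have hs : StarConvex ℝ (d * Complex.I / 4 : ℂ) (stripDomain d p y) :=
    (starConvex_gaussDomain hd hp0 hp1 hy0 hy1).inter (hconv.starConvex hc)
  exact (hs.isPathConnected ⟨center_mem_gaussDomain hd, hc⟩).isConnected.isPreconnected

lemma cornerFree_of_mem {d p y : ℝ} {z : ℂ}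
    (hz : z ∈ gaussDomain (d * Complex.I) p (y + d * Complex.I / 2)) :
    CornerFree p z ∧ CornerFree y (stripFlip d z) := by
  refine ⟨fun n => ⟨(hz.2 n).1, (hz.2 n).2.1⟩, fun n => ?_⟩
  have h := hz.2 n
  rw [mirror_upper] at h
  constructor
  · intro e
    apply h.2.2.1
    rw [← stripFlip_stripFlip d z, e]
    simp [stripFlip]; ring
  · intro e
    apply h.2.2.2
    rw [← stripFlip_stripFlip d z, e]
    simp [stripFlip]; ring

/-- The theta functions that enter the Gauss map have no zeros in its domain. -/
lemma oddTheta_sub_ne_zero {d p y : ℝ} (hd : 0 < d) (hp0 : 0 < p) (hp1 : p < 1 / 2)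
    (hy0 : 0 < y) (hy1 : y < 1 / 2) {z : ℂ}
    (hz : z ∈ gaussDomain (d * Complex.I) p (y + d * Complex.I / 2)) :
    oddTheta (d * Complex.I) (z - p) ≠ 0 ∧ oddTheta (d * Complex.I) (z - -p) ≠ 0 ∧
      oddTheta (d * Complex.I) (z - (y + d * Complex.I / 2)) ≠ 0 ∧
      oddTheta (d * Complex.I) (z - mirror (y + d * Complex.I / 2)) ≠ 0 := by
  -- a zero at height `n d` above the corner lies in the strip only for `n = 0`
  have key : ∀ c : ℂ, c.re = p ∨ c.re = -p ∨ c.re = y ∨ c.re = -y → 0 ≤ c.im → c.im ≤ d / 2 →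
      (∀ n : ℤ, z ≠ c + n) → oddTheta (d * Complex.I) (z - c) ≠ 0 := by
    intro c hre h0 h1 hc
    refine oddTheta_ne_zero hd fun m n e => ?_
    have e' : z = c + m + n * (d * Complex.I) := by linear_combination e
    rcases hz.1 with h | h
    · have him := congrArg Complex.im e'
      simp at him
      have h2 : z.im ≤ d / 2 := by simpa using h.2
      have h3 : 0 ≤ z.im := h.1
      have h4 : (n : ℝ) * d < 1 * d := by linarith
      have h5 : (-1 : ℝ) * d < n * d := by linarith
      have h6 : (n : ℝ) < 1 := lt_of_mul_lt_mul_right h4 hd.le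
      have h7 : (-1 : ℝ) < n := lt_of_mul_lt_mul_right h5 hd.le
      have h8 : n = 0 := by
        have : n < 1 := by exact_mod_cast h6
        have : -1 < n := by exact_mod_cast h7
        omega
      exact hc m (by rw [e', h8]; simp)
    · have hre' := congrArg Complex.re e'
      simp [h] at hre'
      have hb : |c.re| < 1 / 2 ∧ c.re ≠ 0 := by
        rcases hre with r | r | r | r <;> rw [r]
        · exact ⟨by rwa [abs_of_pos hp0], hp0.ne'⟩
        · exact ⟨by rwa [abs_neg, abs_of_pos hp0], by linarith⟩
        · exact ⟨by rwa [abs_of_pos hy0], hy0.ne'⟩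
        · exact ⟨by rwa [abs_neg, abs_of_pos hy0], by linarith⟩
      obtain ⟨b1, b2⟩ := abs_lt.1 hb.1
      have h6 : (m : ℝ) < 1 := by linarith
      have h7 : (-1 : ℝ) < m := by linarith
      have h8 : m = 0 := by
        have : m < 1 := by exact_mod_cast h6
        have : -1 < m := by exact_mod_cast h7
        omega
      rw [h8] at hre'
      apply hb.2
      simpa using hre'.symm
  have hd2 : 0 ≤ d / 2 := by positivity
  refine ⟨key _ (by simp) (by simp) (by simpa using hd2) fun n => (hz.2 n).1,
    key _ (by simp) (by simp) (by simpa using hd2) fun n => (hz.2 n).2.1,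
    key _ (by simp) (by simpa using hd2) (by simp) fun n => (hz.2 n).2.2.1,
    key _ (by rw [mirror_upper]; simp) (by rw [mirror_upper]; simpa using hd2)
      (by rw [mirror_upper]; simp) fun n => (hz.2 n).2.2.2⟩

/-- The Gauss map exists: its domain is star-shaped about the base point. -/
theorem exists_isGaussMap {d p y : ℝ} (hd : 0 < d) (hp0 : 0 < p) (hp1 : p < 1 / 2)
    (hy0 : 0 < y) (hy1 : y < 1 / 2) (a b : ℝ) :
    ∃ G : ℂ → ℂ, IsGaussMap (d * Complex.I) a b p (y + d * Complex.I / 2) G := by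
  have hS := starConvex_gaussDomain hd hp0 hp1 hy0 hy1
  have key : ∀ w : ℂ, (∀ z ∈ gaussDomain (d * Complex.I) p (y + d * Complex.I / 2),
      oddTheta (d * Complex.I) (z - w) ≠ 0) →
      ∃ L, IsLogTheta (d * Complex.I) (gaussDomain (d * Complex.I) p (y + d * Complex.I / 2)) w L :=
    fun w hw => exists_log_of_starConvex hS (center_mem_gaussDomain hd)
      (f := fun z => oddTheta (d * Complex.I) (z - w))
      ((differentiable_oddTheta hd).comp (differentiable_id.sub_const w)) hw
  have hne := fun z hz => oddTheta_sub_ne_zero (z := z) hd hp0 hp1 hy0 hy1 hz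
  obtain ⟨L₁, h₁⟩ := key p fun z hz => (hne z hz).1
  obtain ⟨L₂, h₂⟩ := key (-p) fun z hz => (hne z hz).2.1
  obtain ⟨L₃, h₃⟩ := key _ fun z hz => (hne z hz).2.2.1
  obtain ⟨L₄, h₄⟩ := key _ fun z hz => (hne z hz).2.2.2
  exact ⟨_, L₁, L₂, L₃, L₄, h₁, h₂, h₃, h₄, fun z _ => rfl⟩

/-- On the strip, every branch of the Gauss map is a rotation of the explicit one; along the
imaginary axis it is continued by the point symmetry `G (τ - z) G (z) = G (τ / 2) ^ 2`. -/
theorem IsGaussMap.eq_gaussModel {d p y a b : ℝ} (hd : 0 < d) (hp0 : 0 < p) (hp1 : p < 1 / 2)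
    (hy0 : 0 < y) (hy1 : y < 1 / 2) {G : ℂ → ℂ}
    (hG : IsGaussMap (d * Complex.I) a b p (y + d * Complex.I / 2) G) :
    (∃ κ : ℝ, ∀ z ∈ stripDomain d p y, G z = gaussModel d a b p y κ z) ∧
      ∀ t : ℝ, G ((d - t : ℝ) * Complex.I) * G (t * Complex.I)
        = G ((d / 2 : ℝ) * Complex.I) ^ 2 := by
  obtain ⟨L₁, L₂, L₃, L₄, h₁, h₂, h₃, h₄, hG⟩ := hG
  set D := gaussDomain (d * Complex.I) p (y + d * Complex.I / 2) with hD
  set θ := oddTheta (d * Complex.I) with hθ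
  have hp : ∀ z ∈ D, Complex.exp (L₁ z - L₂ z) = θ (z - p) / θ (z + p) := fun z hz => by
    rw [Complex.exp_sub, h₁.2 z hz, h₂.2 z hz, sub_neg_eq_add]
  have hq : ∀ z ∈ D, Complex.exp (L₃ z - L₄ z)
      = θ (z - d * Complex.I / 2 - y) / θ (z - d * Complex.I / 2 + y) := fun z hz => by
    rw [Complex.exp_sub, h₃.2 z hz, h₄.2 z hz, mirror_upper]
    congr 2 <;> ring
  constructor
  · have hS := isPreconnected_stripDomain hd hp0 hp1 hy0 hy1
    have hsub : stripDomain d p y ⊆ D := fun z hz => hz.1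
    have c1 : ContinuousOn (logRatio d p) (stripDomain d p y) := fun z hz =>
      (analyticAt_logRatio hd hz.2.1 (by linarith [hz.2.2])
        (cornerFree_of_mem hz.1).1).continuousAt.continuousWithinAt
    have c2 : ContinuousOn (fun z => (starRingEnd ℂ) (logRatio d y (stripFlip d z)))
        (stripDomain d p y) := fun z hz => by
      have h := (analyticAt_logRatio hd (z := stripFlip d z) (by simp; linarith [hz.2.2])
        (by simp; linarith [hz.2.1]) (cornerFree_of_mem hz.1).2).continuousAt
      exact (Complex.continuous_conj.continuousAt.comp (h.comp (f := stripFlip d)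
        (continuous_stripFlip d).continuousAt)).continuousWithinAt
    obtain ⟨k₁, e₁⟩ := exists_int_of_exp_eq hS ((h₁.1.sub h₂.1).mono hsub) c1 fun z hz => by
      rw [Pi.sub_apply, hp z (hsub hz), exp_logRatio hd hz.2.1 (by linarith [hz.2.2])
        (cornerFree_of_mem hz.1).1]
    obtain ⟨k₂, e₂⟩ := exists_int_of_exp_eq hS ((h₃.1.sub h₄.1).mono hsub) c2 fun z hz => by
      rw [Pi.sub_apply, hq z (hsub hz), Complex.exp_conj, exp_logRatio hd
        (z := stripFlip d z) (by simp; linarith [hz.2.2]) (by simp; linarith [hz.2.1])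
        (cornerFree_of_mem hz.1).2, map_div₀, oddTheta_conj, oddTheta_conj]
      congr 2 <;> · simp [stripFlip, Complex.conj_ofNat]; ring
    refine ⟨2 * Real.pi * (a * k₁ + b * k₂), fun z hz => ?_⟩
    have f₁ := e₁ z hz
    have f₂ := e₂ z hz
    rw [Pi.sub_apply] at f₁ f₂
    rw [hG z (hsub hz), gaussModel, gaussLog]
    congr 1
    push_cast
    linear_combination (a : ℂ) * f₁ + (b : ℂ) * f₂
  · set A : Set ℂ := {z | z.re = 0} with hA
    have hAc : IsPreconnected A := by
      have h := (convex_singleton (𝕜 := ℝ) (0 : ℝ)).linear_preimage Complex.reLm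
      exact h.isPreconnected
    have hAD : A ⊆ D := fun z hz => mem_gaussDomain_axis hp0 hp1 hy0 hy1 hz
    have hflip : Set.MapsTo (fun z : ℂ => d * Complex.I - z) A A := fun z hz => by
      have : z.re = 0 := hz
      simp [hA, this]
    have hmid : (d * Complex.I / 2 : ℂ) ∈ A := by simp [hA]
    -- a logarithm of a function with `f (τ - z) f (z)` constant is point symmetric
    have key : ∀ M : ℂ → ℂ, ContinuousOn M D → ∀ k : ℂ,
        (∀ z ∈ A, Complex.exp (M (d * Complex.I - z)) * Complex.exp (M z) = k) →
        ∀ z ∈ A, M (d * Complex.I - z) + M z = 2 * M (d * Complex.I / 2) := by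
      intro M hM k hk z hz
      have hmid' : (d * Complex.I - d * Complex.I / 2 : ℂ) = d * Complex.I / 2 := by ring
      have hMA := hM.mono hAD
      have hMf : ContinuousOn (fun z => M (d * Complex.I - z)) A :=
        hMA.comp (by fun_prop) hflip
      obtain ⟨n, hn⟩ := exists_int_of_exp_eq hAc (hMf.add hMA)
        (L' := fun _ => 2 * M (d * Complex.I / 2)) continuousOn_const fun z hz => by
          have := hk _ hmid
          rw [hmid'] at this
          rw [two_mul, Complex.exp_add, this, Pi.add_apply, Complex.exp_add, hk z hz]
      have h0 := hn _ hmid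
      rw [Pi.add_apply, hmid'] at h0
      have h1 := hn z hz
      rw [Pi.add_apply] at h1
      linear_combination h1 - h0
    have s₁ := key (fun z => L₁ z - L₂ z) (h₁.1.sub h₂.1)
      (Complex.exp (4 * Real.pi * Complex.I * p)) fun z hz => by
      obtain ⟨n1, n2, -, -⟩ := oddTheta_sub_ne_zero hd hp0 hp1 hy0 hy1 (hAD hz)
      rw [sub_neg_eq_add] at n2
      rw [hp _ (hAD (hflip hz)), hp z (hAD hz), hθ,
        show d * Complex.I - z - p = d * Complex.I - (z + p) by ring,
        show d * Complex.I - z + p = d * Complex.I - (z - p) by ring, oddTheta_period_sub,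
        oddTheta_period_sub, mul_div_mul_comm, mul_assoc, div_mul_div_cancel₀ n1, div_self n2,
        mul_one, ← Complex.exp_sub]
      congr 1; ring
    have s₂ := key (fun z => L₃ z - L₄ z) (h₃.1.sub h₄.1) 1 fun z hz => by
      obtain ⟨-, -, n1, n2⟩ := oddTheta_sub_ne_zero hd hp0 hp1 hy0 hy1 (hAD hz)
      rw [mirror_upper, show z - (-y + d * Complex.I / 2) = z - d * Complex.I / 2 + y by ring] at n2
      rw [show z - (y + d * Complex.I / 2) = z - d * Complex.I / 2 - y by ring] at n1
      rw [hq _ (hAD (hflip hz)), hq z (hAD hz), hθ,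
        show d * Complex.I - z - d * Complex.I / 2 - y = -(z - d * Complex.I / 2 + y) by ring,
        show d * Complex.I - z - d * Complex.I / 2 + y = -(z - d * Complex.I / 2 - y) by ring,
        oddTheta_neg, oddTheta_neg, neg_div_neg_eq, div_mul_div_cancel₀ n1, div_self n2]
    intro t
    have ht : (t * Complex.I : ℂ) ∈ A := by simp [hA]
    have r1 : (((d - t : ℝ) : ℂ) * Complex.I) = d * Complex.I - t * Complex.I := by push_cast; ring
    have r2 : (((d / 2 : ℝ) : ℂ) * Complex.I) = d * Complex.I / 2 := by push_cast; ring
    rw [r1, r2, hG _ (hAD (hflip ht)), hG _ (hAD ht), hG _ (hAD hmid), ← Complex.exp_add,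
      ← Complex.exp_nat_mul]
    congr 1
    have f₁ := s₁ _ ht
    have f₂ := s₂ _ ht
    push_cast
    linear_combination (a : ℂ) * f₁ + (b : ℂ) * f₂

/-! ### Integrals along the imaginary axis -/

lemma continuousOn_relPhase_Icc {d : ℝ} (hd : 0 < d) (a b : ℝ) {p y : ℝ} (hp0 : 0 < p)
    (hp1 : p < 1 / 2) (hy0 : 0 < y) (hy1 : y < 1 / 2) :
    ContinuousOn (relPhase d a b p y) (Set.Icc 0 (d / 2)) := by
  have h1 : ContinuousOn (axisArg d p) (Set.Icc 0 (d / 2)) :=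
    (continuousOn_axisArg hd hp0 hp1).mono fun t ht => ⟨ht.1, by linarith [ht.2]⟩
  have h2 : ContinuousOn (fun t => axisArg d y (d / 2 - t)) (Set.Icc 0 (d / 2)) :=
    (continuousOn_axisArg hd hy0 hy1).comp (by fun_prop)
      fun t ht => ⟨by linarith [ht.2], by linarith [ht.1]⟩
  exact ((continuousOn_const.mul h1).sub (continuousOn_const.mul h2)).sub continuousOn_const

lemma relPhase_half {d : ℝ} (hd : 0 < d) {a b p y : ℝ} (hy0 : 0 < y) (hy1 : y < 1 / 2)
    (h : a * (2 * p - 1) + b * (2 * y - 1) = 1) : relPhase d a b p y (d / 2) = Real.pi := by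
  rw [relPhase, axisArg_half hd, sub_self, axisArg_zero_right hd hy0 hy1]
  linear_combination Real.pi * h

lemma integral_exp_mul_I {u v c : ℝ} {ψ : ℝ → ℝ} (huv : u ≤ v) (hψ : ContinuousOn ψ (Set.Icc u v)) :
    ∫ t in u..v, Complex.exp ((c + ψ t : ℝ) * Complex.I) = Complex.exp (c * Complex.I) *
      (((∫ t in u..v, Real.cos (ψ t) : ℝ) : ℂ)
        + ((∫ t in u..v, Real.sin (ψ t) : ℝ) : ℂ) * Complex.I) := by
  rw [← Set.uIcc_of_le huv] at hψ
  have i1 : IntervalIntegrable (fun t => ((Real.cos (ψ t) : ℝ) : ℂ)) MeasureTheory.volume u v :=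
    (Complex.continuous_ofReal.comp_continuousOn
      (Real.continuous_cos.comp_continuousOn hψ)).intervalIntegrable
  have i2 : IntervalIntegrable (fun t => ((Real.sin (ψ t) : ℝ) : ℂ)) MeasureTheory.volume u v :=
    (Complex.continuous_ofReal.comp_continuousOn
      (Real.continuous_sin.comp_continuousOn hψ)).intervalIntegrable
  rw [← intervalIntegral.integral_ofReal, ← intervalIntegral.integral_ofReal,
    ← intervalIntegral.integral_mul_const, ← intervalIntegral.integral_add i1 (i2.mul_const _),
    ← intervalIntegral.integral_const_mul]
  refine intervalIntegral.integral_congr fun t _ => ?_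
  simp only [Complex.ofReal_add, add_mul, Complex.exp_add, Complex.ofReal_cos, Complex.ofReal_sin]
  rw [← Complex.exp_mul_I]

lemma axis_mem_stripDomain {d p y t : ℝ} (hp0 : 0 < p) (hp1 : p < 1 / 2) (hy0 : 0 < y)
    (hy1 : y < 1 / 2) (h0 : 0 ≤ t) (h1 : t ≤ d / 2) : (t * Complex.I : ℂ) ∈ stripDomain d p y :=
  ⟨mem_gaussDomain_axis hp0 hp1 hy0 hy1 (by simp), by simpa using h0, by simpa using h1⟩

/-- The closing condition: the second half of the period, on which `G (τ - z) G (z)` is constant,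
contributes the reflected phase, and the two halves add up to the integral of the cosine. -/
theorem IsGaussMap.period_eq_zero {d p y a b : ℝ} (hd : 0 < d) (hp0 : 0 < p) (hp1 : p < 1 / 2)
    (hy0 : 0 < y) (hy1 : y < 1 / 2) {G : ℂ → ℂ}
    (hG : IsGaussMap (d * Complex.I) a b p (y + d * Complex.I / 2) G)
    (h : a * (2 * p - 1) + b * (2 * y - 1) = 1)
    (hcos : ∫ t in (0 : ℝ)..d / 2, Real.cos (relPhase d a b p y t) = 0) :
    segmentIntegral G 0 (d * Complex.I) = 0 := by
  obtain ⟨⟨κ, hκ⟩, hsym⟩ := hG.eq_gaussModel hd hp0 hp1 hy0 hy1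
  set C : ℝ := κ + a * Real.pi - 2 * Real.pi * b * y with hC
  have hψ := continuousOn_relPhase_Icc hd a b hp0 hp1 hy0 hy1
  have hd2 : (0 : ℝ) ≤ d / 2 := by positivity
  have hG1 : ∀ t ∈ Set.Icc 0 (d / 2), G (t * Complex.I)
      = Complex.exp ((C + relPhase d a b p y t : ℝ) * Complex.I) := fun t ht => by
    rw [hκ _ (axis_mem_stripDomain hp0 hp1 hy0 hy1 ht.1 ht.2), gaussModel,
      gaussLog_axis hd a b p y κ ht.1 ht.2]
  have hG2 : ∀ t ∈ Set.Icc 0 (d / 2), G ((d - t : ℝ) * Complex.I)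
      = Complex.exp ((C + -relPhase d a b p y t : ℝ) * Complex.I) := fun t ht => by
    have hs := hsym t
    rw [hG1 t ht, hG1 _ ⟨hd2, le_rfl⟩, relPhase_half hd hy0 hy1 h] at hs
    apply mul_right_cancel₀ (Complex.exp_ne_zero _)
    rw [hs, ← Complex.exp_add, ← Complex.exp_nat_mul]
    -- the relative phase is `π` at `τ / 2`, so the square there contributes a full turn
    have h2 : Complex.exp (2 * Real.pi * Complex.I) = 1 := Complex.exp_two_pi_mul_I
    rw [← mul_one (Complex.exp (_ + _)), ← h2, ← Complex.exp_add]
    congr 1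
    push_cast
    ring
  have hc : ∀ ψ : ℝ → ℝ, ContinuousOn ψ (Set.Icc 0 (d / 2)) → ContinuousOn
      (fun t => Complex.exp ((C + ψ t : ℝ) * Complex.I)) (Set.Icc 0 (d / 2)) := fun ψ hψ =>
    Complex.continuous_exp.comp_continuousOn ((Complex.continuous_ofReal.comp_continuousOn
      (continuousOn_const.add hψ)).mul continuousOn_const)
  have c1 : ContinuousOn (fun t : ℝ => G (t * Complex.I)) (Set.Icc 0 (d / 2)) :=
    (hc _ hψ).congr hG1
  have c2 : ContinuousOn (fun t : ℝ => G (t * Complex.I)) (Set.Icc (d / 2) d) := by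
    have h2 : ContinuousOn (fun t : ℝ => G ((d - t : ℝ) * Complex.I)) (Set.Icc 0 (d / 2)) :=
      (hc _ hψ.neg).congr hG2
    have h3 := h2.comp (f := fun t : ℝ => d - t) (s := Set.Icc (d / 2) d) (by fun_prop)
      fun t ht => ⟨by linarith [ht.2], by linarith [ht.1]⟩
    refine h3.congr fun t _ => ?_
    simp
  have e := segmentIntegral_axis G 0 d
  rw [Complex.ofReal_zero, zero_mul] at e
  rw [e, ← intervalIntegral.integral_add_adjacent_intervals (b := d / 2)
    (c1.intervalIntegrable_of_Icc hd2) (c2.intervalIntegrable_of_Icc (by linarith))]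
  have e2 : ∫ t in d / 2..d, G (t * Complex.I)
      = ∫ t in (0 : ℝ)..d / 2, G ((d - t : ℝ) * Complex.I) := by
    have := intervalIntegral.integral_comp_sub_left (a := 0) (b := d / 2)
      (fun t : ℝ => G (t * Complex.I)) d
    rw [sub_zero, sub_half] at this
    exact this.symm
  have huIcc : Set.uIcc 0 (d / 2) = Set.Icc 0 (d / 2) := Set.uIcc_of_le hd2
  rw [e2, intervalIntegral.integral_congr fun t ht => hG1 t (huIcc ▸ ht),
    intervalIntegral.integral_congr fun t ht => hG2 t (huIcc ▸ ht),
    integral_exp_mul_I hd2 hψ, integral_exp_mul_I (ψ := fun t => -relPhase d a b p y t) hd2 hψ.neg]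
  simp only [Real.cos_neg, Real.sin_neg, hcos, intervalIntegral.integral_neg]
  push_cast
  ring

/-- The vector between the projections of the end points `0` and `τ / 2` of the imaginary axis in the
strip: as the integral of the cosine vanishes, it has the direction of `G 0`. -/
lemma planeProj_axis {d p y a b : ℝ} (hd : 0 < d) (hp0 : 0 < p) (hp1 : p < 1 / 2)
    (hy0 : 0 < y) (hy1 : y < 1 / 2) (κ : ℝ)
    (hcos : ∫ t in (0 : ℝ)..d / 2, Real.cos (relPhase d a b p y t) = 0) :
    planeProj (d * Complex.I) (gaussModel d a b p y κ) (d * Complex.I / 2)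
      = planeProj (d * Complex.I) (gaussModel d a b p y κ) 0
        + ((∫ t in (0 : ℝ)..d / 2, Real.sin (relPhase d a b p y t) : ℝ) : ℂ) * Complex.exp
          ((κ + a * Real.pi - 2 * Real.pi * b * y : ℝ) * Complex.I) := by
  set C : ℝ := κ + a * Real.pi - 2 * Real.pi * b * y with hC
  set G := gaussModel d a b p y κ with hG
  have hψ := continuousOn_relPhase_Icc hd a b hp0 hp1 hy0 hy1
  have hne : ∀ z, G z ≠ 0 := fun z => Complex.exp_ne_zero _
  have hd2 : (0 : ℝ) ≤ d / 2 := by positivity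
  have hd4 : d / 4 ∈ Set.Icc 0 (d / 2) := ⟨by positivity, by linarith⟩
  have hG1 : ∀ t ∈ Set.Icc 0 (d / 2), G (t * Complex.I)
      = Complex.exp ((C + relPhase d a b p y t : ℝ) * Complex.I) := fun t ht => by
    rw [hG, gaussModel, gaussLog_axis hd a b p y κ ht.1 ht.2]
  have cG : ∀ t ∈ Set.Icc 0 (d / 2), ContinuousAt G (t * Complex.I) := fun t ht => by
    have hm := axis_mem_stripDomain hp0 hp1 hy0 hy1 ht.1 ht.2
    obtain ⟨f1, f2⟩ := cornerFree_of_mem hm.1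
    exact (analyticAt_gaussModel hd hm.2.1 hm.2.2 f1 f2).continuousAt
  have cG' : ∀ t ∈ Set.Icc 0 (d / 2), ContinuousAt (fun z => 1 / G z) (t * Complex.I) :=
    fun t ht => continuousAt_const.div (cG t ht) (hne _)
  have e4 : (d * Complex.I / 4 : ℂ) = ((d / 4 : ℝ) : ℂ) * Complex.I := by push_cast; ring
  have hray : ∀ g : ℂ → ℂ, (∀ t ∈ Set.Icc 0 (d / 2), ContinuousAt g (t * Complex.I)) →
      ∀ t ∈ Set.Icc 0 (d / 2), IntervalIntegrable (fun s : ℝ => g (d * Complex.I / 4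
        + s * (t * Complex.I - d * Complex.I / 4))) MeasureTheory.volume 0 1 := by
    intro g hg t ht
    refine ContinuousOn.intervalIntegrable fun s hs => ?_
    rw [Set.uIcc_of_le zero_le_one] at hs
    have e : (d * Complex.I / 4 + s * (t * Complex.I - d * Complex.I / 4) : ℂ)
        = (((1 - s) * (d / 4) + s * t : ℝ) : ℂ) * Complex.I := by push_cast; ring
    have hmem := (convex_Icc 0 (d / 2)) hd4 ht (sub_nonneg.2 hs.2) hs.1 (by ring)
    have h := hg _ hmem
    simp only [smul_eq_mul] at h
    rw [← e] at h
    exact (h.comp (f := fun s : ℝ => (d * Complex.I / 4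
      + s * (t * Complex.I - d * Complex.I / 4) : ℂ)) (by fun_prop)).continuousWithinAt
  have hdiff : ∀ g : ℂ → ℂ, (∀ t ∈ Set.Icc 0 (d / 2), ContinuousAt g (t * Complex.I)) →
      segmentIntegral g (d * Complex.I / 4) ((d / 2 : ℝ) * Complex.I)
        = segmentIntegral g (d * Complex.I / 4) ((0 : ℝ) * Complex.I)
          + Complex.I * ∫ t in (0 : ℝ)..d / 2, g (t * Complex.I) := by
    intro g hg
    have hint : ∀ u ∈ Set.Icc 0 (d / 2), ∀ v ∈ Set.Icc 0 (d / 2),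
        IntervalIntegrable (fun t : ℝ => g (t * Complex.I)) MeasureTheory.volume u v := by
      intro u hu v hv
      refine ContinuousOn.intervalIntegrable fun t ht => ?_
      exact ((hg t (Set.ordConnected_Icc.uIcc_subset hu hv ht)).comp
        (f := fun t : ℝ => (t * Complex.I : ℂ)) (by fun_prop)).continuousWithinAt
    rw [e4, segmentIntegral_axis, segmentIntegral_axis, ← mul_add,
      intervalIntegral.integral_add_adjacent_intervals
        (hint _ hd4 _ ⟨le_rfl, hd2⟩) (hint _ ⟨le_rfl, hd2⟩ _ ⟨hd2, le_rfl⟩)]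
  have huIcc : Set.uIcc 0 (d / 2) = Set.Icc 0 (d / 2) := Set.uIcc_of_le hd2
  have I1 : ∫ t in (0 : ℝ)..d / 2, G (t * Complex.I) = Complex.exp (C * Complex.I) *
      (((∫ t in (0 : ℝ)..d / 2, Real.sin (relPhase d a b p y t) : ℝ) : ℂ) * Complex.I) := by
    rw [intervalIntegral.integral_congr fun t ht => hG1 t (huIcc ▸ ht), integral_exp_mul_I hd2 hψ,
      hcos]
    simp
  have I2 : ∫ t in (0 : ℝ)..d / 2, 1 / G (t * Complex.I) = Complex.exp ((-C : ℝ) * Complex.I) *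
      (-((∫ t in (0 : ℝ)..d / 2, Real.sin (relPhase d a b p y t) : ℝ) : ℂ) * Complex.I) := by
    have hG2 : ∀ t ∈ Set.uIcc 0 (d / 2), 1 / G (t * Complex.I)
        = Complex.exp ((-C + -relPhase d a b p y t : ℝ) * Complex.I) := fun t ht => by
      rw [hG1 t (huIcc ▸ ht), one_div, ← Complex.exp_neg]
      congr 1; push_cast; ring
    rw [intervalIntegral.integral_congr hG2,
      integral_exp_mul_I (ψ := fun t => -relPhase d a b p y t) hd2 hψ.neg]
    simp only [Real.cos_neg, Real.sin_neg, hcos, intervalIntegral.integral_neg]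
    push_cast
    ring
  have e0 : (0 : ℂ) = ((0 : ℝ) : ℂ) * Complex.I := by simp
  have e2 : (d * Complex.I / 2 : ℂ) = ((d / 2 : ℝ) : ℂ) * Complex.I := by push_cast; ring
  have m0 : (0 : ℝ) ∈ Set.Icc 0 (d / 2) := ⟨le_rfl, hd2⟩
  have m2 : d / 2 ∈ Set.Icc 0 (d / 2) := ⟨hd2, le_rfl⟩
  rw [e0, e2, planeProj_eq (hray G cG _ m2) (hray _ cG' _ m2),
    planeProj_eq (hray G cG _ m0) (hray _ cG' _ m0), hdiff G cG, hdiff _ cG', I1, I2]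
  have hconj : (starRingEnd ℂ) (Complex.exp ((-C : ℝ) * Complex.I))
      = Complex.exp (C * Complex.I) := by
    rw [← Complex.exp_conj]
    congr 1
    simp
  simp only [map_add, map_mul, map_neg, Complex.conj_I, Complex.conj_ofReal, hconj]
  linear_combination (-(Complex.exp (C * Complex.I) *
    ((∫ t in (0 : ℝ)..d / 2, Real.sin (relPhase d a b p y t) : ℝ) : ℂ))) * Complex.I_sq

/-! ### The triangle -/

lemma abs_arg_ofReal_mul_exp {r t : ℝ} (hr : 0 < r) (ht : |t| < Real.pi) :
    |((r : ℂ) * Complex.exp (t * Complex.I)).arg| = |t| := by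
  obtain ⟨h1, h2⟩ := abs_lt.1 ht
  rw [Complex.arg_real_mul _ hr, Complex.arg_exp_mul_I, (toIocMod_eq_self _).2]
  exact ⟨h1, by linarith⟩

open EuclideanGeometry in
/-- Two rays that issue from distinct points `P` and `R` to the same side of the line `P R`, at
angles `A` and `B` to the segment with `A + B < π`, meet in the third vertex of a triangle. The
side lengths come from the law of sines. -/
lemma exists_triangle {e P R : ℂ} {A B D : ℝ} (he : e ≠ 0) (hD : 0 < D) (hA0 : 0 < A) (hB0 : 0 < B)
    (hAB : A + B < Real.pi) (hR : R = P + D * e) :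
    ∃ (C : ℂ) (c₁ c₂ : ℝ), 0 < c₁ ∧ 0 < c₂ ∧
      C = P + c₁ * (e * Complex.exp ((-A : ℝ) * Complex.I)) ∧
      C = R - c₂ * (e * Complex.exp (B * Complex.I)) ∧
      AffineIndependent ℝ ![P, R, C] ∧ ∠ R P C = A ∧ ∠ P R C = B := by
  have hsA : 0 < Real.sin A := Real.sin_pos_of_pos_of_lt_pi hA0 (by linarith)
  have hsB : 0 < Real.sin B := Real.sin_pos_of_pos_of_lt_pi hB0 (by linarith)
  have hsAB : 0 < Real.sin (A + B) := Real.sin_pos_of_pos_of_lt_pi (by linarith) hAB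
  set c₁ : ℝ := D * Real.sin B / Real.sin (A + B) with hc₁
  set c₂ : ℝ := D * Real.sin A / Real.sin (A + B) with hc₂
  have h1 : 0 < c₁ := by positivity
  have h2 : 0 < c₂ := by positivity
  set C : ℂ := P + c₁ * (e * Complex.exp ((-A : ℝ) * Complex.I)) with hC
  have hC' : C = R - c₂ * (e * Complex.exp (B * Complex.I)) := by
    have k1 : c₁ * Real.cos A + c₂ * Real.cos B = D := by
      rw [hc₁, hc₂]
      field_simp
      rw [Real.sin_add]; ring
    have k2 : c₁ * Real.sin A = c₂ * Real.sin B := by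
      rw [hc₁, hc₂]; ring
    have k1' : (c₁ : ℂ) * (Real.cos A : ℂ) + c₂ * (Real.cos B : ℂ) = D := by exact_mod_cast k1
    have k2' : (c₁ : ℂ) * (Real.sin A : ℂ) = c₂ * (Real.sin B : ℂ) := by exact_mod_cast k2
    rw [hC, hR, Complex.exp_mul_I, Complex.exp_mul_I, ← Complex.ofReal_cos, ← Complex.ofReal_sin,
      ← Complex.ofReal_cos, ← Complex.ofReal_sin, Real.cos_neg, Real.sin_neg]
    push_cast at k1' k2' ⊢
    linear_combination e * k1' - e * Complex.I * k2'
  have hexp : ∀ t : ℂ, Complex.exp t ≠ 0 := Complex.exp_ne_zero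
  have hDc : (D : ℂ) ≠ 0 := by exact_mod_cast hD.ne'
  have h1c : (c₁ : ℂ) ≠ 0 := by exact_mod_cast h1.ne'
  have h2c : (c₂ : ℂ) ≠ 0 := by exact_mod_cast h2.ne'
  have angP : ∠ R P C = A := by
    have e1 : R -ᵥ P = D * e := by rw [vsub_eq_sub, hR]; ring
    have e2 : C -ᵥ P = c₁ * (e * Complex.exp ((-A : ℝ) * Complex.I)) := by
      rw [vsub_eq_sub, hC]; ring
    rw [EuclideanGeometry.angle, e1, e2, Complex.angle_eq_abs_arg (mul_ne_zero hDc he)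
      (mul_ne_zero h1c (mul_ne_zero he (hexp _)))]
    have e3 : (D * e : ℂ) / (c₁ * (e * Complex.exp ((-A : ℝ) * Complex.I)))
        = ((D / c₁ : ℝ) : ℂ) * Complex.exp (A * Complex.I) := by
      have : Complex.exp (A * Complex.I) * Complex.exp ((-A : ℝ) * Complex.I) = 1 := by
        rw [← Complex.exp_add]; simp
      rw [div_eq_iff (mul_ne_zero h1c (mul_ne_zero he (hexp _)))]
      generalize Complex.exp (A * Complex.I) = E at this ⊢
      generalize Complex.exp ((-A : ℝ) * Complex.I) = E' at this ⊢
      push_cast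
      field_simp
      linear_combination -this
    rw [e3, abs_arg_ofReal_mul_exp (by positivity) (by rw [abs_of_pos hA0]; linarith),
      abs_of_pos hA0]
  have angR : ∠ P R C = B := by
    have e1 : P -ᵥ R = -(D * e) := by rw [vsub_eq_sub, hR]; ring
    have e2 : C -ᵥ R = -(c₂ * (e * Complex.exp (B * Complex.I))) := by
      rw [vsub_eq_sub, hC']; ring
    rw [EuclideanGeometry.angle, e1, e2, Complex.angle_eq_abs_arg
      (neg_ne_zero.2 (mul_ne_zero hDc he))
      (neg_ne_zero.2 (mul_ne_zero h2c (mul_ne_zero he (hexp _)))), neg_div_neg_eq]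
    have e3 : (D * e : ℂ) / (c₂ * (e * Complex.exp (B * Complex.I)))
        = ((D / c₂ : ℝ) : ℂ) * Complex.exp ((-B : ℝ) * Complex.I) := by
      have : Complex.exp ((-B : ℝ) * Complex.I) * Complex.exp (B * Complex.I) = 1 := by
        rw [← Complex.exp_add]; simp
      rw [div_eq_iff (mul_ne_zero h2c (mul_ne_zero he (hexp _)))]
      generalize Complex.exp (B * Complex.I) = E at this ⊢
      generalize Complex.exp ((-B : ℝ) * Complex.I) = E' at this ⊢
      push_cast
      field_simp
      linear_combination -this
    rw [e3, abs_arg_ofReal_mul_exp (by positivity) (by rw [abs_neg, abs_of_pos hB0]; linarith),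
      abs_neg, abs_of_pos hB0]
  refine ⟨C, c₁, c₂, h1, h2, rfl, hC', ?_, angP, angR⟩
  rw [affineIndependent_iff_not_collinear_set, Set.insert_comm,
    EuclideanGeometry.collinear_iff_eq_or_eq_or_angle_eq_zero_or_angle_eq_pi, angP]
  rintro (h | h | h | h)
  · rw [hR] at h
    exact mul_ne_zero hDc he (by linear_combination h)
  · rw [hC] at h
    exact mul_ne_zero h1c (mul_ne_zero he (hexp ((-A : ℝ) * Complex.I)))
      (by linear_combination h)
  · exact hA0.ne' h
  · linarith

lemma sbtw_of_eq_add {e P Q R : ℂ} {r D : ℝ} (he : e ≠ 0) (hr : 0 < r) (hrD : r < D)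
    (hQ : Q = P + r * e) (hR : R = P + D * e) : Sbtw ℝ P Q R := by
  have hD : 0 < D := hr.trans hrD
  have hDc : (D : ℂ) ≠ 0 := by exact_mod_cast hD.ne'
  have hQ' : Q = AffineMap.lineMap P R (r / D) := by
    rw [AffineMap.lineMap_apply, hR, hQ]
    simp
    field_simp
    ring
  rw [hQ', sbtw_lineMap_iff]
  refine ⟨fun h => ?_, by positivity, (div_lt_one hD).2 hrD⟩
  rw [hR] at h
  exact mul_ne_zero hDc he (by linear_combination -h)

/-- The hinge over the upper boundary line, by reflection at the central line of the strip. -/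
theorem upperHinge {d : ℝ} (hd : 0 < d) {a b p y : ℝ} (ha : a < 0) (hb : -1 < b) (hb' : b < 0)
    (hp0 : 0 < p) (hp1 : p < 1 / 2) (hy0 : 0 < y) (hy1 : y < 1 / 2) (κ : ℝ) :
    let F := planeProj (d * Complex.I) (gaussModel d a b p y κ)
    let q : ℂ := y + d * Complex.I / 2
    (F '' segment ℝ (mirror q) q = segment ℝ (F q) (F (d * Complex.I / 2)) ∧
      ∃ k : ℝ, 0 < k ∧ F (d * Complex.I / 2) = F q + k * Complex.exp
        ((κ - b * Real.pi + 2 * Real.pi * a * p : ℝ) * Complex.I)) ∧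
    (F '' segment ℝ q (1 + mirror q) = segment ℝ (F q) (F (1 / 2 + d * Complex.I / 2)) ∧
      ∃ k : ℝ, 0 < k ∧ F (1 / 2 + d * Complex.I / 2) = F q - k * Complex.exp
        ((κ + 2 * Real.pi * a * p : ℝ) * Complex.I)) := by
  intro F q
  obtain ⟨⟨h1, k, hk, h2⟩, h3, l, hl, h4⟩ :=
    lowerHinge hd hb hb' ha hy0 hy1 hp0 hp1 (-κ)
  set H := planeProj (d * Complex.I) (gaussModel d b a y p (-κ)) with hH
  have hF : ∀ z, F (stripFlip d z) = (starRingEnd ℂ) (H z) :=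
    planeProj_stripFlip (gaussModel_stripFlip d a b p y κ)
  have hseg : ∀ u v : ℂ, F '' segment ℝ (stripFlip d u) (stripFlip d v)
      = (starRingEnd ℂ) '' (H '' segment ℝ u v) := by
    intro u v
    have e := image_segment ℝ (Complex.conjAe.toLinearMap.toAffineMap +
      AffineMap.const ℝ ℂ (d * Complex.I / 2 : ℂ)) u v
    have e' : ∀ z, (Complex.conjAe.toLinearMap.toAffineMap +
      AffineMap.const ℝ ℂ (d * Complex.I / 2 : ℂ)) z = stripFlip d z := fun z => rfl
    rw [e', e'] at e
    rw [← e, Set.image_image, Set.image_image]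
    refine Set.image_congr fun z _ => ?_
    rw [e', hF]
  have hconj : ∀ u v : ℂ, (starRingEnd ℂ) '' segment ℝ u v
      = segment ℝ ((starRingEnd ℂ) u) ((starRingEnd ℂ) v) := fun u v =>
    image_segment ℝ Complex.conjAe.toLinearMap.toAffineMap u v
  have q1 : q = stripFlip d y := by simp [q, stripFlip]
  have q2 : mirror q = stripFlip d (-y) := by rw [mirror_upper]; simp [stripFlip]
  have q3 : 1 + mirror q = stripFlip d (1 - y) := by rw [mirror_upper]; simp [stripFlip]; ring
  have q4 : (d * Complex.I / 2 : ℂ) = stripFlip d 0 := by simp [stripFlip]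
  have q5 : (1 / 2 + d * Complex.I / 2 : ℂ) = stripFlip d (1 / 2) := by
    simp [stripFlip, Complex.conj_ofNat]
  have hexp : ∀ r : ℝ, (starRingEnd ℂ) (Complex.exp (r * Complex.I))
      = Complex.exp ((-r : ℝ) * Complex.I) := fun r => by
    rw [← Complex.exp_conj]; congr 1; simp
  rw [q5, q4, q3, q2, q1, hseg, hseg, h1, h3, hconj, hconj, hF, hF, hF, h2, h4]
  refine ⟨⟨rfl, k, hk, ?_⟩, rfl, l, hl, ?_⟩
  · rw [map_add, map_mul, Complex.conj_ofReal, hexp]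
    congr 5; ring
  · rw [map_sub, map_mul, Complex.conj_ofReal, hexp]
    congr 5; ring

/-- The two hinges line up once the period condition holds: it makes the vectors `F 0 - F p`,
`F (τ / 2) - F 0` and `F q - F (τ / 2)` positive multiples of the same unit vector. -/
theorem hingesLineUp_gaussModel {d : ℝ} (hd : 0 < d) {a b p y : ℝ} (ha : -1 < a) (ha' : a < 0)
    (hb : -1 < b) (hb' : b < 0) (hab : a + b < -1)
    (hp0 : 0 < p) (hp1 : p < 1 / 2) (hy0 : 0 < y) (hy1 : y < 1 / 2) (κ : ℝ)
    (h : a * (2 * p - 1) + b * (2 * y - 1) = 1)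
    (hcos : ∫ t in (0 : ℝ)..d / 2, Real.cos (relPhase d a b p y t) = 0) :
    HingesLineUp (d * Complex.I) a b p (y + d * Complex.I / 2) (gaussModel d a b p y κ) := by
  have hπ := Real.pi_pos
  have hmid := planeProj_axis (a := a) (b := b) hd hp0 hp1 hy0 hy1 κ hcos
  have hS := integral_sin_relPhase_pos hd ha' hb' hp0 hp1 hy0 hy1 h
  obtain ⟨⟨s1, r₀, hr₀, f0⟩, s2, r₁, hr₁, f1⟩ := lowerHinge hd ha ha' hb' hp0 hp1 hy0 hy1 κ
  obtain ⟨⟨s3, r₂, hr₂, f2⟩, s4, r₃, hr₃, f3⟩ := upperHinge hd ha' hb hb' hp0 hp1 hy0 hy1 κ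
  rw [HingesLineUp]
  set F := planeProj (d * Complex.I) (gaussModel d a b p y κ) with hF
  set q : ℂ := y + d * Complex.I / 2 with hq
  set m : ℝ := ∫ t in (0 : ℝ)..d / 2, Real.sin (relPhase d a b p y t) with hm
  set ψ : ℝ := κ + a * Real.pi - 2 * Real.pi * b * y with hψ
  set e : ℂ := Complex.exp (ψ * Complex.I) with he
  have he0 : e ≠ 0 := Complex.exp_ne_zero _
  have hneg : Complex.exp (Real.pi * Complex.I) = -1 := Complex.exp_pi_mul_I
  have hψ' : κ - b * Real.pi + 2 * Real.pi * a * p = ψ + Real.pi := by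
    rw [hψ]; linear_combination Real.pi * h
  have f2' : F (d * Complex.I / 2) = F q - r₂ * e := by
    have : Complex.exp ((ψ + Real.pi : ℝ) * Complex.I) = -e := by
      rw [Complex.ofReal_add, add_mul, Complex.exp_add, hneg, ← he]; ring
    rw [f2, hψ', this]; ring
  have f3' : F (1 / 2 + d * Complex.I / 2)
      = F q - r₃ * (e * Complex.exp ((Real.pi * (1 + b) : ℝ) * Complex.I)) := by
    rw [f3, he, ← Complex.exp_add, ← add_mul, ← Complex.ofReal_add,
      show κ + 2 * Real.pi * a * p = ψ + Real.pi * (1 + b) by linarith]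
  have f1' : F (1 / 2)
      = F p + r₁ * (e * Complex.exp ((-(Real.pi * (1 + a)) : ℝ) * Complex.I)) := by
    have : Complex.exp ((κ - 2 * Real.pi * b * y : ℝ) * Complex.I)
        = -(e * Complex.exp ((-(Real.pi * (1 + a)) : ℝ) * Complex.I)) := by
      rw [← mul_neg_one, ← hneg, he, ← Complex.exp_add, ← Complex.exp_add]
      congr 1
      rw [hψ]; push_cast; ring
    rw [f1, this]; ring
  have hR : F q = F p + (r₀ + m + r₂ : ℝ) * e := by
    push_cast
    linear_combination hmid + f0 - f2'
  obtain ⟨C, c₁, c₂, hc₁, hc₂, hC₁, hC₂, haff, ang₁, ang₂⟩ := exists_triangle he0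
    (show 0 < r₀ + m + r₂ by linarith) (A := Real.pi * (1 + a)) (B := Real.pi * (1 + b))
    (mul_pos hπ (by linarith)) (mul_pos hπ (by linarith)) (by nlinarith) hR
  have hc₁' : (c₁ : ℂ) ≠ 0 := by exact_mod_cast hc₁.ne'
  have hc₂' : (c₂ : ℂ) ≠ 0 := by exact_mod_cast hc₂.ne'
  refine ⟨C, haff, ang₁, ang₂, s1, s2, s3, s4, ?_, ?_, ⟨r₁ / c₁, by positivity, ?_⟩,
    ⟨r₃ / c₂, by positivity, ?_⟩⟩
  · exact sbtw_of_eq_add he0 hr₀ (by linarith) f0 hR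
  · exact sbtw_of_eq_add he0 (show 0 < r₀ + m by linarith) (by linarith)
      (by rw [hmid, f0]; push_cast; ring) hR
  · rw [f1', hC₁]
    push_cast
    field_simp
    ring
  · rw [f3', hC₂]
    push_cast
    field_simp
    ring

/-- The projected surface depends only on the values of the Gauss map in the open strip. -/
lemma planeProj_congr {d : ℝ} {G H : ℂ → ℂ} (hd : 0 < d)
    (h : ∀ w : ℂ, 0 < w.im → w.im < d / 2 → G w = H w) {z : ℂ} (h0 : 0 ≤ z.im)
    (h1 : z.im ≤ d / 2) : planeProj (d * Complex.I) G z = planeProj (d * Complex.I) H z := by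
  have hw : ∀ s : ℝ, 0 < s → s < 1 → G (d * Complex.I / 4 + s * (z - d * Complex.I / 4))
      = H (d * Complex.I / 4 + s * (z - d * Complex.I / 4)) := by
    intro s hs0 hs1
    have e : ((d * Complex.I / 4 + s * (z - d * Complex.I / 4) : ℂ)).im
        = (1 - s) * (d / 4) + s * z.im := by simp; ring
    have i1 : 0 < (1 - s) * (d / 4) := mul_pos (by linarith) (by linarith)
    have i2 := mul_nonneg hs0.le h0
    have i3 := mul_le_mul_of_nonneg_left h1 hs0.le
    exact h _ (by rw [e]; linarith) (by rw [e]; linarith)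
  have e1 := segmentIntegral_congr (f := fun w => 1 / 2 * (1 / G w - G w))
    (g := fun w => 1 / 2 * (1 / H w - H w)) (u := d * Complex.I / 4) (v := z)
    fun s h0 h1 => by simp only [hw s h0 h1]
  have e2 := segmentIntegral_congr (f := fun w => Complex.I / 2 * (1 / G w + G w))
    (g := fun w => Complex.I / 2 * (1 / H w + H w)) (u := d * Complex.I / 4) (v := z)
    fun s h0 h1 => by simp only [hw s h0 h1]
  simp only [planeProj, weierstrassMap, Matrix.cons_val_zero, Matrix.cons_val_one, e1, e2]

lemma image_planeProj_congr {d : ℝ} {G H : ℂ → ℂ} (hd : 0 < d)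
    (h : ∀ w : ℂ, 0 < w.im → w.im < d / 2 → G w = H w) {u v : ℂ} (hu : 0 ≤ u.im ∧ u.im ≤ d / 2)
    (hv : 0 ≤ v.im ∧ v.im ≤ d / 2) : planeProj (d * Complex.I) G '' segment ℝ u v
      = planeProj (d * Complex.I) H '' segment ℝ u v := by
  refine Set.image_congr fun z hz => ?_
  have hconv : Convex ℝ {z : ℂ | 0 ≤ z.im ∧ z.im ≤ d / 2} :=
    (convex_Icc (0 : ℝ) (d / 2)).linear_preimage Complex.imLm
  have hz' := hconv.segment_subset hu hv hz
  exact planeProj_congr hd h hz'.1 hz'.2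

lemma HingesLineUp.congr {d : ℝ} {G H : ℂ → ℂ} (hd : 0 < d)
    (h : ∀ w : ℂ, 0 < w.im → w.im < d / 2 → G w = H w) {a b p y : ℝ}
    (hH : HingesLineUp (d * Complex.I) a b p (y + d * Complex.I / 2) H) :
    HingesLineUp (d * Complex.I) a b p (y + d * Complex.I / 2) G := by
  have hd2 : 0 ≤ d / 2 := by positivity
  have F : ∀ z : ℂ, 0 ≤ z.im ∧ z.im ≤ d / 2 →
      planeProj (d * Complex.I) G z = planeProj (d * Complex.I) H z :=
    fun z hz => planeProj_congr hd h hz.1 hz.2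
  have m1 : 0 ≤ (p : ℂ).im ∧ (p : ℂ).im ≤ d / 2 := by simpa using hd2
  have m2 : 0 ≤ (-(p : ℂ)).im ∧ (-(p : ℂ)).im ≤ d / 2 := by simpa using hd2
  have m3 : 0 ≤ (1 - (p : ℂ)).im ∧ (1 - (p : ℂ)).im ≤ d / 2 := by simpa using hd2
  have m4 : 0 ≤ (0 : ℂ).im ∧ (0 : ℂ).im ≤ d / 2 := by simpa using hd2
  have m5 : 0 ≤ (1 / 2 : ℂ).im ∧ (1 / 2 : ℂ).im ≤ d / 2 := by
    have : (1 / 2 : ℂ).im = 0 := by simp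
    rw [this]; exact ⟨le_rfl, hd2⟩
  have m6 : 0 ≤ (y + d * Complex.I / 2 : ℂ).im ∧ (y + d * Complex.I / 2 : ℂ).im ≤ d / 2 := by
    simpa using hd2
  have m7 : 0 ≤ (mirror (y + d * Complex.I / 2)).im ∧
      (mirror (y + d * Complex.I / 2)).im ≤ d / 2 := by
    rw [mirror_upper]; simpa using hd2
  have m8 : 0 ≤ (1 + mirror (y + d * Complex.I / 2)).im ∧
      (1 + mirror (y + d * Complex.I / 2)).im ≤ d / 2 := by
    rw [mirror_upper]; simpa using hd2
  have m9 : 0 ≤ (d * Complex.I / 2 : ℂ).im ∧ (d * Complex.I / 2 : ℂ).im ≤ d / 2 := by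
    simpa using hd2
  have m10 : 0 ≤ (1 / 2 + d * Complex.I / 2 : ℂ).im ∧
      (1 / 2 + d * Complex.I / 2 : ℂ).im ≤ d / 2 := by
    rw [Complex.add_im]
    have : (1 / 2 : ℂ).im = 0 := by simp
    rw [this, zero_add]; exact m9
  rw [HingesLineUp] at hH ⊢
  rw [F _ m1, F _ m4, F _ m5, F _ m6, F _ m9, F _ m10, image_planeProj_congr hd h m2 m1,
    image_planeProj_congr hd h m1 m3, image_planeProj_congr hd h m7 m6,
    image_planeProj_congr hd h m6 m8]
  exact hH

theorem mainTheorem3 (τ : ℂ) (hτre : τ.re = 0) (hτim : 0 < τ.im)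
    (a b : ℝ) (ha : -1 < a) (ha' : a ≤ -(1 / 2)) (hb : -1 < b) (hb' : b ≤ -(1 / 2))
    (hab : a + b < -1) :
    ∃ (p : ℝ) (q : ℂ), 0 < p ∧ p < 1 / 2 ∧ 0 < q.re ∧ q.re < 1 / 2 ∧ q.im = τ.im / 2 ∧
      a * (2 * p - 1) + b * (2 * q.re - 1) = 1 ∧
      (∃ G : ℂ → ℂ, IsGaussMap τ a b p q G) ∧
      ∀ G : ℂ → ℂ, IsGaussMap τ a b p q G →
        segmentIntegral G 0 τ = 0 ∧ HingesLineUp τ a b p q G := by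
  obtain ⟨d, hd, rfl⟩ : ∃ d : ℝ, 0 < d ∧ τ = d * Complex.I :=
    ⟨τ.im, hτim, Complex.ext (by simp [hτre]) (by simp)⟩
  obtain ⟨p, y, hp0, hp1, hy0, hy1, h, hcos⟩ := exists_period_solution hd ha ha' hb hb' hab
  have hre : ((y : ℂ) + d * Complex.I / 2).re = y := by simp
  refine ⟨p, y + d * Complex.I / 2, hp0, hp1, by rwa [hre], by rwa [hre], by simp,
    by rwa [hre], exists_isGaussMap hd hp0 hp1 hy0 hy1 a b, fun G hG => ⟨?_, ?_⟩⟩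
  · exact hG.period_eq_zero hd hp0 hp1 hy0 hy1 h hcos
  · obtain ⟨⟨κ, hκ⟩, -⟩ := hG.eq_gaussModel hd hp0 hp1 hy0 hy1
    refine (hingesLineUp_gaussModel hd ha (by linarith) hb (by linarith) hab hp0 hp1 hy0 hy1 κ h
      hcos).congr hd fun w h0 h1 => hκ w ⟨mem_gaussDomain_of_inner h0 h1, h0.le, h1.le⟩
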